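/- **Setting.** Let $\Omega\subset\mathbb R^2$ be an open, bounded, connected polygonal domain with Lipschitz boundary, $1<p<2$, $1/p+1/p'=1$, $z\in\Omega$, $\kappa>0$ a constant, and let $\nu:\mathbb R\to\mathbb R$ satisfy $0<\nu_-\le\nu\le\nu_+$ and $|\nu(s_1)-\nu(s_2)|\le C_{\mathcal L}|s_1-s_2|$. Let $\mathbf f\in\mathbf H^1(\Omega)$. A triple $(\mathbf u,\mathsf p,T)\in \mathbf H_0(\mathrm{div},\Omega)\times L^2_0(\Omega)\times W^{1,p}_0(\Omega)$ is a solution if, for all $\mathbf v\in\mathbf H_0(\mathrm{div},\Omega)$, $\mathsf q\in L^2_0(\Omega)$, $S\in W_0^{1,p'}(\Omega)$, $$\int_\Omega(\nu(T)\mathbf u\cdot\mathbf v-\mathsf p\,\mathrm{div}\,\mathbf v)=\int_\Omega\mathbf f\cdot\mathbf v,\qquad \int_\Omega \mathsf q\,\mathrm{div}\,\mathbf u=0,\qquad \int_\Omega(\kappa\nabla T\cdot\nabla S-T\mathbf u\cdot\nabla S)=S(z).$$ Let $\mathbb T$ be a collection of conforming triangulations $\mathscr T_h$ of $\bar\Omega$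 by closed triangles $K$, with $h_K=\mathrm{diam}\,K$ and $h=\max_K h_K$, that is shape regular with parameter $\sigma$ (each $K$ contains a disc whose diameter is at least $h_K/\sigma$). Let $V_h$ be the continuous piecewise affine functions in $W_0^{1,p'}(\Omega)$, $\mathbf X_h$ the fields in $\mathbf H_0(\mathrm{div},\Omega)$ of the form $a_K\mathbf x+\mathbf b_K$ on each $K$, and $Q_h$ the piecewise constants in $L^2_0(\Omega)$. A discrete solution $(\mathbf u_h,\mathsf p_h,T_h)\in\mathbf X_h\times Q_h\times V_h$ satisfies the same three equations for all test functions in $\mathbf X_h\times Q_h\times V_h$. Put $\mathbf e_{\mathbf u}=\mathbf u-\mathbf u_h$, $e_T=T-T_h$. Let $C_e$ be the best constant in $\|w\|_{L^{2p/(2-p)}(\Omega)}\le C_e\|\nabla w\|_{\mathbf L^p(\Omega)}$ on $W_0^{1,p}(\Omega)$; let $C_\kappa$ be the best constant in $$\|\nabla R\|_{\mathbf L^p(\Omega)}\le C_\kappa\sup_{S\in W_0^{1,p'}(\Omega)}\frac{\int_\Omega\kappa\nabla R\cdot\nabla S}{\|\nabla S\|_{\mathbf L^{p'}(\Omega)}}\qquad\forall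 R\in W_0^{1,p}(\Omega),$$ and, for $h_\star>0$, let $\tilde C_\kappa$ be the best constant in the same inequality with $R,S\in V_h$, uniformly over the meshes of $\mathbb T$ with $h\le h_\star$ (a constant is $\infty$ if there is no finite one). Set $\mathfrak C=(2C_eC_\kappa)^{-1}$ and $\tilde{\mathfrak C}=(2C_e\tilde C_\kappa)^{-1}$, and let $\|\delta_z\|_{W^{-1,p}(\Omega)}=\sup_{S\in W_0^{1,p'}(\Omega)}|S(z)|/\|\nabla S\|_{\mathbf L^{p'}(\Omega)}$. For $K\in\mathscr T_h$ let $\mathscr S_K$ be the set of sides of $K$ shared with another triangle of $\mathscr T_h$, and let $\mathcal N_K$ consist of $K$ and the triangles that share a side with $K$ (also used for their union). For an internal side $\gamma$ shared by $K^\pm$, let $[\![\mathbf w\cdot\boldsymbol\tau]\!]=\boldsymbol\tau^+\cdot\mathbf w|_{K^+}+\boldsymbol\tau^-\cdot\mathbf w|_{K^-}$ on $\gamma$, in the sense of traces, where $\boldsymbol\tau^+=-\boldsymbol\tau^-$ is a unit tangent to $\gamma$. Let $\mathbf{curl}\,\mathbf w=\partial_1w_2-\partial_2w_1$, let $\mathscr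 P_K\mathbf f$ be the $\mathbf L^2(K)$-orthogonal projection of $\mathbf f$ onto the constants (in $[\![(\mathbf f-\mathscr P_K\mathbf f)\cdot\boldsymbol\tau]\!]$ each side of $\gamma$ takes its own projection), and $$\mathfrak E_K=\Big(h_K^2\|\mathbf{curl}(\mathbf f-\nu(T_h)\mathbf u_h)\|^2_{L^2(K)}+h_K\sum_{\gamma\in\mathscr S_K}\|[\![(\mathbf f-\nu(T_h)\mathbf u_h)\cdot\boldsymbol\tau]\!]\|^2_{L^2(\gamma)}\Big)^{1/2}.$$ **Theorem.** Let $k\in\mathbb N$. There is a finite constant $C$, depending only on $\Omega,p,z,\kappa,\nu_-,\nu_+,C_{\mathcal L},\sigma,k$, such that the following holds. Let $\|\mathbf f\|_{\mathbf L^2(\Omega)}\le\nu_-\min\{\mathfrak C,\tilde{\mathfrak C}\}$, let $(\mathbf u,\mathsf p,T)$ be a solution, let $\mathscr T_h\in\mathbb T$ with $h\le h_\star$, and let $(\mathbf u_h,\mathsf p_h,T_h)$ be a discrete solution. Assume that, for some $\rho,\varrho\in(0,1)$, $$\mathfrak C^{-1}\|\mathbf e_{\mathbf u}\|_{\mathbf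 L^2(\Omega)}\le\rho,\qquad C_{\mathcal L}\|\delta_z\|_{W^{-1,p}(\Omega)}\|\mathbf u\|_{\mathbf L^{p'}(\Omega)}\le\varrho(1-\rho)\nu_-\mathfrak C^2,$$ and that, for each $K\in\mathscr T_h$, $\nu(T_h)|_K$ is a polynomial of degree at most $k$. Then, for every $K\in\mathscr T_h$, $$\mathfrak E_K\le C\Big(\|\mathbf e_{\mathbf u}\|_{\mathbf L^2(\mathcal N_K)}+\sum_{K'\in\mathcal N_K}h_{K'}\|\mathbf{curl}(\mathbf f-\mathscr P_{K'}\mathbf f)\|_{L^2(K')}+\|e_T\|_{L^{2p/(2-p)}(\mathcal N_K)}+\sum_{\gamma\in\mathscr S_K}h_K^{1/2}\|[\![(\mathbf f-\mathscr P_K\mathbf f)\cdot\boldsymbol\tau]\!]\|_{L^2(\gamma)}\Big).$$ -/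

import Mathlib

open MeasureTheory Filter Topology
open scoped ENNReal NNReal ContDiff

noncomputable section

namespace DarcyHeat

/-- The Euclidean plane. -/
abbrev E : Type := EuclideanSpace ℝ (Fin 2)

/-! ### The domain -/

/-- `Ω` lies, near each of its boundary points and in suitable Cartesian coordinates, strictly below
the graph of a Lipschitz function. -/
def HasLipschitzBoundary (Ω : Set E) : Prop :=
  ∀ x ∈ frontier Ω, ∃ r > 0, ∃ (A : E ≃ₗᵢ[ℝ] E) (g : ℝ → ℝ) (L : ℝ≥0), LipschitzWith L g ∧
    ∀ y ∈ Metric.ball x r, (y ∈ Ω ↔ (A y) 1 < g ((A y) 0))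

/-- An open, bounded, connected polygonal domain with Lipschitz boundary. -/
structure IsPolygonalLipschitzDomain (Ω : Set E) : Prop where
  isOpen : IsOpen Ω
  isConnected : IsConnected Ω
  isBounded : Bornology.IsBounded Ω
  lipschitz : HasLipschitzBoundary Ω
  polygonal : ∃ s : Finset (E × E), frontier Ω ⊆ ⋃ e ∈ s, segment ℝ e.1 e.2

/-! ### Function spaces

Functions on `Ω` are functions on the plane of which only the values in `Ω` matter, up to null
sets unless continuity is asked for. -/

/-- Smooth functions with compact support in the open set `U`. -/
def IsTest (U : Set E) (φ : E → ℝ) : Prop :=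
  ContDiff ℝ ∞ φ ∧ HasCompactSupport φ ∧ tsupport φ ⊆ U

/-- `G` is the weak gradient of `w` in `U`. -/
def HasWeakGradient (U : Set E) (w : E → ℝ) (G : E → E) : Prop :=
  LocallyIntegrableOn w U ∧ LocallyIntegrableOn G U ∧
    ∀ φ, IsTest U φ → ∀ v : E,
      ∫ x in U, w x * fderiv ℝ φ x v = - ∫ x in U, inner ℝ (G x) v * φ x

/-- `w ∈ W^{1,r}(U)`, with weak gradient `G`. -/
def MemW (U : Set E) (r : ℝ≥0∞) (w : E → ℝ) (G : E → E) : Prop :=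
  MemLp w r (volume.restrict U) ∧ MemLp G r (volume.restrict U) ∧ HasWeakGradient U w G

/-- `w ∈ W_0^{1,r}(U)`, the closure of the test functions in `W^{1,r}(U)`, with weak
gradient `G`. -/
def MemW0 (U : Set E) (r : ℝ≥0∞) (w : E → ℝ) (G : E → E) : Prop :=
  MemW U r w G ∧ ∃ φ : ℕ → E → ℝ, (∀ n, IsTest U (φ n)) ∧
    Tendsto (fun n => eLpNorm (w - φ n) r (volume.restrict U)) atTop (𝓝 0) ∧
    Tendsto (fun n => eLpNorm (G - gradient (φ n)) r (volume.restrict U)) atTop (𝓝 0)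

/-- The vector field `f` belongs to `H¹(U)²`. -/
def MemH1Vec (U : Set E) (f : E → E) : Prop :=
  ∀ i : Fin 2, ∃ G : E → E, MemW U 2 (fun x => f x i) G

/-- `v ∈ H_0(div, U)`, with weak divergence `d`. The last clause says, for all `φ` in
`C^∞` up to the boundary, that the normal trace
`⟨v · n, φ⟩ = ∫_U (v · ∇φ + φ div v)` vanishes; it contains the definition of the weak
divergence as the case of test functions `φ`. -/
def MemH0div (U : Set E) (v : E → E) (d : E → ℝ) : Prop :=
  MemLp v 2 (volume.restrict U) ∧ MemLp d 2 (volume.restrict U) ∧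
    ∀ φ : E → ℝ, ContDiff ℝ ∞ φ → HasCompactSupport φ →
      ∫ x in U, (inner ℝ (v x) (gradient φ x) + d x * φ x) = 0

/-- `q ∈ L²_0(U)`. -/
def MemL20 (U : Set E) (q : E → ℝ) : Prop :=
  MemLp q 2 (volume.restrict U) ∧ ∫ x in U, q x = 0

/-- The vector curl `(∂₂φ, -∂₁φ)` of a scalar function. -/
def curlS (φ : E → ℝ) (x : E) : E :=
  !₂[fderiv ℝ φ x (EuclideanSpace.single 1 1), - fderiv ℝ φ x (EuclideanSpace.single 0 1)]

/-- `c` is the weak scalar curl `∂₁w₂ - ∂₂w₁` of the vector field `w` in `U`. -/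
def HasWeakCurl (U : Set E) (w : E → E) (c : E → ℝ) : Prop :=
  LocallyIntegrableOn w U ∧ LocallyIntegrableOn c U ∧
    ∀ φ, IsTest U φ → ∫ x in U, inner ℝ (w x) (curlS φ x) = ∫ x in U, c x * φ x

/-- `‖curl w‖_{L²(U)}`, with value `∞` if `w` has no weak curl. (The weak curl is unique up to null
sets.) -/
def curlNorm (U : Set E) (w : E → E) : ℝ≥0∞ :=
  ⨅ (c : E → ℝ) (_ : HasWeakCurl U w c), eLpNorm c 2 (volume.restrict U)

/-! ### Exponents -/

/-- The Hölder conjugate exponent `p' = p / (p - 1)`. -/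
def conjExp (p : ℝ) : ℝ≥0∞ := ENNReal.ofReal (p / (p - 1))

/-- The Sobolev exponent `2p / (2 - p)`. -/
def sobExp (p : ℝ) : ℝ≥0∞ := ENNReal.ofReal (2 * p / (2 - p))

/-! ### The continuous problem -/

/-- `(u, P, T)` is a weak solution of the coupled problem with viscosity `ν`, diffusivity `κ`, force
`f` and heat source `δ_z`. Elements of `W_0^{1,p'}(Ω)`, `p' > 2`, enter through their continuous
representatives, so that `⟨δ_z, S⟩ = S z`. -/
def IsWeakSolution (Ω : Set E) (p : ℝ) (ν κ : ℝ → ℝ) (f : E → E) (z : E)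
    (u : E → E) (P T : E → ℝ) : Prop :=
  ∃ (du : E → ℝ) (GT : E → E),
    MemH0div Ω u du ∧ MemL20 Ω P ∧ MemW0 Ω (ENNReal.ofReal p) T GT ∧
    (∀ v d, MemH0div Ω v d →
      ∫ x in Ω, (ν (T x) * inner ℝ (u x) (v x) - P x * d x) = ∫ x in Ω, inner ℝ (f x) (v x)) ∧
    (∀ q, MemL20 Ω q → ∫ x in Ω, q x * du x = 0) ∧
    (∀ S GS, MemW0 Ω (conjExp p) S GS → ContinuousOn S Ω →
      ∫ x in Ω, (κ (T x) * inner ℝ (GT x) (GS x) - T x * inner ℝ (u x) (GS x)) = S z)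

/-! ### Meshes -/

/-- A conforming triangulation of the closure of `Ω`. A triangle is given by the set of its three
vertices. -/
structure Mesh (Ω : Set E) where
  elems : Finset (Finset E)
  card_eq : ∀ K ∈ elems, K.card = 3
  indep : ∀ K ∈ elems, AffineIndependent ℝ ((↑) : {x // x ∈ K} → E)
  conforming : ∀ K ∈ elems, ∀ K' ∈ elems,
    convexHull ℝ (K : Set E) ∩ convexHull ℝ (K' : Set E) = convexHull ℝ ((K : Set E) ∩ (K' : Set E))
  cover : ⋃ K ∈ elems, convexHull ℝ (K : Set E) = closure Ω

/-- The closed triangle (or segment) with the given vertices. -/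
def hull (K : Finset E) : Set E := convexHull ℝ (K : Set E)

/-- `h_K = diam K`. -/
def hK (K : Finset E) : ℝ := Metric.diam (hull K)

/-- The mesh size `h = max_K h_K`. -/
def Mesh.size {Ω : Set E} (𝒯 : Mesh Ω) : ℝ≥0 := 𝒯.elems.sup fun K => (hK K).toNNReal

/-- All triangles of all meshes of the collection have an aspect ratio (the diameter of the
triangle over the diameter of an inscribed disc) of at most `σ`. -/
def ShapeRegular {Ω : Set E} (σ : ℝ) (𝕋 : Set (Mesh Ω)) : Prop :=
  ∀ 𝒯 ∈ 𝕋, ∀ K ∈ 𝒯.elems, ∃ (c : E) (r : ℝ), 0 < r ∧ Metric.ball c r ⊆ hull K ∧ hK K ≤ σ * (2 * r)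

/-- `γ` is an internal side: a side of two different triangles. -/
def Mesh.IsInternalSide {Ω : Set E} (𝒯 : Mesh Ω) (γ : Finset E) : Prop :=
  γ.card = 2 ∧ ∃ K ∈ 𝒯.elems, ∃ K' ∈ 𝒯.elems, K ≠ K' ∧ γ ⊆ K ∧ γ ⊆ K'

open scoped Classical in
/-- `𝒮_K`: the internal sides which are sides of `K`. -/
def Mesh.sides {Ω : Set E} (𝒯 : Mesh Ω) (K : Finset E) : Finset (Finset E) :=
  (K.powersetCard 2).filter 𝒯.IsInternalSide

open scoped Classical in
/-- `𝒩_K`: the triangle `K` and the triangles that share an internal side with it. -/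
def Mesh.patch {Ω : Set E} (𝒯 : Mesh Ω) (K : Finset E) : Finset (Finset E) :=
  𝒯.elems.filter fun K' => K' = K ∨ (𝒯.sides K ∩ 𝒯.sides K').Nonempty

/-- The union of the triangles in `𝒩_K`. -/
def Mesh.patchSet {Ω : Set E} (𝒯 : Mesh Ω) (K : Finset E) : Set E :=
  ⋃ K' ∈ 𝒯.patch K, hull K'

/-! ### The discrete problem -/

/-- `S ∈ V_h`, with weak gradient `G`: continuous on the closure of `Ω`, affine on each triangle, and
in `W_0^{1,p'}(Ω)`. -/
def Mesh.MemV {Ω : Set E} (𝒯 : Mesh Ω) (p : ℝ) (S : E → ℝ) (G : E → E) : Prop :=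
  ContinuousOn S (closure Ω) ∧
    (∀ K ∈ 𝒯.elems, ∃ (a : ℝ) (b : E), ∀ x ∈ hull K, S x = a + inner ℝ b x) ∧
    MemW0 Ω (conjExp p) S G

/-- `v ∈ X_h`, with weak divergence `d`: lowest order Raviart–Thomas fields in `H_0(div, Ω)`. -/
def Mesh.MemX {Ω : Set E} (𝒯 : Mesh Ω) (v : E → E) (d : E → ℝ) : Prop :=
  MemH0div Ω v d ∧
    ∀ K ∈ 𝒯.elems, ∃ (a : ℝ) (b : E), ∀ᵐ x ∂(volume.restrict (hull K)), v x = a • x + b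

/-- `q ∈ Q_h`: piecewise constant functions in `L²_0(Ω)`. -/
def Mesh.MemQ {Ω : Set E} (𝒯 : Mesh Ω) (q : E → ℝ) : Prop :=
  MemL20 Ω q ∧ ∀ K ∈ 𝒯.elems, ∃ a : ℝ, ∀ᵐ x ∂(volume.restrict (hull K)), q x = a

/-- `(u, P, T) ∈ X_h × Q_h × V_h` solves the discrete system. -/
def Mesh.IsDiscreteSolution {Ω : Set E} (𝒯 : Mesh Ω) (p : ℝ) (ν κ : ℝ → ℝ) (f : E → E) (z : E)
    (u : E → E) (P T : E → ℝ) : Prop :=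
  ∃ (du : E → ℝ) (GT : E → E),
    𝒯.MemX u du ∧ 𝒯.MemQ P ∧ 𝒯.MemV p T GT ∧
    (∀ v d, 𝒯.MemX v d →
      ∫ x in Ω, (ν (T x) * inner ℝ (u x) (v x) - P x * d x) = ∫ x in Ω, inner ℝ (f x) (v x)) ∧
    (∀ q, 𝒯.MemQ q → ∫ x in Ω, q x * du x = 0) ∧
    (∀ S GS, 𝒯.MemV p S GS →
      ∫ x in Ω, (κ (T x) * inner ℝ (GT x) (GS x) - T x * inner ℝ (u x) (GS x)) = S z)

/-! ### The constants of the smallness hypotheses -/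

/-- `C_e`: the best constant in `‖w‖_{L^{2p/(2-p)}(Ω)} ≤ C ‖∇w‖_{L^p(Ω)}`, `w ∈ W_0^{1,p}(Ω)`. -/
def sobolevConst (Ω : Set E) (p : ℝ) : ℝ≥0∞ :=
  sInf {C | ∀ w G, MemW0 Ω (ENNReal.ofReal p) w G →
    eLpNorm w (sobExp p) (volume.restrict Ω) ≤
      C * eLpNorm G (ENNReal.ofReal p) (volume.restrict Ω)}

/-- `C_κ`: the best constant in the inf-sup condition
`‖∇R‖_{L^p} ≤ C sup_S (∫ κ ∇R · ∇S) / ‖∇S‖_{L^{p'}}`, with `R ∈ W_0^{1,p}(Ω)` and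
`S ∈ W_0^{1,p'}(Ω)`. -/
def infSupConst (Ω : Set E) (p κ : ℝ) : ℝ≥0∞ :=
  sInf {C | ∀ R GR, MemW0 Ω (ENNReal.ofReal p) R GR →
    eLpNorm GR (ENNReal.ofReal p) (volume.restrict Ω) ≤
      C * ⨆ (S : E → ℝ) (GS : E → E) (_ : MemW0 Ω (conjExp p) S GS),
        ENNReal.ofReal (∫ x in Ω, κ * inner ℝ (GR x) (GS x)) /
          eLpNorm GS (conjExp p) (volume.restrict Ω)}

/-- `C̃_κ`: the best constant in the inf-sup condition on the spaces `V_h`, uniformly over the meshes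
of the collection with `h ≤ h⋆`. -/
def discreteInfSupConst {Ω : Set E} (𝕋 : Set (Mesh Ω)) (hstar p κ : ℝ) : ℝ≥0∞ :=
  sInf {C | ∀ 𝒯 ∈ 𝕋, 𝒯.size ≤ hstar → ∀ R GR, 𝒯.MemV p R GR →
    eLpNorm GR (ENNReal.ofReal p) (volume.restrict Ω) ≤
      C * ⨆ (S : E → ℝ) (GS : E → E) (_ : 𝒯.MemV p S GS),
        ENNReal.ofReal (∫ x in Ω, κ * inner ℝ (GR x) (GS x)) /
          eLpNorm GS (conjExp p) (volume.restrict Ω)}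

/-- `𝔠 = (2 C_e C_κ)⁻¹`. -/
def smallConst (Ω : Set E) (p κ : ℝ) : ℝ≥0∞ :=
  (2 * sobolevConst Ω p * infSupConst Ω p κ)⁻¹

/-- `𝔠̃ = (2 C_e C̃_κ)⁻¹`. -/
def discreteSmallConst {Ω : Set E} (𝕋 : Set (Mesh Ω)) (hstar p κ : ℝ) : ℝ≥0∞ :=
  (2 * sobolevConst Ω p * discreteInfSupConst 𝕋 hstar p κ)⁻¹

/-- `‖δ_z‖_{W^{-1,p}(Ω)}`, the norm dual to `‖∇·‖_{L^{p'}(Ω)}` on `W_0^{1,p'}(Ω)`. -/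
def diracNorm (Ω : Set E) (p : ℝ) (z : E) : ℝ≥0∞ :=
  ⨆ (S : E → ℝ) (G : E → E) (_ : MemW0 Ω (conjExp p) S G ∧ ContinuousOn S Ω),
    ‖S z‖ₑ / eLpNorm G (conjExp p) (volume.restrict Ω)

/-! ### Traces, jumps and the indicator -/

/-- The arc length on the side `γ`. -/
def sideMeasure (γ : Finset E) : Measure E := (μH[1]).restrict (hull γ)

/-- `g ∈ L²(γ)²` is the trace on the side `γ` of the vector field `w ∈ H¹(K)²`: smooth fields converge
to `w` in `H¹(K)²` while their restrictions to `γ` converge to `g` in `L²(γ)²`. -/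
def IsTrace (K γ : Finset E) (w g : E → E) : Prop :=
  MemLp w 2 (volume.restrict (hull K)) ∧ MemLp g 2 (sideMeasure γ) ∧
    ∃ D : E → E →L[ℝ] E, MemLp D 2 (volume.restrict (hull K)) ∧
      ∃ φ : ℕ → E → E, (∀ n, ContDiff ℝ ∞ (φ n)) ∧
        Tendsto (fun n => eLpNorm (φ n - w) 2 (volume.restrict (hull K))) atTop (𝓝 0) ∧
        Tendsto (fun n => eLpNorm (fderiv ℝ (φ n) - D) 2 (volume.restrict (hull K))) atTop (𝓝 0) ∧
        Tendsto (fun n => eLpNorm (φ n - g) 2 (sideMeasure γ)) atTop (𝓝 0)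

/-- `j = τ⁺ · w|_{K⁺} + τ⁻ · w|_{K⁻}` is the tangential jump across the internal side `γ`, where
`τ⁺ = -τ⁻` is a unit tangent to `γ`, of the broken field whose restriction to a triangle `K` is
`w K`. -/
def Mesh.IsTangentialJump {Ω : Set E} (𝒯 : Mesh Ω) (γ : Finset E) (w : Finset E → E → E)
    (j : E → ℝ) : Prop :=
  ∃ Kp ∈ 𝒯.elems, ∃ Km ∈ 𝒯.elems, Kp ≠ Km ∧ γ ⊆ Kp ∧ γ ⊆ Km ∧
    ∃ a ∈ γ, ∃ b ∈ γ, a ≠ b ∧ ∃ gp gm : E → E, IsTrace Kp γ (w Kp) gp ∧ IsTrace Km γ (w Km) gm ∧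
      ∀ x, j x = inner ℝ (‖b - a‖⁻¹ • (b - a)) (gp x) + inner ℝ (-(‖b - a‖⁻¹ • (b - a))) (gm x)

/-- `‖⟦w · τ⟧‖_{L²(γ)}`, with value `∞` if `w` has no traces on `γ`. (Traces are unique up to null
sets, and the jump up to its sign.) -/
def Mesh.jumpNorm {Ω : Set E} (𝒯 : Mesh Ω) (γ : Finset E) (w : Finset E → E → E) : ℝ≥0∞ :=
  ⨅ (j : E → ℝ) (_ : 𝒯.IsTangentialJump γ w j), eLpNorm j 2 (sideMeasure γ)

/-- The indicator `𝔈_K = (h_K² ‖curl r‖²_{L²(K)} + h_K ∑_{γ ∈ 𝒮_K} ‖⟦r · τ⟧‖²_{L²(γ)})^{1/2}` with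
`r = f - ν(T_h) u_h`. -/
def Mesh.curlIndicator {Ω : Set E} (𝒯 : Mesh Ω) (ν : ℝ → ℝ) (f uh : E → E) (Th : E → ℝ)
    (K : Finset E) : ℝ≥0∞ :=
  (ENNReal.ofReal (hK K) ^ 2 *
      curlNorm (interior (hull K)) (fun x => f x - ν (Th x) • uh x) ^ 2 +
    ENNReal.ofReal (hK K) *
      ∑ γ ∈ 𝒯.sides K, 𝒯.jumpNorm γ (fun _ x => f x - ν (Th x) • uh x) ^ 2) ^ (1 / 2 : ℝ)

/-- `f - 𝒫_K f` on the triangle `K`, where `𝒫_K f`, the `L²(K)`-orthogonal projection of `f` onto the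
constants, is the mean value of `f` over `K`. -/
def osc (f : E → E) (K : Finset E) (x : E) : E := f x - ⨍ y in hull K, f y

/-- `w` coincides on `K` with a polynomial of total degree at most `k`. -/
def IsPolynomialOn (k : ℕ) (K : Finset E) (w : E → ℝ) : Prop :=
  ∃ P : MvPolynomial (Fin 2) ℝ, P.totalDegree ≤ k ∧
    ∀ x ∈ hull K, w x = MvPolynomial.eval (fun i => x i) P

end DarcyHeat

end

/-! The residual `r = f - ν(T_h) u_h` is tested with vector curls. If `φ` is smooth with compact
support in the patch, then `curlS φ` is divergence free and lies in `H_0(div)`, so the pressure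
drops out of the momentum equation and `∫ r · curl φ = ∫ (ν(T) u - ν(T_h) u_h) · curl φ`. Splitting
the flux difference as `ν(T_h)(u - u_h) + (ν(T) - ν(T_h)) u` and applying Hölder with exponents
`2p/(2-p)` and `p'` bounds this by `A ‖curl φ‖`, where `A = ν₊ ‖e_u‖ + M ‖e_T‖` on the patch
(`eLpNorm_residual_le`). Here `M` bounds `C_L ‖u‖_{p'}`. It comes from the second smallness
hypothesis, because `𝔠` is finite and `‖δ_z‖` is not zero (`exists_velocity_bound`).

The converse estimates follow Verfürth's bubble technique. On each triangle `r` is the oscillation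
of `f` plus a polynomial field of degree at most `k + 1`, so its curl and its tangential jumps split
into a data part and a polynomial part. Testing with a squared cut-off times the polynomial part
controls that part, since all norms on a space of polynomials of bounded degree are equivalent.
`exists_element_bound` does this for the curl and `Mesh.exists_jumpNorm_bound` for the jumps. The
latter rests on Green's formula in the two adjacent triangles and uses the curl bounds on both.

Uniformity in the mesh comes from placing the cut-offs on discs: an inscribed disc for the curl, a
disc about the midpoint of the side for a jump. Barycentric coordinates of a triangle that contains
a disc of radius `r` are Lipschitz with constant `1/(2r)`, so within distance `r` of the midpoint of
a side the triangle is exactly a half disc (`hull_eq_halfPlane_near_midpoint`). Hence similarities,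
whose scaling factors are explicit, carry everything to the unit disc, and Green's formula is needed
in a half plane only. -/

noncomputable section

namespace DarcyHeat

/-! ### Polynomial functions on the plane -/

/-- The function on the plane defined by a polynomial in two variables. -/
def polyFun (p : MvPolynomial (Fin 2) ℝ) (x : E) : ℝ := MvPolynomial.eval (fun i => x i) p

theorem polyFun_add (p q : MvPolynomial (Fin 2) ℝ) : polyFun (p + q) = polyFun p + polyFun q := by
  ext x; simp [polyFun]

theorem polyFun_smul (c : ℝ) (p : MvPolynomial (Fin 2) ℝ) : polyFun (c • p) = c • polyFun p := by
  ext x; simp [polyFun, MvPolynomial.smul_eval]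

theorem contDiff_polyFun (p : MvPolynomial (Fin 2) ℝ) : ContDiff ℝ ∞ (polyFun p) := by
  induction p using MvPolynomial.induction_on with
  | C a =>
    have : polyFun (MvPolynomial.C a) = fun _ => a := by ext; simp [polyFun]
    rw [this]
    exact contDiff_const
  | add p q hp hq => rw [polyFun_add]; exact hp.add hq
  | mul_X p i hp =>
    have : polyFun (p * MvPolynomial.X i) = fun x => polyFun p x * x i := by
      ext x; simp [polyFun]
    rw [this]
    exact hp.mul (by fun_prop)

theorem fderiv_polyFun (p : MvPolynomial (Fin 2) ℝ) (x : E) (i : Fin 2) :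
    fderiv ℝ (polyFun p) x (EuclideanSpace.single i 1) =
      polyFun (MvPolynomial.pderiv i p) x := by
  induction p using MvPolynomial.induction_on with
  | C a =>
    have : polyFun (MvPolynomial.C a) = fun _ => a := by ext; simp [polyFun]
    simp [this]
    simp [polyFun]
  | add p q hp hq =>
    rw [polyFun_add, map_add, polyFun_add, fderiv_add
      ((contDiff_polyFun p).differentiable (by simp) x)
      ((contDiff_polyFun q).differentiable (by simp) x)]
    simp [hp, hq]
  | mul_X p j hp =>
    have h1 : polyFun (p * MvPolynomial.X j) = fun x => polyFun p x * x j := by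
      ext x; simp [polyFun]
    have h2 : HasFDerivAt (fun x : E => x j) (EuclideanSpace.proj j : E →L[ℝ] ℝ) x :=
      (EuclideanSpace.proj j : E →L[ℝ] ℝ).hasFDerivAt
    have h3 := ((contDiff_polyFun p).differentiable (by simp) x).hasFDerivAt.mul h2
    rw [h1, show (fun x : E => polyFun p x * x j) = polyFun p * fun x => x j from rfl, h3.fderiv]
    simp [polyFun, hp, MvPolynomial.pderiv_X, Pi.single_apply]
    split_ifs <;> simp

theorem totalDegree_pderiv_le (p : MvPolynomial (Fin 2) ℝ) (i : Fin 2) :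
    (MvPolynomial.pderiv i p).totalDegree ≤ p.totalDegree := by
  conv_lhs => rw [p.as_sum, map_sum]
  refine MvPolynomial.totalDegree_finsetSum_le fun d hd => ?_
  rw [MvPolynomial.pderiv_monomial]
  refine (MvPolynomial.totalDegree_monomial_le _ _).trans
    (le_trans ?_ (MvPolynomial.le_totalDegree hd))
  have h : d - Finsupp.single i 1 ≤ d := tsub_le_self
  rw [Finsupp.sum_fintype _ _ (by simp), Finsupp.sum_fintype _ _ (by simp)]
  exact Finset.sum_le_sum fun j _ => h j

/-- Affine changes of variables keep the degree, so one polynomial space on the reference disc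
serves triangles of every size and orientation. -/
theorem totalDegree_bind₁_le {p : MvPolynomial (Fin 2) ℝ} {g : Fin 2 → MvPolynomial (Fin 2) ℝ}
    (hg : ∀ i, (g i).totalDegree ≤ 1) :
    (MvPolynomial.bind₁ g p).totalDegree ≤ p.totalDegree := by
  conv_lhs => rw [p.as_sum, map_sum]
  refine MvPolynomial.totalDegree_finsetSum_le fun d hd => ?_
  rw [MvPolynomial.bind₁_monomial]
  refine (MvPolynomial.totalDegree_mul _ _).trans ?_
  rw [MvPolynomial.totalDegree_C, zero_add]
  refine (MvPolynomial.totalDegree_finsetProd _ _).trans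
    (le_trans ?_ (MvPolynomial.le_totalDegree hd))
  refine Finset.sum_le_sum fun j _ => (MvPolynomial.totalDegree_pow _ _).trans ?_
  simpa using Nat.mul_le_mul_left (d j) (hg j)

/-! ### Equivalence of norms on finite dimensional spaces of functions -/

/-- `T` is injective into `L²` and its range is finite dimensional, so `T' ∘ T⁻¹` is automatically
continuous there; `C` is its operator norm. -/
theorem exists_eLpNorm_le_mul {W α β F F' : Type*} [AddCommGroup W] [Module ℝ W]
    [FiniteDimensional ℝ W] [MeasurableSpace α] [MeasurableSpace β]
    [NormedAddCommGroup F] [NormedSpace ℝ F] [NormedAddCommGroup F'] [NormedSpace ℝ F']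
    {μ : Measure α} {μ' : Measure β} (T : W →ₗ[ℝ] α → F) (T' : W →ₗ[ℝ] β → F')
    (hT : ∀ w, MemLp (T w) 2 μ) (hT' : ∀ w, MemLp (T' w) 2 μ')
    (inj : ∀ w, T w =ᵐ[μ] 0 → w = 0) :
    ∃ C : ℝ≥0, ∀ w, eLpNorm (T' w) 2 μ' ≤ C * eLpNorm (T w) 2 μ := by
  let L : W →ₗ[ℝ] Lp F 2 μ :=
    { toFun := fun w => (hT w).toLp
      map_add' := fun v w => by
        rw [← MemLp.toLp_add]; exact MemLp.toLp_congr _ _ (by rw [map_add])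
      map_smul' := fun c w => by
        simp only [RingHom.id_apply]
        rw [← MemLp.toLp_const_smul]; exact MemLp.toLp_congr _ _ (by rw [map_smul]) }
  let L' : W →ₗ[ℝ] Lp F' 2 μ' :=
    { toFun := fun w => (hT' w).toLp
      map_add' := fun v w => by
        rw [← MemLp.toLp_add]; exact MemLp.toLp_congr _ _ (by rw [map_add])
      map_smul' := fun c w => by
        simp only [RingHom.id_apply]
        rw [← MemLp.toLp_const_smul]; exact MemLp.toLp_congr _ _ (by rw [map_smul]) }
  have hL : Function.Injective L := by
    rw [← LinearMap.ker_eq_bot, LinearMap.ker_eq_bot']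
    intro w hw
    apply inj
    have h : (hT w).toLp = 0 := hw
    exact (hT w).coeFn_toLp.symm.trans (by rw [h]; exact Lp.coeFn_zero _ _ _)
  let e := LinearEquiv.ofInjective L hL
  have : FiniteDimensional ℝ L.range := e.finiteDimensional
  let M : L.range →L[ℝ] Lp F' 2 μ' := (L' ∘ₗ e.symm.toLinearMap).toContinuousLinearMap
  refine ⟨‖M‖₊, fun w => ?_⟩
  have h := M.le_opENorm (e w)
  have h1 : M (e w) = L' w := by simp [M]
  have h2 : ‖e w‖ₑ = ‖L w‖ₑ := rfl
  rw [h1, h2] at h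
  simpa [L, L', Lp.enorm_toLp] using! h

theorem memLp_restrict_of_continuous {X F : Type*} [TopologicalSpace X] [MeasurableSpace X]
    [BorelSpace X] [SecondCountableTopology X]
    [NormedAddCommGroup F] {μ : Measure X} [IsFiniteMeasureOnCompacts μ] [T2Space X]
    {s : Set X} (hs : IsCompact s) {g : X → F} (hg : Continuous g) (q : ℝ≥0∞) :
    MemLp g q (μ.restrict s) := by
  obtain ⟨C, hC⟩ := hs.exists_bound_of_continuousOn hg.continuousOn
  have : IsFiniteMeasure (μ.restrict s) := ⟨by simpa using hs.measure_lt_top⟩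
  exact MemLp.of_bound (hg.continuousOn.aestronglyMeasurable_of_isCompact hs hs.measurableSet) C
    (ae_restrict_of_forall_mem hs.measurableSet hC)

/-! ### The reference bubble functions -/

/-- A smooth cut-off function supported in the unit disc. -/
def bump : ContDiffBump (0 : E) := ⟨1 / 4, 1 / 2, by norm_num, by norm_num⟩

theorem contDiff_bump : ContDiff ℝ ∞ (bump : E → ℝ) := bump.contDiff

theorem tsupport_bump : tsupport (bump : E → ℝ) ⊆ Metric.ball 0 1 := by
  rw [bump.tsupport_eq]
  exact Metric.closedBall_subset_ball (by norm_num [bump])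

theorem bump_eq_one {x : E} (hx : ‖x‖ ≤ 1 / 4) : bump x = 1 :=
  bump.one_of_mem_closedBall (by simpa [bump] using hx)

/-- The disc contains the square `(-1/8, 1/8)²`, since `√2/8 < 1/4`, and a polynomial that vanishes
on a product of infinite sets is zero. -/
theorem polyFun_eq_zero {p : MvPolynomial (Fin 2) ℝ}
    (h : ∀ x ∈ Metric.ball (0 : E) (1 / 4), polyFun p x = 0) : p = 0 := by
  refine MvPolynomial.funext_set (fun _ => Set.Ioo (-(1 / 8) : ℝ) (1 / 8))
    (fun _ => Set.Ioo_infinite (by norm_num)) fun x hx => ?_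
  have := h (WithLp.toLp 2 x) (by
    have h0 := hx 0 trivial
    have h1 := hx 1 trivial
    simp only [Set.mem_Ioo] at h0 h1
    rw [mem_ball_zero_iff, EuclideanSpace.norm_eq]
    apply Real.sqrt_lt' (by norm_num) |>.2
    simp [Fin.sum_univ_two]
    nlinarith)
  simpa [polyFun] using! this

/-- The square of the cut-off function times `g`. -/
def bubble (g : E → ℝ) (x : E) : ℝ := bump x ^ 2 * g x

theorem contDiff_bubble {g : E → ℝ} (hg : ContDiff ℝ ∞ g) : ContDiff ℝ ∞ (bubble g) :=
  (contDiff_bump.pow 2).mul hg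

theorem tsupport_bubble (g : E → ℝ) : tsupport (bubble g) ⊆ Metric.ball 0 1 := by
  refine (closure_mono ?_).trans tsupport_bump
  intro x hx h
  apply hx
  simp [bubble, h]

theorem hasCompactSupport_bubble (g : E → ℝ) : HasCompactSupport (bubble g) := by
  refine bump.hasCompactSupport.mono ?_
  intro x hx h
  apply hx
  simp [bubble, h]

/-- `bubble` composed with a linear family of smooth functions. -/
theorem fderiv_bubble_add {g g' : E → ℝ} (hg : ContDiff ℝ ∞ g) (hg' : ContDiff ℝ ∞ g') :
    fderiv ℝ (bubble (g + g')) = fderiv ℝ (bubble g) + fderiv ℝ (bubble g') := by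
  have : bubble (g + g') = bubble g + bubble g' := by ext x; simp [bubble]; ring
  ext1 x
  rw [this, fderiv_add ((contDiff_bubble hg).differentiable (by simp) x)
    ((contDiff_bubble hg').differentiable (by simp) x)]
  rfl

theorem fderiv_bubble_smul {g : E → ℝ} (hg : ContDiff ℝ ∞ g) (c : ℝ) :
    fderiv ℝ (bubble (c • g)) = c • fderiv ℝ (bubble g) := by
  have : bubble (c • g) = c • bubble g := by ext x; simp [bubble]; ring
  ext1 x
  rw [this, fderiv_const_smul ((contDiff_bubble hg).differentiable (by simp) x)]
  rfl

theorem memLp_bubble {g : E → ℝ} (hg : ContDiff ℝ ∞ g) : MemLp (bubble g) 2 volume :=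
  (contDiff_bubble hg).continuous.memLp_of_hasCompactSupport (hasCompactSupport_bubble g)

theorem memLp_fderiv_bubble {g : E → ℝ} (hg : ContDiff ℝ ∞ g) :
    MemLp (fderiv ℝ (bubble g)) 2 volume :=
  ((contDiff_bubble hg).continuous_fderiv (by simp)).memLp_of_hasCompactSupport
    ((hasCompactSupport_bubble g).fderiv ℝ)

theorem memLp_bump_mul {g : E → ℝ} (hg : ContDiff ℝ ∞ g) :
    MemLp (fun x => bump x * g x) 2 volume :=
  (contDiff_bump.mul hg).continuous.memLp_of_hasCompactSupport
    (bump.hasCompactSupport.mul_right)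

theorem eq_zero_of_bump_mul_ae_eq_zero {g : E → ℝ} (hg : Continuous g)
    (h : (fun x => bump x * g x) =ᵐ[volume] 0) :
    ∀ x ∈ Metric.ball (0 : E) (1 / 4), g x = 0 := by
  have h' := (Continuous.ae_eq_iff_eq volume (bump.continuous.mul hg) continuous_zero).1 h
  intro x hx
  have := congrFun h' x
  simpa [bump_eq_one (x := x) (by simpa using (Metric.mem_ball.1 hx).le)] using! this

/-- The reference norm is that of `bump * p`, because the integral of `p * bubble p` is its square.
It is a norm on polynomials since `bump = 1` on a disc. The radius `R` is there to cover a whole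
triangle after its inscribed disc is scaled to the unit disc. -/
theorem exists_bubble_bound (N : ℕ) (R : ℝ) : ∃ C : ℝ≥0, ∀ p : MvPolynomial (Fin 2) ℝ,
    p.totalDegree ≤ N →
    eLpNorm (polyFun p) 2 (volume.restrict (Metric.closedBall 0 R)) ≤
      C * eLpNorm (fun x => bump x * polyFun p x) 2 volume ∧
    eLpNorm (fderiv ℝ (bubble (polyFun p))) 2 volume ≤
      C * eLpNorm (fun x => bump x * polyFun p x) 2 volume ∧
    eLpNorm (bubble (polyFun p)) 2 volume ≤
      C * eLpNorm (fun x => bump x * polyFun p x) 2 volume := by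
  let W := MvPolynomial.restrictTotalDegree (Fin 2) ℝ N
  let T : W →ₗ[ℝ] E → ℝ :=
    { toFun := fun p x => bump x * polyFun p.1 x
      map_add' := fun p q => by ext x; simp [polyFun_add]; ring
      map_smul' := fun c p => by ext x; simp [polyFun_smul]; ring }
  let T₁ : W →ₗ[ℝ] E → ℝ :=
    { toFun := fun p => polyFun p.1
      map_add' := fun p q => polyFun_add _ _
      map_smul' := fun c p => polyFun_smul _ _ }
  let T₂ : W →ₗ[ℝ] E → (E →L[ℝ] ℝ) :=
    { toFun := fun p => fderiv ℝ (bubble (polyFun p.1))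
      map_add' := fun p q => by
        rw [← fderiv_bubble_add (contDiff_polyFun _) (contDiff_polyFun _), ← polyFun_add]; rfl
      map_smul' := fun c p => by
        simp only [RingHom.id_apply]
        rw [← fderiv_bubble_smul (contDiff_polyFun _), ← polyFun_smul]; rfl }
  let T₃ : W →ₗ[ℝ] E → ℝ :=
    { toFun := fun p => bubble (polyFun p.1)
      map_add' := fun p q => by ext x; simp [polyFun_add, bubble]; ring
      map_smul' := fun c p => by ext x; simp [polyFun_smul, bubble]; ring }
  have hT : ∀ w, MemLp (T w) 2 volume := fun w => memLp_bump_mul (contDiff_polyFun _)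
  have inj : ∀ w, T w =ᵐ[volume] 0 → w = 0 := fun w hw => Subtype.ext
    (polyFun_eq_zero (eq_zero_of_bump_mul_ae_eq_zero (contDiff_polyFun _).continuous hw))
  obtain ⟨C₁, h₁⟩ := exists_eLpNorm_le_mul (μ' := volume.restrict (Metric.closedBall 0 R)) T T₁ hT
    (fun w => memLp_restrict_of_continuous (isCompact_closedBall _ _)
      (contDiff_polyFun _).continuous _) inj
  obtain ⟨C₂, h₂⟩ := exists_eLpNorm_le_mul (μ' := volume) T T₂ hT
    (fun w => memLp_fderiv_bubble (contDiff_polyFun _)) inj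
  obtain ⟨C₃, h₃⟩ := exists_eLpNorm_le_mul (μ' := volume) T T₃ hT
    (fun w => memLp_bubble (contDiff_polyFun _)) inj
  refine ⟨max C₁ (max C₂ C₃), fun p hp => ?_⟩
  let w : W := ⟨p, (MvPolynomial.mem_restrictTotalDegree _ _ _).2 hp⟩
  refine ⟨(h₁ w).trans ?_, (h₂ w).trans ?_, (h₃ w).trans ?_⟩ <;>
  · refine mul_le_mul' ?_ le_rfl
    simp

/-- The point `(t, 0)` of the plane. -/
def axisPt (t : ℝ) : E := EuclideanSpace.single 0 t

theorem isometry_axisPt : Isometry axisPt :=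
  Isometry.of_dist_eq fun s t => by
    rw [axisPt, axisPt, EuclideanSpace.dist_eq]
    simp [Fin.sum_univ_two, Real.sqrt_sq dist_nonneg]

theorem memLp_axis {g : E → ℝ} (hg : Continuous g) (hc : HasCompactSupport g) :
    MemLp (fun t => g (axisPt t)) 2 volume :=
  (hg.comp isometry_axisPt.continuous).memLp_of_hasCompactSupport
    (hc.comp_isClosedEmbedding isometry_axisPt.isClosedEmbedding)

/-- A polynomial on the side is extended to the plane as a constant in the normal direction before
it is cut off. The reference norm lives on the first axis, where the scaled side lies; `[-R, R]` is
there to cover that side. -/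
theorem exists_side_bubble_bound (N : ℕ) (R : ℝ) : ∃ C : ℝ≥0, ∀ p : Polynomial ℝ,
    p.natDegree ≤ N →
    eLpNorm (fun t => p.eval t) 2 (volume.restrict (Set.Icc (-R) R)) ≤
      C * eLpNorm (fun t => bump (axisPt t) * p.eval t) 2 volume ∧
    eLpNorm (fderiv ℝ (bubble fun y => p.eval (y 0))) 2 volume ≤
      C * eLpNorm (fun t => bump (axisPt t) * p.eval t) 2 volume ∧
    eLpNorm (bubble fun y => p.eval (y 0)) 2 volume ≤
      C * eLpNorm (fun t => bump (axisPt t) * p.eval t) 2 volume := by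
  have hs : ∀ p : Polynomial ℝ, ContDiff ℝ ∞ (fun y : E => p.eval (y 0)) := fun p =>
    (p.contDiff_aeval (R := ℝ) (𝕜 := ℝ) ∞).comp (by fun_prop : ContDiff ℝ ∞ fun y : E => y 0)
  let W := Polynomial.degreeLT ℝ (N + 1)
  have eadd : ∀ p q : Polynomial ℝ, (fun y : E => (p + q).eval (y 0)) =
    (fun y : E => p.eval (y 0)) + (fun y : E => q.eval (y 0)) := fun p q => by ext; simp
  have esmul : ∀ (c : ℝ) (p : Polynomial ℝ), (fun y : E => (c • p).eval (y 0)) =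
    c • (fun y : E => p.eval (y 0)) := fun c p => by ext; simp
  let T : W →ₗ[ℝ] ℝ → ℝ :=
    { toFun := fun p t => bump (axisPt t) * p.1.eval t
      map_add' := fun p q => by ext x; simp; ring
      map_smul' := fun c p => by ext x; simp; ring }
  let T₁ : W →ₗ[ℝ] ℝ → ℝ :=
    { toFun := fun p t => p.1.eval t
      map_add' := fun p q => by ext x; simp
      map_smul' := fun c p => by ext x; simp }
  let T₂ : W →ₗ[ℝ] E → (E →L[ℝ] ℝ) :=
    { toFun := fun p => fderiv ℝ (bubble fun y => p.1.eval (y 0))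
      map_add' := fun p q => by
        rw [← fderiv_bubble_add (hs _) (hs _), ← eadd]; rfl
      map_smul' := fun c p => by
        simp only [RingHom.id_apply]
        rw [← fderiv_bubble_smul (hs _), ← esmul]; rfl }
  let T₃ : W →ₗ[ℝ] E → ℝ :=
    { toFun := fun p => bubble fun y => p.1.eval (y 0)
      map_add' := fun p q => by ext x; simp [bubble]; ring
      map_smul' := fun c p => by ext x; simp [bubble]; ring }
  have hT : ∀ w, MemLp (T w) 2 volume := fun w => by
    have h := memLp_axis (contDiff_bump.mul (hs w.1)).continuous bump.hasCompactSupport.mul_right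
    simpa [T, axisPt] using! h
  have inj : ∀ w, T w =ᵐ[volume] 0 → w = 0 := by
    intro w hw
    have hc : Continuous fun t => bump (axisPt t) * w.1.eval t :=
      (bump.continuous.comp isometry_axisPt.continuous).mul w.1.continuous
    have h' := (Continuous.ae_eq_iff_eq volume hc continuous_zero).1 hw
    apply Subtype.ext
    refine Polynomial.eq_zero_of_infinite_isRoot _
      ((Set.Ioo_infinite (show (-(1 / 4) : ℝ) < 1 / 4 by norm_num)).mono fun t ht => ?_)
    have := congrFun h' t
    have hb : bump (axisPt t) = 1 := bump_eq_one (by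
      simp only [axisPt, PiLp.norm_single, Real.norm_eq_abs]
      exact (abs_lt.2 ht).le)
    simpa [hb] using! this
  obtain ⟨C₁, h₁⟩ := exists_eLpNorm_le_mul (μ' := volume.restrict (Set.Icc (-R) R)) T T₁ hT
    (fun w => memLp_restrict_of_continuous isCompact_Icc w.1.continuous _) inj
  obtain ⟨C₂, h₂⟩ := exists_eLpNorm_le_mul (μ' := volume) T T₂ hT
    (fun w => memLp_fderiv_bubble (hs _)) inj
  obtain ⟨C₃, h₃⟩ := exists_eLpNorm_le_mul (μ' := volume) T T₃ hT
    (fun w => memLp_bubble (hs _)) inj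
  refine ⟨max C₁ (max C₂ C₃), fun p hp => ?_⟩
  let w : W := ⟨p, Polynomial.mem_degreeLT.2 (by
    refine Polynomial.degree_le_natDegree.trans_lt ?_
    exact_mod_cast Nat.lt_succ_of_le hp)⟩
  refine ⟨(h₁ w).trans ?_, (h₂ w).trans ?_, (h₃ w).trans ?_⟩ <;>
  · refine mul_le_mul' ?_ le_rfl
    simp

/-! ### Cauchy–Schwarz inequalities -/

section CauchySchwarz

variable {α H : Type*} [MeasurableSpace α] {μ : Measure α}
  [NormedAddCommGroup H] [InnerProductSpace ℝ H]

theorem eLpNorm_inner_le {f g : α → H} {p q : ℝ≥0∞} [ENNReal.HolderConjugate p q]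
    (hf : AEStronglyMeasurable f μ) (hg : AEStronglyMeasurable g μ) :
    ∫⁻ x, ‖(inner ℝ (f x) (g x) : ℝ)‖ₑ ∂μ ≤ eLpNorm f p μ * eLpNorm g q μ := by
  rw [← eLpNorm_one_eq_lintegral_enorm]
  have := eLpNorm_le_eLpNorm_mul_eLpNorm_of_nnnorm (p := p) (q := q) (r := 1) hf hg
    (fun x y => (inner ℝ x y : ℝ)) 1
    (.of_forall fun x => by simpa using nnnorm_inner_le_nnnorm (𝕜 := ℝ) (f x) (g x))
  simpa using this

theorem enorm_integral_inner_le {f g : α → H} {p q : ℝ≥0∞} [ENNReal.HolderConjugate p q]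
    (hf : AEStronglyMeasurable f μ) (hg : AEStronglyMeasurable g μ) :
    ‖∫ x, (inner ℝ (f x) (g x) : ℝ) ∂μ‖ₑ ≤ eLpNorm f p μ * eLpNorm g q μ :=
  (enorm_integral_le_lintegral_enorm _).trans (eLpNorm_inner_le hf hg)

theorem enorm_integral_mul_le {f g : α → ℝ} (hf : AEStronglyMeasurable f μ)
    (hg : AEStronglyMeasurable g μ) :
    ‖∫ x, f x * g x ∂μ‖ₑ ≤ eLpNorm f 2 μ * eLpNorm g 2 μ := by
  simpa [mul_comm] using enorm_integral_inner_le (p := 2) (q := 2) hf hg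

theorem integrable_inner_of_memLp {f g : α → H} (hf : MemLp f 2 μ) (hg : MemLp g 2 μ) :
    Integrable (fun x => (inner ℝ (f x) (g x) : ℝ)) μ :=
  ⟨hf.1.inner hg.1, (eLpNorm_inner_le hf.1 hg.1).trans_lt
    (ENNReal.mul_lt_top hf.2 hg.2)⟩

theorem integrable_mul_of_memLp {f g : α → ℝ} (hf : MemLp f 2 μ) (hg : MemLp g 2 μ) :
    Integrable (fun x => f x * g x) μ := by
  simpa [mul_comm] using integrable_inner_of_memLp hf hg

/-- Traces and weak curls are limits of smooth fields in `L²`; this carries Green's formula to the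
limit. -/
theorem tendsto_integral_inner {w : ℕ → α → H} {w₀ V : α → H}
    (hw : ∀ n, MemLp (w n) 2 μ) (hw₀ : MemLp w₀ 2 μ) (hV : MemLp V 2 μ)
    (h : Tendsto (fun n => eLpNorm (w n - w₀) 2 μ) atTop (𝓝 0)) :
    Tendsto (fun n => ∫ x, (inner ℝ (w n x) (V x) : ℝ) ∂μ) atTop
      (𝓝 (∫ x, (inner ℝ (w₀ x) (V x) : ℝ) ∂μ)) := by
  rw [tendsto_iff_edist_tendsto_0]
  have h0 : Tendsto (fun n => eLpNorm (w n - w₀) 2 μ * eLpNorm V 2 μ) atTop (𝓝 0) := by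
    simpa using ENNReal.Tendsto.mul_const h (Or.inr hV.2.ne)
  refine tendsto_of_tendsto_of_tendsto_of_le_of_le tendsto_const_nhds h0 (fun _ => zero_le)
    fun n => ?_
  show edist _ _ ≤ _
  rw [edist_eq_enorm_sub, ← integral_sub (integrable_inner_of_memLp (hw n) hV)
    (integrable_inner_of_memLp hw₀ hV)]
  simp_rw [← inner_sub_left]
  exact enorm_integral_inner_le (f := w n - w₀) ((hw n).1.sub hw₀.1) hV.1

theorem tendsto_integral_mul {w : ℕ → α → ℝ} {w₀ V : α → ℝ}
    (hw : ∀ n, MemLp (w n) 2 μ) (hw₀ : MemLp w₀ 2 μ) (hV : MemLp V 2 μ)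
    (h : Tendsto (fun n => eLpNorm (w n - w₀) 2 μ) atTop (𝓝 0)) :
    Tendsto (fun n => ∫ x, w n x * V x ∂μ) atTop (𝓝 (∫ x, w₀ x * V x ∂μ)) := by
  simpa [mul_comm] using tendsto_integral_inner hw hw₀ hV h

theorem enorm_integral_sq_eq {g : α → ℝ} (hg : MemLp g 2 μ) :
    ‖∫ x, g x * g x ∂μ‖ₑ = eLpNorm g 2 μ ^ 2 := by
  have h0 : 0 ≤ ∫ x, g x * g x ∂μ := integral_nonneg fun x => mul_self_nonneg _
  rw [Real.enorm_eq_ofReal h0, ofReal_integral_eq_lintegral_ofReal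
    (integrable_mul_of_memLp hg hg) (.of_forall fun x => mul_self_nonneg _),
    eLpNorm_eq_lintegral_rpow_enorm_toReal (by simp) (by simp), ← ENNReal.rpow_natCast,
    ← ENNReal.rpow_mul]
  simp only [ENNReal.toReal_ofNat, one_div, Nat.cast_ofNat, ne_eq, OfNat.ofNat_ne_zero,
    not_false_eq_true, inv_mul_cancel₀, ENNReal.rpow_one]
  refine lintegral_congr fun x => ?_
  rw [← abs_mul_abs_self, ENNReal.ofReal_mul (abs_nonneg _), Real.enorm_eq_ofReal_abs]
  rw [show (2 : ℝ) = ((2 : ℕ) : ℝ) by norm_num, ENNReal.rpow_natCast, sq]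

end CauchySchwarz

/-! ### The scalar curl of a smooth field -/

/-- The functional `D ↦ ∂₁w₂ - ∂₂w₁` on Jacobians. -/
def curlOp : (E →L[ℝ] E) →L[ℝ] ℝ :=
  (EuclideanSpace.proj 1 : E →L[ℝ] ℝ) ∘L
      (ContinuousLinearMap.apply ℝ E (EuclideanSpace.single (0 : Fin 2) (1 : ℝ))) -
    (EuclideanSpace.proj 0 : E →L[ℝ] ℝ) ∘L
      (ContinuousLinearMap.apply ℝ E (EuclideanSpace.single (1 : Fin 2) (1 : ℝ)))

theorem curlOp_apply (D : E →L[ℝ] E) :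
    curlOp D = D (EuclideanSpace.single 0 1) 1 - D (EuclideanSpace.single 1 1) 0 := by
  simp [curlOp]

/-- The scalar curl of a differentiable vector field. -/
def curlV (g : E → E) (x : E) : ℝ := curlOp (fderiv ℝ g x)

/-- Rotation by a right angle. -/
def rot (τ : E) : E := !₂[-τ 1, τ 0]

theorem inner_E (x y : E) : inner ℝ x y = x 0 * y 0 + x 1 * y 1 := by
  simp [PiLp.inner_apply, Fin.sum_univ_two]; ring

theorem norm_sq_E (x : E) : ‖x‖ ^ 2 = x 0 ^ 2 + x 1 ^ 2 := by
  rw [← real_inner_self_eq_norm_sq, inner_E]; ring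

@[simp] theorem rot_apply_zero (τ : E) : rot τ 0 = -τ 1 := rfl
@[simp] theorem rot_apply_one (τ : E) : rot τ 1 = τ 0 := rfl

theorem rot_neg (τ : E) : rot (-τ) = -rot τ := by
  ext i; fin_cases i <;> simp

theorem norm_rot (τ : E) : ‖rot τ‖ = ‖τ‖ := by
  rw [← sq_eq_sq₀ (norm_nonneg _) (norm_nonneg _), norm_sq_E, norm_sq_E]
  simp; ring

theorem inner_rot_self (τ : E) : inner ℝ (rot τ) τ = 0 := by
  rw [inner_E]; simp; ring

theorem decomp_E (v : E) : v = v 0 • EuclideanSpace.single 0 1 + v 1 • EuclideanSpace.single 1 1 := by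
  ext i; fin_cases i <;> simp

/-- The scalar curl is invariant under rotations, so it can be computed in the frame of tangent and
normal of a side. -/
theorem curlOp_eq_of_norm_eq_one (D : E →L[ℝ] E) {τ : E} (hτ : ‖τ‖ = 1) :
    curlOp D = inner ℝ (rot τ) (D τ) - inner ℝ τ (D (rot τ)) := by
  have h : τ 0 ^ 2 + τ 1 ^ 2 = 1 := by rw [← norm_sq_E, hτ]; norm_num
  have h1 : D τ = τ 0 • D (EuclideanSpace.single 0 1) + τ 1 • D (EuclideanSpace.single 1 1) := by
    conv_lhs => rw [decomp_E τ, map_add, map_smul, map_smul]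
  have h2 : D (rot τ) =
      -τ 1 • D (EuclideanSpace.single 0 1) + τ 0 • D (EuclideanSpace.single 1 1) := by
    conv_lhs => rw [decomp_E (rot τ), map_add, map_smul, map_smul]
    simp
  rw [curlOp_apply, h1, h2, inner_E, inner_E]
  simp only [rot_apply_zero, rot_apply_one, PiLp.add_apply, PiLp.smul_apply, smul_eq_mul]
  linear_combination (-(D (EuclideanSpace.single 0 1) 1) + (D (EuclideanSpace.single 1 1) 0)) * h

theorem enorm_curlS_le (φ : E → ℝ) (x : E) : ‖curlS φ x‖ ≤ 2 * ‖fderiv ℝ φ x‖ := by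
  have h : ∀ i : Fin 2, |fderiv ℝ φ x (EuclideanSpace.single i 1)| ≤ ‖fderiv ℝ φ x‖ := fun i => by
    simpa using (fderiv ℝ φ x).le_opNorm (EuclideanSpace.single i 1)
  refine (sq_le_sq₀ (norm_nonneg _) (by positivity)).1 ?_
  rw [norm_sq_E]
  have h0 := sq_le_sq' (neg_le_of_abs_le (h 0)) (le_of_abs_le (h 0))
  have h1 := sq_le_sq' (neg_le_of_abs_le (h 1)) (le_of_abs_le (h 1))
  simp only [curlS, PiLp.toLp_apply, Matrix.cons_val_zero, Matrix.cons_val_one]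
  nlinarith

theorem curlV_smul {φ : E → ℝ} {g : E → E} {x : E} (hφ : DifferentiableAt ℝ φ x)
    (hg : DifferentiableAt ℝ g x) :
    curlV (fun y => φ y • g y) x = curlV g x * φ x - inner ℝ (g x) (curlS φ x) := by
  rw [curlV, curlV, fderiv_fun_smul hφ hg, curlOp_apply, curlOp_apply, inner_E]
  simp [curlS]
  ring

theorem curlS_eq_zero {φ : E → ℝ} {x : E} (hx : x ∉ tsupport φ) : curlS φ x = 0 := by
  have : fderiv ℝ φ x = 0 := by
    by_contra h
    exact hx (support_fderiv_subset ℝ h)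
  ext i; fin_cases i <;> simp [curlS, this]

theorem continuous_curlS {φ : E → ℝ} (hφ : ContDiff ℝ ∞ φ) : Continuous (curlS φ) := by
  have h := hφ.continuous_fderiv (by simp)
  have h' : ∀ v, Continuous fun x => fderiv ℝ φ x v := fun v => h.clm_apply continuous_const
  refine (PiLp.continuous_toLp 2 _).comp (continuous_pi fun i => ?_)
  fin_cases i
  · exact h' _
  · exact (h' _).neg

theorem hasCompactSupport_curlS {φ : E → ℝ} (hφ : HasCompactSupport φ) :
    HasCompactSupport (curlS φ) :=
  HasCompactSupport.intro hφ fun _ hx => curlS_eq_zero hx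

theorem continuous_curlV {g : E → E} (hg : ContDiff ℝ ∞ g) : Continuous (curlV g) :=
  curlOp.continuous.comp (hg.continuous_fderiv (by simp))

/-! ### Integration by parts in the plane and in half planes -/

theorem integral_fderiv_eq_zero {F : E → ℝ} (hF : ContDiff ℝ ∞ F) (hc : HasCompactSupport F)
    (v : E) : ∫ x, fderiv ℝ F x v = 0 := by
  have hi : Integrable (fun x => fderiv ℝ F x v) volume :=
    ((hF.continuous_fderiv (by simp)).clm_apply continuous_const).integrable_of_hasCompactSupport
      (hc.fderiv_apply ℝ v)
  have := integral_mul_fderiv_eq_neg_fderiv_mul_of_integrable (μ := volume)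
    (f := fun _ : E => (1 : ℝ)) (g := F) (v := v)
    (by simp) (by simpa using hi)
    (by simpa using hF.continuous.integrable_of_hasCompactSupport hc)
    (fun x _ => by fun_prop) (fun x _ => hF.differentiable (by simp) x)
  simpa using this

theorem integral_curlV_eq_zero {G : E → E} (hG : ContDiff ℝ ∞ G) (hc : HasCompactSupport G) :
    ∫ x, curlV G x = 0 := by
  have hs : ∀ i : Fin 2, ContDiff ℝ ∞ fun x => G x i := fun i => by fun_prop
  have hcs : ∀ i : Fin 2, HasCompactSupport fun x => G x i := fun i =>
    hc.comp_left (g := fun y : E => y i) rfl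
  have hd : ∀ (i : Fin 2) (x v : E), fderiv ℝ G x v i = fderiv ℝ (fun x => G x i) x v := by
    intro i x v
    have h := (EuclideanSpace.proj i : E →L[ℝ] ℝ).hasFDerivAt.comp x
      (hG.differentiable (by simp) x).hasFDerivAt
    have h' : fderiv ℝ (fun x => G x i) x = _ := h.fderiv
    rw [h']; simp
  have hi : ∀ (i : Fin 2) (v : E), Integrable (fun x => fderiv ℝ (fun x => G x i) x v) volume :=
    fun i v => (((hs i).continuous_fderiv (by simp)).clm_apply
      continuous_const).integrable_of_hasCompactSupport ((hcs i).fderiv_apply ℝ v)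
  simp_rw [curlV, curlOp_apply, hd]
  rw [integral_sub (hi _ _) (hi _ _), integral_fderiv_eq_zero (hs 1) (hcs 1),
    integral_fderiv_eq_zero (hs 0) (hcs 0), sub_zero]

/-- Integration by parts of a smooth field against the vector curl of a test function. -/
theorem integral_inner_curlS {g : E → E} {φ : E → ℝ} (hg : ContDiff ℝ ∞ g) (hφ : ContDiff ℝ ∞ φ)
    (hc : HasCompactSupport φ) :
    ∫ x, inner ℝ (g x) (curlS φ x) = ∫ x, curlV g x * φ x := by
  have h := integral_curlV_eq_zero (hφ.smul hg) hc.smul_right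
  have h1 : Integrable (fun x => curlV g x * φ x) volume :=
    ((continuous_curlV hg).mul hφ.continuous).integrable_of_hasCompactSupport hc.mul_left
  have h2 : Integrable (fun x => (inner ℝ (g x) (curlS φ x) : ℝ)) volume :=
    (hg.continuous.inner (continuous_curlS hφ)).integrable_of_hasCompactSupport
      (HasCompactSupport.intro hc fun x hx => by simp [curlS_eq_zero hx])
  have h3 : ∀ x, curlV (φ • g) x = curlV g x * φ x - inner ℝ (g x) (curlS φ x) :=
    fun x => curlV_smul (hφ.differentiable (by simp) x) (hg.differentiable (by simp) x)
  simp_rw [h3] at h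
  rw [integral_sub h1 h2] at h
  linarith

/-- The rotation that takes the first coordinate direction to `τ`. -/
def frame (τ : E) (hτ : ‖τ‖ = 1) : E ≃ₗᵢ[ℝ] E where
  toFun y := y 0 • τ + y 1 • rot τ
  invFun x := !₂[inner ℝ τ x, inner ℝ (rot τ) x]
  map_add' x y := by simp [add_smul]; abel
  map_smul' c x := by simp [mul_smul]
  left_inv y := by
    have h : τ 0 ^ 2 + τ 1 ^ 2 = 1 := by rw [← norm_sq_E, hτ]; norm_num
    ext i
    fin_cases i
    · simp [inner_E]; linear_combination (y 0) * h
    · simp [inner_E]; linear_combination (y 1) * h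
  right_inv x := by
    have h : τ 0 ^ 2 + τ 1 ^ 2 = 1 := by rw [← norm_sq_E, hτ]; norm_num
    ext i
    fin_cases i
    · simp [inner_E]; linear_combination (x 0) * h
    · simp [inner_E]; linear_combination (x 1) * h
  norm_map' y := by
    have h : τ 0 ^ 2 + τ 1 ^ 2 = 1 := by rw [← norm_sq_E, hτ]; norm_num
    change ‖y 0 • τ + y 1 • rot τ‖ = ‖y‖
    rw [← sq_eq_sq₀ (norm_nonneg _) (norm_nonneg _), norm_sq_E (_ + _), norm_sq_E y]
    simp
    linear_combination (y 0 ^ 2 + y 1 ^ 2) * h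

theorem frame_apply (τ : E) (hτ : ‖τ‖ = 1) (y : E) : frame τ hτ y = y 0 • τ + y 1 • rot τ := rfl

theorem frame_symm_apply (τ : E) (hτ : ‖τ‖ = 1) (x : E) :
    (frame τ hτ).symm x = !₂[inner ℝ τ x, inner ℝ (rot τ) x] := rfl

theorem measurePreserving_pair :
    MeasurePreserving (fun q : ℝ × ℝ => (!₂[q.1, q.2] : E)) volume volume := by
  have h1 := (volume_preserving_finTwoArrow ℝ).symm
  exact (PiLp.volume_preserving_toLp (Fin 2)).comp h1

/-- Cartesian coordinates with origin `m` and first axis along `τ`. -/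
def coords (m τ : E) (q : ℝ × ℝ) : E := m + (q.1 • τ + q.2 • rot τ)

theorem measurePreserving_coords (m : E) {τ : E} (hτ : ‖τ‖ = 1) :
    MeasurePreserving (coords m τ) volume volume := by
  have h := (measurePreserving_add_left volume m).comp
    ((frame τ hτ).measurePreserving.comp measurePreserving_pair)
  exact h

theorem isClosedEmbedding_coords (m : E) {τ : E} (hτ : ‖τ‖ = 1) :
    IsClosedEmbedding (coords m τ) := by
  have h1 : IsClosedEmbedding (fun q : ℝ × ℝ => (!₂[q.1, q.2] : E)) := by
    have := ((PiLp.homeomorph 2 (fun _ : Fin 2 => ℝ)).symm.isClosedEmbedding).comp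
      (Homeomorph.finTwoArrow (X := ℝ)).symm.isClosedEmbedding
    exact this
  exact (Homeomorph.addLeft m).isClosedEmbedding.comp
    ((frame τ hτ).toHomeomorph.isClosedEmbedding.comp h1)

theorem inner_rot_coords (m : E) {τ : E} (hτ : ‖τ‖ = 1) (q : ℝ × ℝ) :
    inner ℝ (rot τ) (coords m τ q - m) = q.2 := by
  simp [coords, inner_add_right, inner_smul_right, inner_rot_self, norm_rot, hτ]

/-- The closed half plane to the left of the line through `m` in the direction `τ`. -/
def halfPlane (m τ : E) : Set E := {x | 0 ≤ inner ℝ (rot τ) (x - m)}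

theorem isClosed_halfPlane (m τ : E) : IsClosed (halfPlane m τ) :=
  isClosed_le continuous_const (by fun_prop)

theorem setIntegral_halfPlane (m : E) {τ : E} (hτ : ‖τ‖ = 1) (F : E → ℝ) :
    ∫ x in halfPlane m τ, F x = ∫ q in Set.univ ×ˢ Set.Ici (0 : ℝ), F (coords m τ q) := by
  rw [← (measurePreserving_coords m hτ).setIntegral_preimage_emb
    (isClosedEmbedding_coords m hτ).measurableEmbedding]
  congr 2
  ext q
  simp [halfPlane, inner_rot_coords m hτ]

theorem isometry_line (m : E) {τ : E} (hτ : ‖τ‖ = 1) : Isometry fun s : ℝ => m + s • τ :=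
  Isometry.of_dist_eq fun s t => by
    rw [dist_add_left, dist_eq_norm, ← sub_smul, norm_smul, hτ, mul_one, Real.dist_eq,
      Real.norm_eq_abs]

theorem setIntegral_halfPlane_fderiv_tangential (m : E) {τ : E} (hτ : ‖τ‖ = 1) {F : E → ℝ}
    (hF : ContDiff ℝ ∞ F) (hc : HasCompactSupport F) :
    ∫ x in halfPlane m τ, fderiv ℝ F x τ = 0 := by
  have hi : Integrable (fun q => fderiv ℝ F (coords m τ q) τ) volume :=
    (((hF.continuous_fderiv (by simp)).clm_apply continuous_const).comp
      (isClosedEmbedding_coords m hτ).continuous).integrable_of_hasCompactSupport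
      ((hc.fderiv_apply ℝ τ).comp_isClosedEmbedding (isClosedEmbedding_coords m hτ))
  rw [setIntegral_halfPlane m hτ, Measure.volume_eq_prod, ← Measure.prod_restrict,
    integral_prod_symm _ (by rw [Measure.prod_restrict]; exact hi.integrableOn)]
  refine integral_eq_zero_of_ae (.of_forall fun t => ?_)
  simp only [Measure.restrict_univ, Pi.zero_apply]
  -- By Fubini the inner integral runs over a whole line parallel to the boundary. Split at `0`, its
  -- two halves give opposite values of `F`.
  have hl : ∀ s, HasDerivAt (fun s => F (coords m τ (s, t))) (fderiv ℝ F (coords m τ (s, t)) τ) s :=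
    fun s => by
      have h1 : HasDerivAt (fun s : ℝ => coords m τ (s, t)) τ s := by
        have := (((hasDerivAt_id s).smul_const τ).add_const (t • rot τ)).const_add m
        simpa [coords] using! this
      exact (hF.differentiable (by simp) _).hasFDerivAt.comp_hasDerivAt s h1
  have hemb : IsClosedEmbedding fun s : ℝ => coords m τ (s, t) := by
    have e : (fun s : ℝ => coords m τ (s, t)) = fun s => m + t • rot τ + s • τ := by
      funext s; simp only [coords]; abel
    rw [e]
    exact (isometry_line (m + t • rot τ) hτ).isClosedEmbedding
  have hcd : ContDiff ℝ ∞ fun s : ℝ => F (coords m τ (s, t)) :=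
    hF.comp (by unfold coords; fun_prop)
  have hcs := hc.comp_isClosedEmbedding hemb
  have e : (fun s => fderiv ℝ F (coords m τ (s, t)) τ) = deriv fun s => F (coords m τ (s, t)) :=
    funext fun s => (hl s).deriv.symm
  rw [e]
  have h1 := HasCompactSupport.integral_Ioi_deriv_eq (hcd.of_le (by simp)) hcs 0
  have h2 := HasCompactSupport.integral_Iic_deriv_eq (hcd.of_le (by simp)) hcs 0
  have hinter : Integrable (deriv fun s => F (coords m τ (s, t))) volume :=
    (hcd.continuous_deriv (by simp)).integrable_of_hasCompactSupport hcs.deriv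
  rw [← intervalIntegral.integral_Iic_add_Ioi hinter.integrableOn hinter.integrableOn, h1, h2]
  simp

/-- By Fubini the inner integral runs along a ray that enters the half plane from its boundary; only
the value at the starting point survives, with a minus sign. -/
theorem setIntegral_halfPlane_fderiv_normal (m : E) {τ : E} (hτ : ‖τ‖ = 1) {F : E → ℝ}
    (hF : ContDiff ℝ ∞ F) (hc : HasCompactSupport F) :
    ∫ x in halfPlane m τ, fderiv ℝ F x (rot τ) = -∫ s : ℝ, F (m + s • τ) := by
  have hi : Integrable (fun q => fderiv ℝ F (coords m τ q) (rot τ)) volume :=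
    (((hF.continuous_fderiv (by simp)).clm_apply continuous_const).comp
      (isClosedEmbedding_coords m hτ).continuous).integrable_of_hasCompactSupport
      ((hc.fderiv_apply ℝ _).comp_isClosedEmbedding (isClosedEmbedding_coords m hτ))
  rw [setIntegral_halfPlane m hτ, Measure.volume_eq_prod, setIntegral_prod _ hi.integrableOn,
    Measure.restrict_univ, ← integral_neg]
  refine integral_congr_ae (.of_forall fun s => ?_)
  simp only
  have hl : ∀ t, HasDerivAt (fun t => F (coords m τ (s, t)))
      (fderiv ℝ F (coords m τ (s, t)) (rot τ)) t := fun t => by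
      have h1 : HasDerivAt (fun t : ℝ => coords m τ (s, t)) (rot τ) t := by
        have := (((hasDerivAt_id t).smul_const (rot τ)).const_add (s • τ)).const_add m
        simpa [coords] using! this
      exact (hF.differentiable (by simp) _).hasFDerivAt.comp_hasDerivAt t h1
  have hemb : IsClosedEmbedding fun t : ℝ => coords m τ (s, t) := by
    have e : (fun t : ℝ => coords m τ (s, t)) = fun t => m + s • τ + t • rot τ := by
      funext t; simp only [coords]; abel
    rw [e]
    exact (isometry_line (m + s • τ) ((norm_rot τ).trans hτ)).isClosedEmbedding
  have hcd : ContDiff ℝ ∞ fun t : ℝ => F (coords m τ (s, t)) :=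
    hF.comp (by unfold coords; fun_prop)
  have e : (fun t => fderiv ℝ F (coords m τ (s, t)) (rot τ)) =
      deriv fun t => F (coords m τ (s, t)) := funext fun t => (hl t).deriv.symm
  rw [e, integral_Ici_eq_integral_Ioi,
    HasCompactSupport.integral_Ioi_deriv_eq (hcd.of_le (by simp)) (hc.comp_isClosedEmbedding hemb)]
  simp [coords]

/-- In the frame `τ, rot τ` the curl is a tangential derivative, which integrates to zero, minus a
normal derivative of `τ · G`, whose integral is minus the boundary term. -/
theorem setIntegral_halfPlane_curlV (m : E) {τ : E} (hτ : ‖τ‖ = 1) {G : E → E}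
    (hG : ContDiff ℝ ∞ G) (hc : HasCompactSupport G) :
    ∫ x in halfPlane m τ, curlV G x = ∫ s : ℝ, inner ℝ τ (G (m + s • τ)) := by
  have hs : ∀ v : E, ContDiff ℝ ∞ fun x => (inner ℝ v (G x) : ℝ) := fun v => contDiff_const.inner ℝ hG
  have hcs : ∀ v : E, HasCompactSupport fun x => (inner ℝ v (G x) : ℝ) := fun v =>
    hc.comp_left (g := fun y : E => (inner ℝ v y : ℝ)) (inner_zero_right v)
  have hd : ∀ x v w : E, inner ℝ v (fderiv ℝ G x w) =
      fderiv ℝ (fun x => (inner ℝ v (G x) : ℝ)) x w := by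
    intro x v w
    have h := (innerSL ℝ v).hasFDerivAt.comp x (hG.differentiable (by simp) x).hasFDerivAt
    have h' : fderiv ℝ (fun x => (inner ℝ v (G x) : ℝ)) x = _ := h.fderiv
    rw [h']; simp
  have hi : ∀ v w : E, Integrable (fun x => fderiv ℝ (fun x => (inner ℝ v (G x) : ℝ)) x w) volume :=
    fun v w => (((hs v).continuous_fderiv (by simp)).clm_apply
      continuous_const).integrable_of_hasCompactSupport ((hcs v).fderiv_apply ℝ w)
  simp_rw [curlV, curlOp_eq_of_norm_eq_one _ hτ, hd]
  rw [integral_sub (hi _ _).integrableOn (hi _ _).integrableOn,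
    setIntegral_halfPlane_fderiv_tangential m hτ (hs _) (hcs _),
    setIntegral_halfPlane_fderiv_normal m hτ (hs _) (hcs _)]
  simp

/-! ### Triangles and sides as measure spaces -/

theorem isCompact_hull (K : Finset E) : IsCompact (hull K) :=
  K.finite_toSet.isCompact_convexHull ℝ

theorem convex_hull (K : Finset E) : Convex ℝ (hull K) := convex_convexHull ℝ _

theorem measurableSet_hull (K : Finset E) : MeasurableSet (hull K) :=
  (isCompact_hull K).measurableSet

/-- The frontier of a convex set is null. Weak curls live in the open triangle, traces and meshes
use the closed one, and this identifies the two measures. -/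
theorem restrict_interior_hull (K : Finset E) :
    (volume : Measure E).restrict (interior (hull K)) = volume.restrict (hull K) :=
  Measure.restrict_congr_set
    (interior_ae_eq_of_null_frontier ((convex_hull K).addHaar_frontier volume))

instance (K : Finset E) : IsFiniteMeasure ((volume : Measure E).restrict (hull K)) :=
  ⟨by simpa using (isCompact_hull K).measure_lt_top⟩

theorem memLp_hull {F : Type*} [NormedAddCommGroup F] (K : Finset E) {g : E → F}
    (hg : Continuous g) (q : ℝ≥0∞) : MemLp g q (volume.restrict (hull K)) :=
  memLp_restrict_of_continuous (isCompact_hull K) hg q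

/-- The unit tangent of the segment from `a` to `b`. -/
def tangent (a b : E) : E := ‖b - a‖⁻¹ • (b - a)

theorem norm_tangent {a b : E} (hab : a ≠ b) : ‖tangent a b‖ = 1 := by
  have : ‖b - a‖ ≠ 0 := norm_ne_zero_iff.2 (sub_ne_zero.2 hab.symm)
  simp [tangent, norm_smul, this]

theorem tangent_swap (a b : E) : tangent b a = -tangent a b := by
  rw [tangent, tangent, norm_sub_rev, ← smul_neg, neg_sub]

theorem smul_tangent {a b : E} (hab : a ≠ b) : ‖b - a‖ • tangent a b = b - a := by
  have : ‖b - a‖ ≠ 0 := norm_ne_zero_iff.2 (sub_ne_zero.2 hab.symm)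
  rw [tangent, smul_smul, mul_inv_cancel₀ this, one_smul]

theorem segment_eq_image_tangent {a b : E} (hab : a ≠ b) :
    segment ℝ a b = (fun s : ℝ => midpoint ℝ a b + s • tangent a b) ''
      Set.Icc (-(‖b - a‖ / 2)) (‖b - a‖ / 2) := by
  have h0 : 0 < ‖b - a‖ := norm_pos_iff.2 (sub_ne_zero.2 hab.symm)
  have hm : midpoint ℝ a b = a + (‖b - a‖ / 2) • tangent a b := by
    rw [div_eq_inv_mul, mul_smul, smul_tangent hab, midpoint_eq_smul_add]
    rw [smul_sub, smul_add, invOf_eq_inv]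
    module
  rw [segment_eq_image']
  ext x
  simp only [Set.mem_image, Set.mem_Icc, hm]
  constructor
  · rintro ⟨θ, ⟨h1, h2⟩, rfl⟩
    refine ⟨θ * ‖b - a‖ - ‖b - a‖ / 2, ⟨by nlinarith, by nlinarith⟩, ?_⟩
    rw [← smul_tangent hab, smul_smul, add_assoc, ← add_smul, smul_tangent hab]
    ring_nf
  · rintro ⟨s, ⟨h1, h2⟩, rfl⟩
    refine ⟨(s + ‖b - a‖ / 2) / ‖b - a‖, ⟨?_, ?_⟩, ?_⟩
    · exact div_nonneg (by linarith) h0.le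
    · rw [div_le_one h0]; linarith
    · rw [← smul_tangent hab, smul_smul, smul_tangent hab, div_mul_cancel₀ _ h0.ne', add_assoc,
        ← add_smul, add_comm s]

/-- Parametrization by arc length is an isometry, hence it carries Lebesgue measure to
one-dimensional Hausdorff measure. The origin is the midpoint because the side bubbles are centred
there. -/
theorem sideMeasure_eq_map {γ : Finset E} {a b : E} (hab : a ≠ b)
    (hγ : hull γ = segment ℝ a b) :
    sideMeasure γ = ((volume : Measure ℝ).restrict
      (Set.Icc (-(‖b - a‖ / 2)) (‖b - a‖ / 2))).map
        (fun s : ℝ => midpoint ℝ a b + s • tangent a b) := by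
  have hL := isometry_line (midpoint ℝ a b) (norm_tangent hab)
  have h1 := hL.map_hausdorffMeasure (d := 1) (Or.inl zero_le_one)
  rw [hausdorffMeasure_real] at h1
  have hpre : (fun s : ℝ => midpoint ℝ a b + s • tangent a b) ⁻¹' hull γ =
      Set.Icc (-(‖b - a‖ / 2)) (‖b - a‖ / 2) := by
    rw [hγ, segment_eq_image_tangent hab, Set.preimage_image_eq _ hL.injective]
  rw [← hpre, ← Measure.restrict_map hL.continuous.measurable (measurableSet_hull γ), h1,
    Measure.restrict_restrict (measurableSet_hull γ), sideMeasure, Set.inter_eq_left.2]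
  rw [hγ, segment_eq_image_tangent hab]
  exact Set.image_subset_range _ _

theorem measurableEmbedding_line (a : E) {τ : E} (hτ : ‖τ‖ = 1) :
    MeasurableEmbedding fun s : ℝ => a + s • τ :=
  (isometry_line a hτ).isClosedEmbedding.measurableEmbedding

theorem isFiniteMeasure_sideMeasure {γ : Finset E} {a b : E} (hab : a ≠ b)
    (hγ : hull γ = segment ℝ a b) : IsFiniteMeasure (sideMeasure γ) := by
  rw [sideMeasure_eq_map hab hγ]
  infer_instance

theorem memLp_side {F : Type*} [NormedAddCommGroup F] {γ : Finset E} {a b : E}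
    (hab : a ≠ b) (hγ : hull γ = segment ℝ a b) {g : E → F} (hg : Continuous g) (q : ℝ≥0∞) :
    MemLp g q (sideMeasure γ) := by
  have := isFiniteMeasure_sideMeasure hab hγ
  obtain ⟨C, hC⟩ := (isCompact_hull γ).exists_bound_of_continuousOn hg.continuousOn
  exact MemLp.of_bound hg.aestronglyMeasurable C
    (ae_restrict_of_forall_mem (measurableSet_hull γ) hC)

/-- The ball of radius `ρ` about the midpoint cuts the line inside the segment, since `ρ` is at most
half its length; the end points of the side never matter. -/
theorem integral_sideMeasure {γ : Finset E} {a b : E} (hab : a ≠ b)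
    (hγ : hull γ = segment ℝ a b) {ρ : ℝ} (hρ : 2 * ρ ≤ ‖b - a‖) {F : E → ℝ}
    (hF : ∀ x ∉ Metric.ball (midpoint ℝ a b) ρ, F x = 0) :
    ∫ x, F x ∂sideMeasure γ = ∫ s : ℝ, F (midpoint ℝ a b + s • tangent a b) := by
  rw [sideMeasure_eq_map hab hγ, (measurableEmbedding_line _ (norm_tangent hab)).integral_map]
  refine setIntegral_eq_integral_of_forall_compl_eq_zero fun s hs => hF _ fun hx => hs ?_
  rw [mem_ball_iff_norm, add_sub_cancel_left, norm_smul, norm_tangent hab, mul_one,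
    Real.norm_eq_abs, abs_lt] at hx
  exact ⟨by linarith, by linarith⟩

/-! ### Weak curls -/

theorem memLp_curlS {φ : E → ℝ} (hφ : ContDiff ℝ ∞ φ) (hc : HasCompactSupport φ) (μ : Measure E)
    [IsFiniteMeasureOnCompacts μ] : MemLp (curlS φ) 2 μ :=
  (continuous_curlS hφ).memLp_of_hasCompactSupport (hasCompactSupport_curlS hc)

/-- The difference of two weak curls annihilates all test functions, so the fundamental lemma of the
calculus of variations applies. -/
theorem HasWeakCurl.ae_eq {U : Set E} (hU : IsOpen U) {w : E → E} {c c' : E → ℝ}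
    (hc : HasWeakCurl U w c) (hc' : HasWeakCurl U w c') (h2 : MemLp c 2 (volume.restrict U))
    (h2' : MemLp c' 2 (volume.restrict U)) : c =ᵐ[volume.restrict U] c' := by
  have h := hU.ae_eq_zero_of_integral_contDiff_smul_eq_zero (hc.2.1.sub hc'.2.1) (μ := volume) ?_
  · rw [EventuallyEq, ae_restrict_iff' hU.measurableSet]
    filter_upwards [h] with x hx hxU
    exact sub_eq_zero.1 (hx hxU)
  · intro φ h1 h3 h4
    have hφ : MemLp φ 2 (volume.restrict U) := h1.continuous.memLp_of_hasCompactSupport h3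
    have e := (hc.2.2 φ ⟨h1, h3, h4⟩).symm.trans (hc'.2.2 φ ⟨h1, h3, h4⟩)
    rw [← setIntegral_eq_integral_of_forall_compl_eq_zero (s := U)]
    · simp only [smul_eq_mul, Pi.sub_apply, mul_sub]
      rw [integral_sub]
      · simp_rw [mul_comm (φ _)]; rw [e, sub_self]
      · exact integrable_mul_of_memLp hφ h2
      · exact integrable_mul_of_memLp hφ h2'
    · intro x hx
      rw [image_eq_zero_of_notMem_tsupport fun h => hx (h4 h), zero_smul]

/-- Competitors in `L²` agree with `c` almost everywhere and the others have infinite norm, so the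
infimum is the norm of `c`. -/
theorem HasWeakCurl.curlNorm_eq {U : Set E} (hU : IsOpen U) {w : E → E} {c : E → ℝ}
    (hc : HasWeakCurl U w c) (h2 : MemLp c 2 (volume.restrict U)) :
    curlNorm U w = eLpNorm c 2 (volume.restrict U) := by
  refine le_antisymm (iInf₂_le c hc) (le_iInf₂ fun c' hc' => ?_)
  by_cases h2' : MemLp c' 2 (volume.restrict U)
  · exact (eLpNorm_congr_ae (hc.ae_eq hU hc' h2 h2')).le
  · have : eLpNorm c' 2 (volume.restrict U) = ⊤ := by
      by_contra h
      exact h2' ⟨hc'.2.1.aestronglyMeasurable, Ne.lt_top h⟩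
    rw [this]; exact le_top

theorem exists_hasWeakCurl_of_curlNorm_ne_top {U : Set E} {w : E → E} (h : curlNorm U w ≠ ⊤) :
    ∃ c, HasWeakCurl U w c ∧ MemLp c 2 (volume.restrict U) := by
  by_contra! h'
  refine h (top_le_iff.1 (le_iInf₂ fun c hc => top_le_iff.2 ?_))
  by_contra h2
  exact h' c hc ⟨hc.2.1.aestronglyMeasurable, Ne.lt_top h2⟩

/-- Passes from the oscillation of `f` to the residual, which differs from it by a polynomial field
on each triangle. -/
theorem HasWeakCurl.add_smooth {K : Finset E} {w w' : E → E} {c : E → ℝ}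
    (hc : HasWeakCurl (interior (hull K)) w c)
    (h2 : MemLp c 2 (volume.restrict (hull K))) (hw : MemLp w 2 (volume.restrict (hull K)))
    {P : E → E} (hP : ContDiff ℝ ∞ P) (h : w' =ᵐ[volume.restrict (hull K)] w + P) :
    HasWeakCurl (interior (hull K)) w' (c + curlV P) := by
  have hPm := memLp_hull K hP.continuous 2
  have hcm := memLp_hull K (continuous_curlV hP) 2
  refine ⟨?_, ?_, fun φ hφ => ?_⟩
  · refine IntegrableOn.locallyIntegrableOn (IntegrableOn.mono_set ?_ interior_subset)
    exact ((memLp_congr_ae h).2 (hw.add hPm)).integrable one_le_two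
  · refine IntegrableOn.locallyIntegrableOn (IntegrableOn.mono_set ?_ interior_subset)
    exact (h2.add hcm).integrable one_le_two
  · have hφ2 : MemLp φ 2 (volume.restrict (hull K)) :=
      hφ.1.continuous.memLp_of_hasCompactSupport hφ.2.1
    have hcs := memLp_curlS hφ.1 hφ.2.1 (volume.restrict (hull K))
    have e1 := hc.2.2 φ hφ
    rw [restrict_interior_hull] at e1 ⊢
    have e2 : ∫ x in hull K, inner ℝ (P x) (curlS φ x) = ∫ x in hull K, curlV P x * φ x := by
      have hs : ∀ x ∉ hull K, x ∉ tsupport φ := fun x hx h => hx (interior_subset (hφ.2.2 h))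
      rw [setIntegral_eq_integral_of_forall_compl_eq_zero,
        setIntegral_eq_integral_of_forall_compl_eq_zero, integral_inner_curlS hP hφ.1 hφ.2.1]
      · intro x hx; rw [image_eq_zero_of_notMem_tsupport (hs x hx), mul_zero]
      · intro x hx; rw [curlS_eq_zero (hs x hx), inner_zero_right]
    have e3 : ∫ x in hull K, inner ℝ (w' x) (curlS φ x) =
        ∫ x in hull K, (inner ℝ (w x) (curlS φ x) + inner ℝ (P x) (curlS φ x)) := by
      refine integral_congr_ae ?_
      filter_upwards [h] with x hx
      rw [hx, Pi.add_apply, inner_add_left]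
    rw [e3, integral_add (integrable_inner_of_memLp hw hcs) (integrable_inner_of_memLp hPm hcs),
      e1, e2, ← integral_add (integrable_mul_of_memLp h2 hφ2) (integrable_mul_of_memLp hcm hφ2)]
    simp [add_mul]

/-! ### Traces -/

theorem memLp_curlOp {K : Finset E} {D : E → E →L[ℝ] E}
    (hD : MemLp D 2 (volume.restrict (hull K))) :
    MemLp (fun x => curlOp (D x)) 2 (volume.restrict (hull K)) :=
  curlOp.comp_memLp' hD

theorem tendsto_eLpNorm_curlOp {K : Finset E} {D : E → E →L[ℝ] E} {φ : ℕ → E → E}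
    (h : Tendsto (fun n => eLpNorm (fderiv ℝ (φ n) - D) 2 (volume.restrict (hull K))) atTop (𝓝 0)) :
    Tendsto (fun n => eLpNorm (curlV (φ n) - fun x => curlOp (D x)) 2 (volume.restrict (hull K)))
      atTop (𝓝 0) := by
  have h0 : Tendsto (fun n => (‖curlOp‖₊ : ℝ≥0∞) *
      eLpNorm (fderiv ℝ (φ n) - D) 2 (volume.restrict (hull K))) atTop (𝓝 0) := by
    simpa using ENNReal.Tendsto.const_mul h (Or.inr ENNReal.coe_ne_top)
  refine tendsto_of_tendsto_of_tendsto_of_le_of_le tendsto_const_nhds h0 (fun _ => zero_le)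
    fun n => ?_
  refine eLpNorm_le_nnreal_smul_eLpNorm_of_ae_le_mul (.of_forall fun x => ?_) 2
  simp only [Pi.sub_apply, curlV, ← map_sub]
  exact curlOp.le_opNNNorm _

/-- Smooth fields converging in `H¹(K)` determine the weak curl of their limit. -/
theorem hasWeakCurl_of_tendsto {K : Finset E} {w : E → E} {D : E → E →L[ℝ] E} {ψ : ℕ → E → E}
    (hw : MemLp w 2 (volume.restrict (hull K))) (hD : MemLp D 2 (volume.restrict (hull K)))
    (hψ : ∀ n, ContDiff ℝ ∞ (ψ n))
    (h1 : Tendsto (fun n => eLpNorm (ψ n - w) 2 (volume.restrict (hull K))) atTop (𝓝 0))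
    (h2 : Tendsto (fun n => eLpNorm (fderiv ℝ (ψ n) - D) 2 (volume.restrict (hull K)))
      atTop (𝓝 0)) :
    HasWeakCurl (interior (hull K)) w fun x => curlOp (D x) := by
  refine ⟨?_, ?_, fun φ hφ => ?_⟩
  · exact IntegrableOn.locallyIntegrableOn
      (IntegrableOn.mono_set (hw.integrable one_le_two) interior_subset)
  · exact IntegrableOn.locallyIntegrableOn
      (IntegrableOn.mono_set ((memLp_curlOp hD).integrable one_le_two) interior_subset)
  · have hφ2 : MemLp φ 2 (volume.restrict (hull K)) :=
      hφ.1.continuous.memLp_of_hasCompactSupport hφ.2.1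
    rw [restrict_interior_hull]
    have hs : ∀ x ∉ hull K, x ∉ tsupport φ := fun x hx h => hx (interior_subset (hφ.2.2 h))
    refine tendsto_nhds_unique (tendsto_integral_inner (fun n => memLp_hull K (hψ n).continuous 2)
      hw (memLp_curlS hφ.1 hφ.2.1 _) h1) ?_
    refine (tendsto_integral_mul (fun n => memLp_hull K (continuous_curlV (hψ n)) 2)
      (memLp_curlOp hD) hφ2 (tendsto_eLpNorm_curlOp h2)).congr fun n => ?_
    rw [setIntegral_eq_integral_of_forall_compl_eq_zero,
      setIntegral_eq_integral_of_forall_compl_eq_zero, integral_inner_curlS (hψ n) hφ.1 hφ.2.1]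
    · intro x hx; rw [curlS_eq_zero (hs x hx), inner_zero_right]
    · intro x hx; rw [image_eq_zero_of_notMem_tsupport (hs x hx), mul_zero]

/-- Green's formula on a triangle that coincides with a half plane on the support of the test
function, for smooth fields. -/
theorem setIntegral_inner_curlS_of_smooth {K γ : Finset E} {a b : E} (hab : a ≠ b)
    (hγ : hull γ = segment ℝ a b) {ρ : ℝ} (hρ : 2 * ρ ≤ ‖b - a‖)
    (hK : ∀ x ∈ Metric.ball (midpoint ℝ a b) ρ,
      x ∈ hull K ↔ x ∈ halfPlane (midpoint ℝ a b) (tangent a b))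
    {φ : E → ℝ} (hφ : IsTest (Metric.ball (midpoint ℝ a b) ρ) φ) {v : E → E}
    (hv : ContDiff ℝ ∞ v) :
    ∫ x in hull K, inner ℝ (v x) (curlS φ x) =
      (∫ x in hull K, curlV v x * φ x) -
        ∫ x, inner ℝ (v x) (φ x • tangent a b) ∂sideMeasure γ := by
  have hτ := norm_tangent hab
  have hi : ∀ x ∉ Metric.ball (midpoint ℝ a b) ρ, x ∉ tsupport φ := fun x hx h => hx (hφ.2.2 h)
  have hφ2 : MemLp φ 2 (volume.restrict (hull K)) :=
    hφ.1.continuous.memLp_of_hasCompactSupport hφ.2.1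
  have hG := hφ.1.smul hv
  have hGc : HasCompactSupport (φ • v) := hφ.2.1.smul_right
  have h3 : ∀ x, curlV (φ • v) x = curlV v x * φ x - inner ℝ (v x) (curlS φ x) :=
    fun x => curlV_smul (hφ.1.differentiable (by simp) x) (hv.differentiable (by simp) x)
  -- Outside the ball the integrand vanishes and inside it the triangle is the half plane, so the
  -- triangle may be replaced by the half plane.
  have e1 : ∫ x in hull K, curlV (φ • v) x =
      ∫ x in halfPlane (midpoint ℝ a b) (tangent a b), curlV (φ • v) x := by
    rw [← integral_indicator (measurableSet_hull K),
      ← integral_indicator (isClosed_halfPlane _ _).measurableSet]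
    congr 1
    ext x
    by_cases hx : x ∈ Metric.ball (midpoint ℝ a b) ρ
    · by_cases hxK : x ∈ hull K
      · rw [Set.indicator_of_mem hxK, Set.indicator_of_mem ((hK x hx).1 hxK)]
      · rw [Set.indicator_of_notMem hxK, Set.indicator_of_notMem (fun h => hxK ((hK x hx).2 h))]
    · have : curlV (φ • v) x = 0 := by
        rw [h3, curlS_eq_zero (hi x hx), image_eq_zero_of_notMem_tsupport (hi x hx)]
        simp
      rw [Set.indicator_apply_eq_zero.2 fun _ => this, Set.indicator_apply_eq_zero.2 fun _ => this]
  rw [setIntegral_halfPlane_curlV _ hτ hG hGc] at e1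
  have e2 : ∫ x, inner ℝ (v x) (φ x • tangent a b) ∂sideMeasure γ =
      ∫ s : ℝ, inner ℝ (tangent a b) ((φ • v) (midpoint ℝ a b + s • tangent a b)) := by
    rw [integral_sideMeasure hab hγ hρ]
    · refine integral_congr_ae (.of_forall fun s => ?_)
      show inner ℝ (v _) (φ _ • tangent a b) = inner ℝ (tangent a b) (φ _ • v _)
      rw [inner_smul_right, inner_smul_right, real_inner_comm]
    · intro x hx
      rw [image_eq_zero_of_notMem_tsupport (hi x hx), zero_smul, inner_zero_right]
  simp_rw [h3] at e1
  rw [integral_sub (integrable_mul_of_memLp (memLp_hull K (continuous_curlV hv) 2) hφ2)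
    (integrable_inner_of_memLp (memLp_hull K hv.continuous 2) (memLp_curlS hφ.1 hφ.2.1 _)),
    ← e2] at e1
  linarith

/-- Green's formula on a triangle that coincides with a half plane on the support of the test
function. -/
theorem IsTrace.setIntegral_inner_curlS {K γ : Finset E} {a b : E} (hab : a ≠ b)
    (hγ : hull γ = segment ℝ a b) {ρ : ℝ} (hρ : 2 * ρ ≤ ‖b - a‖)
    (hK : ∀ x ∈ Metric.ball (midpoint ℝ a b) ρ,
      x ∈ hull K ↔ x ∈ halfPlane (midpoint ℝ a b) (tangent a b))
    {φ : E → ℝ} (hφ : IsTest (Metric.ball (midpoint ℝ a b) ρ) φ) {w g : E → E} {c : E → ℝ}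
    (hw : IsTrace K γ w g) (hc : HasWeakCurl (interior (hull K)) w c)
    (h2 : MemLp c 2 (volume.restrict (hull K))) :
    ∫ x in hull K, inner ℝ (w x) (curlS φ x) =
      (∫ x in hull K, c x * φ x) -
        ∫ x, inner ℝ (g x) (φ x • tangent a b) ∂sideMeasure γ := by
  obtain ⟨hwm, hgm, D, hD, ψ, hψ, l1, l2, l3⟩ := hw
  have hφ2 : MemLp φ 2 (volume.restrict (hull K)) :=
    hφ.1.continuous.memLp_of_hasCompactSupport hφ.2.1
  -- The trace supplies its own limit Jacobian `D`. Its curl is a weak curl of `w`, hence equals the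
  -- given `c`, and the smooth formula can pass to the limit.
  have hcD : c =ᵐ[volume.restrict (hull K)] fun x => curlOp (D x) := by
    have := hc.ae_eq isOpen_interior (hasWeakCurl_of_tendsto hwm hD hψ l1 l2)
      (by rwa [restrict_interior_hull])
      (by rw [restrict_interior_hull]; exact memLp_curlOp hD)
    rwa [restrict_interior_hull] at this
  have e : ∫ x in hull K, c x * φ x = ∫ x in hull K, curlOp (D x) * φ x :=
    integral_congr_ae (hcD.mono fun x hx => by simp only [hx])
  rw [e]
  refine tendsto_nhds_unique (tendsto_integral_inner (fun n => memLp_hull K (hψ n).continuous 2)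
      hwm (memLp_curlS hφ.1 hφ.2.1 _) l1) ?_
  refine ((tendsto_integral_mul (fun n => memLp_hull K (continuous_curlV (hψ n)) 2)
      (memLp_curlOp hD) hφ2 (tendsto_eLpNorm_curlOp l2)).sub
    (tendsto_integral_inner (fun n => memLp_side hab hγ (hψ n).continuous 2) hgm
      (memLp_side hab hγ (hφ.1.continuous.smul continuous_const) 2) l3)).congr fun n => ?_
  exact (setIntegral_inner_curlS_of_smooth hab hγ hρ hK hφ (hψ n)).symm

theorem memLp_fun_add {α F : Type*} [MeasurableSpace α] [NormedAddCommGroup F] {μ : Measure α}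
    {f g : α → F} {q : ℝ≥0∞} (hf : MemLp f q μ) (hg : MemLp g q μ) :
    MemLp (fun x => f x + g x) q μ := hf.add hg

theorem IsTrace.add_smooth {K γ : Finset E} {a b : E} (hab : a ≠ b)
    (hγ : hull γ = segment ℝ a b) {w w' g P : E → E} (hw : IsTrace K γ w g)
    (hP : ContDiff ℝ ∞ P) (h : w' =ᵐ[volume.restrict (hull K)] w + P) :
    IsTrace K γ w' (g + P) := by
  obtain ⟨hwm, hgm, D, hD, ψ, hψ, l1, l2, l3⟩ := hw
  have hP1 := memLp_hull K hP.continuous 2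
  have hP2 := memLp_side hab hγ hP.continuous 2
  have hP3 := memLp_hull K (hP.continuous_fderiv (by simp)) 2
  have k1 : MemLp w' 2 (volume.restrict (hull K)) := (memLp_congr_ae h).2 (hwm.add hP1)
  have k2 : MemLp (g + P) 2 (sideMeasure γ) := hgm.add hP2
  have k3 := memLp_fun_add hD hP3
  have k4 : ∀ n, ContDiff ℝ ∞ (ψ n + P) := fun n => (hψ n).add hP
  refine ⟨k1, k2, fun x => D x + fderiv ℝ P x, k3, fun n => ψ n + P, k4, ?_, ?_, ?_⟩
  · refine l1.congr fun n => eLpNorm_congr_ae ?_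
    filter_upwards [h] with x hx
    simp [hx]
  · have e : ∀ n, fderiv ℝ (ψ n + P) - (fun x => D x + fderiv ℝ P x) = fderiv ℝ (ψ n) - D := fun n => by
      funext x
      simp only [Pi.sub_apply]
      rw [fderiv_add ((hψ n).differentiable (by simp) x) (hP.differentiable (by simp) x),
        add_sub_add_right_eq_sub]
    simpa only [e] using l2
  · simpa only [add_sub_add_right_eq_sub] using l3

/-! ### Scaling -/

/-- The factor is `s^(d/2)`: it gives `s` in the plane and `s^(1/2)` on a side, the two weights of
the indicator. -/
theorem eLpNorm_two_comp_smul {V F : Type*} [NormedAddCommGroup V] [NormedSpace ℝ V]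
    [MeasurableSpace V] [BorelSpace V] [FiniteDimensional ℝ V] (μ : Measure V) [μ.IsAddHaarMeasure]
    [NormedAddCommGroup F] (g : V → F) {s : ℝ} (hs : 0 < s) :
    eLpNorm (fun x => g (s⁻¹ • x)) 2 μ =
      ENNReal.ofReal (s ^ Module.finrank ℝ V) ^ (1 / 2 : ℝ) * eLpNorm g 2 μ := by
  have hemb : MeasurableEmbedding (fun x : V => s⁻¹ • x) :=
    (Homeomorph.smulOfNeZero s⁻¹ (inv_ne_zero hs.ne')).measurableEmbedding
  have h := hemb.eLpNorm_map_measure (g := g) (p := 2) (μ := μ)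
  rw [Measure.map_addHaar_smul μ (inv_ne_zero hs.ne'), eLpNorm_smul_measure_of_ne_top (by simp)]
    at h
  rw [show (fun x => g (s⁻¹ • x)) = g ∘ fun x : V => s⁻¹ • x from rfl, ← h, inv_pow, inv_inv,
    abs_of_pos (by positivity)]
  simp

/-- The similarity that takes the disc of radius `s` about `m` to the unit disc and the direction
`τ` to that of the first axis. -/
def toRef (m : E) {s : ℝ} (hs : 0 < s) {τ : E} (hτ : ‖τ‖ = 1) : E ≃ₜ E :=
  ((Homeomorph.addRight (-m)).trans (frame τ hτ).symm.toHomeomorph).trans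
    (Homeomorph.smulOfNeZero s⁻¹ (inv_ne_zero hs.ne'))

section toRef

variable (m : E) {s : ℝ} (hs : 0 < s) {τ : E} (hτ : ‖τ‖ = 1)

theorem toRef_apply (x : E) : toRef m hs hτ x = s⁻¹ • (frame τ hτ).symm (x - m) := by
  simp [toRef, sub_eq_add_neg]

theorem norm_toRef (x : E) : ‖toRef m hs hτ x‖ = s⁻¹ * ‖x - m‖ := by
  rw [toRef_apply, norm_smul, LinearIsometryEquiv.norm_map, norm_inv, Real.norm_of_nonneg hs.le]

theorem toRef_line (t : ℝ) : toRef m hs hτ (m + t • τ) = axisPt (s⁻¹ * t) := by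
  rw [toRef_apply, add_sub_cancel_left, map_smul, smul_smul]
  have : (frame τ hτ).symm τ = EuclideanSpace.single 0 1 := by
    rw [LinearIsometryEquiv.symm_apply_eq, frame_apply]
    simp
  rw [this, axisPt]
  ext i; fin_cases i <;> simp

theorem hasFDerivAt_toRef (x : E) : HasFDerivAt (toRef m hs hτ)
    (s⁻¹ • ((frame τ hτ).symm.toContinuousLinearEquiv : E →L[ℝ] E)) x := by
  have h := (((frame τ hτ).symm.toContinuousLinearEquiv : E →L[ℝ] E).hasFDerivAt.comp x
    ((hasFDerivAt_id x).sub_const m)).const_smul s⁻¹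
  have e : (toRef m hs hτ : E → E) = fun x => s⁻¹ • (frame τ hτ).symm (x - m) :=
    funext (toRef_apply m hs hτ)
  rw [e]
  exact h

theorem contDiff_toRef : ContDiff ℝ ∞ (toRef m hs hτ) := by
  have e : (toRef m hs hτ : E → E) = fun x => s⁻¹ • (frame τ hτ).symm (x - m) :=
    funext (toRef_apply m hs hτ)
  rw [e]
  exact ((frame τ hτ).symm.contDiff.comp (contDiff_id.sub contDiff_const)).const_smul _

theorem eLpNorm_comp_toRef {F : Type*} [NormedAddCommGroup F] (g : E → F) :
    eLpNorm (fun x => g (toRef m hs hτ x)) 2 volume = ENNReal.ofReal s * eLpNorm g 2 volume := by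
  have h := eLpNorm_two_comp_smul volume g hs
  rw [finrank_euclideanSpace_fin] at h
  have h1 : MeasurePreserving (fun x : E => (frame τ hτ).symm (x + -m)) volume volume :=
    (frame τ hτ).symm.measurePreserving.comp (measurePreserving_add_right volume (-m))
  have hemb : MeasurableEmbedding fun x : E => (frame τ hτ).symm (x + -m) :=
    ((Homeomorph.addRight (-m)).trans (frame τ hτ).symm.toHomeomorph).measurableEmbedding
  have h2 := hemb.eLpNorm_map_measure (g := fun x => g (s⁻¹ • x)) (p := 2) (μ := volume)
  rw [h1.map_eq, h] at h2
  have e : (fun x => g (toRef m hs hτ x)) =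
      (fun x => g (s⁻¹ • x)) ∘ fun x : E => (frame τ hτ).symm (x + -m) := rfl
  rw [e, ← h2, ENNReal.ofReal_pow hs.le, ← ENNReal.rpow_natCast, ← ENNReal.rpow_mul]
  norm_num

/-- In two dimensions the factor `s⁻¹` of the derivative cancels the factor `s` of the `L²` norm, so
the bound does not depend on `s`. The `2` comes from `enorm_curlS_le`. -/
theorem eLpNorm_curlS_comp_toRef_le {F : E → ℝ} (hF : ContDiff ℝ ∞ F) :
    eLpNorm (curlS fun x => F (toRef m hs hτ x)) 2 volume ≤
      2 * eLpNorm (fderiv ℝ F) 2 volume := by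
  have hd : ∀ x, ‖fderiv ℝ (fun x => F (toRef m hs hτ x)) x‖ ≤
      s⁻¹ * ‖fderiv ℝ F (toRef m hs hτ x)‖ := by
    intro x
    have h := (hF.differentiable (by simp) _).hasFDerivAt.comp x (hasFDerivAt_toRef m hs hτ x)
    have h' : fderiv ℝ (fun x => F (toRef m hs hτ x)) x = _ := h.fderiv
    rw [h']
    refine (ContinuousLinearMap.opNorm_comp_le _ _).trans ?_
    rw [mul_comm]
    refine mul_le_mul_of_nonneg_right ?_ (norm_nonneg _)
    rw [norm_smul, norm_inv, Real.norm_of_nonneg hs.le]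
    refine mul_le_of_le_one_right (inv_nonneg.2 hs.le) ?_
    exact ContinuousLinearMap.opNorm_le_bound _ zero_le_one fun y => by simp
  have h1 : eLpNorm (curlS fun x => F (toRef m hs hτ x)) 2 volume ≤
      (2 * s⁻¹).toNNReal • eLpNorm (fun x => fderiv ℝ F (toRef m hs hτ x)) 2 volume := by
    refine eLpNorm_le_nnreal_smul_eLpNorm_of_ae_le_mul (.of_forall fun x => ?_) 2
    rw [← NNReal.coe_le_coe]
    simp only [coe_nnnorm, NNReal.coe_mul]
    rw [Real.coe_toNNReal _ (by positivity)]
    calc _ ≤ _ := enorm_curlS_le _ x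
      _ ≤ 2 * (s⁻¹ * ‖fderiv ℝ F (toRef m hs hτ x)‖) := by gcongr; exact hd x
      _ = _ := by ring
  refine h1.trans (le_of_eq ?_)
  rw [eLpNorm_comp_toRef, ENNReal.smul_def, smul_eq_mul, ← mul_assoc]
  congr 1
  change ENNReal.ofReal _ * _ = _
  rw [← ENNReal.ofReal_mul (by positivity), mul_assoc, inv_mul_cancel₀ hs.ne', mul_one]
  simp

theorem isTest_comp_toRef {F : E → ℝ} (hF : IsTest (Metric.ball 0 1) F) :
    IsTest (Metric.ball m s) fun x => F (toRef m hs hτ x) := by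
  refine ⟨hF.1.comp (contDiff_toRef m hs hτ),
    hF.2.1.comp_isClosedEmbedding (toRef m hs hτ).isClosedEmbedding, ?_⟩
  refine (tsupport_comp_subset_preimage F (toRef m hs hτ).continuous).trans fun x hx => ?_
  have := hF.2.2 hx
  rw [mem_ball_zero_iff, norm_toRef, inv_mul_lt_iff₀ hs, mul_one] at this
  exact mem_ball_iff_norm.2 this

end toRef

theorem isTest_bubble {g : E → ℝ} (hg : ContDiff ℝ ∞ g) : IsTest (Metric.ball 0 1) (bubble g) :=
  ⟨contDiff_bubble hg, hasCompactSupport_bubble g, tsupport_bubble g⟩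

/-! ### Geometry of triangles -/

theorem volume_segment (a b : E) : volume (segment ℝ a b) = 0 := by
  have h : affineSpan ℝ ({a, b} : Set E) ≠ ⊤ := by
    intro h
    have h1 := collinear_iff_finrank_le_one.1 (collinear_pair ℝ a b)
    rw [← direction_affineSpan, h, AffineSubspace.direction_top, finrank_top,
      finrank_euclideanSpace_fin] at h1
    omega
  refine measure_mono_null ?_ (Measure.addHaar_affineSubspace volume _ h)
  rw [← convexHull_pair]
  exact convexHull_subset_affineSpan _

/-- An affine function with values in the unit interval on a disc. -/
theorem abs_sub_le_of_mem_Icc_on_ball (L : E →ᵃ[ℝ] ℝ) {c : E} {r : ℝ} (hr : 0 < r)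
    (h : ∀ y ∈ Metric.ball c r, L y ∈ Set.Icc (0 : ℝ) 1) (y y' : E) :
    2 * r * |L y - L y'| ≤ ‖y - y'‖ := by
  rcases eq_or_ne y y' with rfl | hne
  · simp
  have h0 : 0 < ‖y - y'‖ := norm_pos_iff.2 (sub_ne_zero.2 hne)
  have hlin : L y - L y' = L.linear (y - y') := by
    have := L.linearMap_vsub y y'
    simpa using this.symm
  -- Between antipodal points at distance `t` from the centre, `L` varies by at most `1` over a
  -- length `2 * t`. The disc is open, so this is done for `t < r` and then `t` tends to `r`.
  suffices H : ∀ t : ℝ, 0 ≤ t → t < r → 2 * t * |L y - L y'| ≤ ‖y - y'‖ by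
    refine le_of_tendsto (f := fun t : ℝ => 2 * t * |L y - L y'|) (x := 𝓝[<] r) ?_ ?_
    · refine ((Continuous.tendsto (by fun_prop) r).mono_left nhdsWithin_le_nhds)
    · filter_upwards [Ioo_mem_nhdsLT hr] with t ht using H t ht.1.le ht.2
  intro t ht0 htr
  set v := (t / ‖y - y'‖) • (y - y') with hv
  have hvn : ‖v‖ = t := by
    rw [hv, norm_smul, norm_div, norm_norm, Real.norm_of_nonneg ht0, div_mul_cancel₀ _ h0.ne']
  have hp := h (c + v) (by simpa [hvn] using htr)
  have hm := h (c - v) (by simpa [mem_ball_iff_norm, hvn] using htr)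
  have e1 : L (c + v) = L c + L.linear v := by
    have := L.map_vadd c v; simpa [add_comm] using this
  have e2 : L (c - v) = L c - L.linear v := by
    have := L.map_vadd c (-v); simp [neg_add_eq_sub] at this; simpa using this
  have e3 : L.linear v = t / ‖y - y'‖ * (L y - L y') := by
    rw [hlin, hv, map_smul, smul_eq_mul]
  have h1 : 2 * |L.linear v| ≤ 1 := by
    rw [e1] at hp; rw [e2] at hm
    have := hp.1; have := hp.2; have := hm.1; have := hm.2
    rcases abs_cases (L.linear v) with ⟨h, _⟩ | ⟨h, _⟩ <;> rw [h] <;> linarith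
  rw [e3, abs_mul, abs_of_nonneg (by positivity)] at h1
  have : 2 * t * |L y - L y'| = ‖y - y'‖ * (2 * (t / ‖y - y'‖ * |L y - L y'|)) := by
    field_simp
  rw [this]
  exact mul_le_of_le_one_right h0.le h1

/-- The barycentric coordinates of a triangle. -/
def triangleBasis (K : Finset E) (hcard : K.card = 3)
    (hind : AffineIndependent ℝ ((↑) : {x // x ∈ K} → E)) : AffineBasis {x // x ∈ K} ℝ E :=
  ⟨(↑), hind, by
    rw [hind.affineSpan_eq_top_iff_card_eq_finrank_add_one]
    simp [hcard]⟩

theorem mem_hull_iff_coord {K : Finset E} (hcard : K.card = 3)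
    (hind : AffineIndependent ℝ ((↑) : {x // x ∈ K} → E)) (y : E) :
    y ∈ hull K ↔ ∀ i, 0 ≤ (triangleBasis K hcard hind).coord i y := by
  have h := (triangleBasis K hcard hind).convexHull_eq_nonneg_coord
  have e : Set.range (triangleBasis K hcard hind) = (K : Set E) := by
    change Set.range ((↑) : {x // x ∈ K} → E) = _
    simp
  rw [e] at h
  rw [hull, h]
  rfl

/-- Barycentric coordinates take values in `[0, 1]` on the triangle, in particular on the disc. This
Lipschitz bound is the form in which shape regularity enters the local geometry. -/
theorem coord_sub_le {K : Finset E} (hcard : K.card = 3)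
    (hind : AffineIndependent ℝ ((↑) : {x // x ∈ K} → E)) {c : E} {r : ℝ} (hr : 0 < r)
    (hball : Metric.ball c r ⊆ hull K) (i : {x // x ∈ K}) (y y' : E) :
    2 * r * |(triangleBasis K hcard hind).coord i y - (triangleBasis K hcard hind).coord i y'| ≤
      ‖y - y'‖ := by
  refine abs_sub_le_of_mem_Icc_on_ball (c := c) _ hr (fun x hx => ?_) y y'
  have h := (mem_hull_iff_coord hcard hind x).1 (hball hx)
  refine ⟨h i, ?_⟩
  rw [← (triangleBasis K hcard hind).sum_coord_apply_eq_one x]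
  exact Finset.single_le_sum (fun j _ => h j) (Finset.mem_univ i)

/-- The barycentric coordinate of `b` rises from `0` to `1` along the side. -/
theorem two_mul_le_norm_side {K : Finset E} (hcard : K.card = 3)
    (hind : AffineIndependent ℝ ((↑) : {x // x ∈ K} → E)) {c : E} {r : ℝ} (hr : 0 < r)
    (hball : Metric.ball c r ⊆ hull K) {a b : E} (ha : a ∈ K) (hb : b ∈ K) (hab : a ≠ b) :
    2 * r ≤ ‖b - a‖ := by
  have h := coord_sub_le hcard hind hr hball ⟨b, hb⟩ b a
  have h1 : (triangleBasis K hcard hind).coord ⟨b, hb⟩ b = 1 :=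
    (triangleBasis K hcard hind).coord_apply_eq ⟨b, hb⟩
  have h2 : (triangleBasis K hcard hind).coord ⟨b, hb⟩ a = 0 :=
    (triangleBasis K hcard hind).coord_apply_ne (i := ⟨b, hb⟩) (j := ⟨a, ha⟩)
      (by simpa using hab.symm)
  rw [h1, h2] at h
  simpa using h

theorem decomp_frame {τ : E} (hτ : ‖τ‖ = 1) (v : E) :
    v = (inner ℝ τ v : ℝ) • τ + (inner ℝ (rot τ) v : ℝ) • rot τ := by
  conv_lhs => rw [← (frame τ hτ).apply_symm_apply v, frame_apply, frame_symm_apply]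
  simp

/-- Near the midpoint of a side, a triangle is a half disc. -/
theorem hull_eq_halfPlane_near_midpoint {K : Finset E} (hcard : K.card = 3)
    (hind : AffineIndependent ℝ ((↑) : {x // x ∈ K} → E)) {c : E} {r : ℝ} (hr : 0 < r)
    (hball : Metric.ball c r ⊆ hull K) {a b : E} (ha : a ∈ K) (hb : b ∈ K) (hab : a ≠ b) :
    (∀ y ∈ Metric.ball (midpoint ℝ a b) r,
      y ∈ hull K ↔ y ∈ halfPlane (midpoint ℝ a b) (tangent a b)) ∨
    (∀ y ∈ Metric.ball (midpoint ℝ a b) r,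
      y ∈ hull K ↔ y ∈ halfPlane (midpoint ℝ a b) (tangent b a)) := by
  set B := triangleBasis K hcard hind with hB
  set m := midpoint ℝ a b with hm
  set τ := tangent a b with hτdef
  have hτ : ‖τ‖ = 1 := norm_tangent hab
  obtain ⟨x, hx, hxa, hxb⟩ : ∃ x ∈ K, x ≠ a ∧ x ≠ b := by
    by_contra! h
    have : K ⊆ {a, b} := fun y hy => by
      by_cases hya : y = a
      · simp [hya]
      · simp [h y hy hya]
    have := Finset.card_le_card this
    have := Finset.card_le_two (a := a) (b := b)
    omega
  have hKeq : ∀ i : {x // x ∈ K}, i = ⟨a, ha⟩ ∨ i = ⟨b, hb⟩ ∨ i = ⟨x, hx⟩ := by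
    have h3 : ({a, b, x} : Finset E) = K := by
      refine Finset.eq_of_subset_of_card_le ?_ ?_
      · intro y hy
        simp only [Finset.mem_insert, Finset.mem_singleton] at hy
        rcases hy with rfl | rfl | rfl <;> assumption
      · rw [hcard, Finset.card_eq_three.2 ⟨a, b, x, hab, hxa.symm, hxb.symm, rfl⟩]
    intro i
    have : (i : E) ∈ ({a, b, x} : Finset E) := h3.symm ▸ i.2
    simp only [Finset.mem_insert, Finset.mem_singleton] at this
    simpa [Subtype.ext_iff] using this
  have hself : ∀ (y : E) (hy : y ∈ K), B.coord ⟨y, hy⟩ y = 1 := fun y hy =>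
    B.coord_apply_eq ⟨y, hy⟩
  have hne : ∀ (y y' : E) (hy : y ∈ K) (_ : y' ∈ K), y ≠ y' → B.coord ⟨y, hy⟩ y' = 0 :=
    fun y y' hy hy' h => B.coord_apply_ne (i := ⟨y, hy⟩) (j := ⟨y', hy'⟩) (by simpa using h)
  have hmid : ∀ i, B.coord i m = (B.coord i a + B.coord i b) / 2 := fun i => by
    rw [hm, AffineMap.map_midpoint, midpoint_eq_smul_add, invOf_eq_inv, smul_eq_mul]
    ring
  -- The coordinates of `a` and `b` equal `1/2` at the midpoint and change by less than `1/2` in the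
  -- ball, so only the coordinate of the third vertex decides membership there.
  have hside : ∀ i, B.coord i m = 1 / 2 → ∀ y ∈ Metric.ball m r, 0 ≤ B.coord i y := by
    intro i hi y hy
    have h := coord_sub_le hcard hind hr hball i y m
    rw [← hB, hi] at h
    rw [mem_ball_iff_norm] at hy
    have h1 : 2 * r * |B.coord i y - 1 / 2| < 2 * r * (1 / 2) := by linarith
    have h2 := lt_of_mul_lt_mul_left h1 (by positivity)
    linarith [(abs_lt.1 h2).1]
  set ζ := B.coord ⟨x, hx⟩ with hζ
  have hζm : ζ m = 0 := by
    rw [hmid, hne x a hx ha hxa, hne x b hx hb hxb]; norm_num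
  have hiff : ∀ y ∈ Metric.ball m r, y ∈ hull K ↔ 0 ≤ ζ y := by
    intro y hy
    rw [mem_hull_iff_coord hcard hind]
    refine ⟨fun h => h _, fun h i => ?_⟩
    rcases hKeq i with rfl | rfl | rfl
    · exact hside _ (by rw [hmid, hself a ha, hne a b ha hb hab]; norm_num) y hy
    · exact hside _ (by rw [hmid, hself b hb, hne b a hb ha hab.symm]; norm_num) y hy
    · exact h
  have hlin : ∀ y y', ζ y - ζ y' = ζ.linear (y - y') := fun y y' => by
    simpa using (ζ.linearMap_vsub y y').symm
  have hτ0 : ζ.linear τ = 0 := by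
    rw [hτdef, tangent, map_smul, ← hlin, hne x a hx ha hxa, hne x b hx hb hxb]
    simp
  -- The third coordinate vanishes along the side, so it is a multiple of the signed distance to its
  -- line; the sign of the factor tells on which side the triangle lies.
  have hζy : ∀ y, ζ y = inner ℝ (rot τ) (y - m) * ζ.linear (rot τ) := by
    intro y
    have h := hlin y m
    rw [hζm, sub_zero] at h
    rw [h]
    conv_lhs => rw [decomp_frame hτ (y - m), map_add, map_smul, map_smul, hτ0]
    simp
  have ht : ζ.linear (rot τ) ≠ 0 := by
    intro h0
    have := hζy x
    rw [hself x hx, h0, mul_zero] at this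
    exact one_ne_zero this
  rcases lt_or_gt_of_ne ht with h | h
  · right
    intro y hy
    rw [hiff y hy, hζy, tangent_swap, halfPlane, Set.mem_ofPred_eq, rot_neg, inner_neg_left]
    constructor
    · intro h'; nlinarith
    · intro h'; nlinarith
  · left
    intro y hy
    rw [hiff y hy, hζy, halfPlane, Set.mem_ofPred_eq]
    exact mul_nonneg_iff_of_pos_right h

theorem norm_side_le_hK {K : Finset E} {a b : E} (ha : a ∈ K) (hb : b ∈ K) : ‖b - a‖ ≤ hK K := by
  rw [← dist_eq_norm]
  exact Metric.dist_le_diam_of_mem (isCompact_hull K).isBounded (subset_convexHull ℝ _ hb)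
    (subset_convexHull ℝ _ ha)

theorem hull_pair (a b : E) [DecidableEq E] : hull ({a, b} : Finset E) = segment ℝ a b := by
  simp [hull, convexHull_pair]

/-- Two triangles of a mesh with a common side meet in that side. -/
theorem Mesh.hull_inter_hull {Ω : Set E} (𝒯 : Mesh Ω) {K K' : Finset E} (hK : K ∈ 𝒯.elems)
    (hK' : K' ∈ 𝒯.elems) (hne : K ≠ K') {a b : E} (hab : a ≠ b) (ha : a ∈ K) (hb : b ∈ K)
    (ha' : a ∈ K') (hb' : b ∈ K') : hull K ∩ hull K' = segment ℝ a b := by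
  classical
  have h1 : ({a, b} : Finset E) ⊆ K ∩ K' := by
    intro y hy
    simp only [Finset.mem_insert, Finset.mem_singleton] at hy
    rcases hy with rfl | rfl <;> simp [*]
  have h2 : (K ∩ K').card ≤ 2 := by
    by_contra! h
    have e1 : K ∩ K' = K := Finset.eq_of_subset_of_card_le Finset.inter_subset_left
      (by rw [𝒯.card_eq K hK]; omega)
    have e2 : K ∩ K' = K' := Finset.eq_of_subset_of_card_le Finset.inter_subset_right
      (by rw [𝒯.card_eq K' hK']; omega)
    exact hne (e1.symm.trans e2)
  have h3 : ({a, b} : Finset E) = K ∩ K' := Finset.eq_of_subset_of_card_le h1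
    (by rw [Finset.card_pair hab]; exact h2)
  rw [hull, hull, 𝒯.conforming K hK K' hK', ← Finset.coe_inter, ← h3, ← convexHull_pair]
  simp

/-- Two triangles with a common side lie on different sides of it. -/
theorem Mesh.not_same_side {Ω : Set E} (𝒯 : Mesh Ω) {K K' : Finset E} (hK : K ∈ 𝒯.elems)
    (hK' : K' ∈ 𝒯.elems) (hne : K ≠ K') {a b : E} (hab : a ≠ b) (ha : a ∈ K) (hb : b ∈ K)
    (ha' : a ∈ K') (hb' : b ∈ K') {τ : E} (hτ : ‖τ‖ = 1) (hτab : τ = tangent a b ∨ τ = tangent b a)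
    {ρ : ℝ} (hρ : 0 < ρ)
    (h : ∀ y ∈ Metric.ball (midpoint ℝ a b) ρ, y ∈ hull K ↔ y ∈ halfPlane (midpoint ℝ a b) τ)
    (h' : ∀ y ∈ Metric.ball (midpoint ℝ a b) ρ, y ∈ hull K' ↔ y ∈ halfPlane (midpoint ℝ a b) τ) :
    False := by
  set m := midpoint ℝ a b
  have hr : ‖rot τ‖ = 1 := (norm_rot τ).trans hτ
  -- This point would lie in both triangles, hence on their common side, whose points have no normal
  -- component relative to `m`.
  have hb1 : m + (ρ / 2) • rot τ ∈ Metric.ball m ρ := by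
    rw [mem_ball_iff_norm, add_sub_cancel_left, norm_smul, hr, mul_one, Real.norm_of_nonneg
      (by positivity)]
    linarith
  have hin : inner ℝ (rot τ) (m + (ρ / 2) • rot τ - m) = ρ / 2 := by
    rw [add_sub_cancel_left, inner_smul_right, real_inner_self_eq_norm_sq, hr]; ring
  have hh : m + (ρ / 2) • rot τ ∈ halfPlane m τ := by
    rw [halfPlane, Set.mem_ofPred_eq, hin]; positivity
  have hs : m + (ρ / 2) • rot τ ∈ segment ℝ a b := by
    rw [← 𝒯.hull_inter_hull hK hK' hne hab ha hb ha' hb']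
    exact ⟨(h _ hb1).2 hh, (h' _ hb1).2 hh⟩
  rw [segment_eq_image_tangent hab] at hs
  obtain ⟨t, -, ht⟩ := hs
  have ht' : m + (ρ / 2) • rot τ - m = t • tangent a b := by
    rw [← ht]; exact add_sub_cancel_left _ _
  rw [ht', inner_smul_right] at hin
  have h0 : inner ℝ (rot τ) (tangent a b) = 0 := by
    rcases hτab with e | e
    · rw [← e, inner_rot_self]
    · rw [e, tangent_swap, rot_neg, inner_neg_left, inner_rot_self, neg_zero]
  rw [h0] at hin
  linarith

/-! ### Divergence-free test fields -/

theorem IsPolygonalLipschitzDomain.volume_frontier {Ω : Set E}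
    (hΩ : IsPolygonalLipschitzDomain Ω) : volume (frontier Ω) = 0 := by
  obtain ⟨s, hs⟩ := hΩ.polygonal
  refine measure_mono_null hs ?_
  exact (measure_biUnion_null_iff s.countable_toSet).2 fun e _ => volume_segment _ _

theorem IsPolygonalLipschitzDomain.restrict_closure {Ω : Set E}
    (hΩ : IsPolygonalLipschitzDomain Ω) :
    (volume : Measure E).restrict (closure Ω) = volume.restrict Ω :=
  Measure.restrict_congr_set (closure_ae_eq_of_null_frontier hΩ.volume_frontier)

theorem contDiff_gradient {ψ : E → ℝ} (hψ : ContDiff ℝ ∞ ψ) : ContDiff ℝ ∞ (gradient ψ) :=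
  (InnerProductSpace.toDual ℝ E).symm.contDiff.comp (hψ.fderiv_right (m := ∞) (by simp))

theorem gradient_apply (ψ : E → ℝ) (x : E) (i : Fin 2) :
    gradient ψ x i = fderiv ℝ ψ x (EuclideanSpace.single i 1) := by
  have h : inner ℝ (gradient ψ x) (EuclideanSpace.single i 1) =
      fderiv ℝ ψ x (EuclideanSpace.single i 1) := by
    rw [gradient, InnerProductSpace.toDual_symm_apply]
  rw [← h, EuclideanSpace.inner_single_right]
  simp

theorem curlV_gradient {ψ : E → ℝ} (hψ : ContDiff ℝ ∞ ψ) (x : E) : curlV (gradient ψ) x = 0 := by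
  have hd : ∀ (i : Fin 2) (v : E), fderiv ℝ (gradient ψ) x v i =
      fderiv ℝ (fderiv ℝ ψ) x v (EuclideanSpace.single i 1) := by
    intro i v
    have h := (EuclideanSpace.proj i : E →L[ℝ] ℝ).hasFDerivAt.comp x
      ((contDiff_gradient hψ).differentiable (by simp) x).hasFDerivAt
    have e : (EuclideanSpace.proj i : E →L[ℝ] ℝ) ∘ gradient ψ =
        fun y => fderiv ℝ ψ y (EuclideanSpace.single i 1) := by
      ext y; exact gradient_apply ψ y i
    rw [e] at h
    have h2 := ((hψ.fderiv_right (m := ∞) (by simp)).differentiable (by simp) x).hasFDerivAt.clm_apply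
      (hasFDerivAt_const (EuclideanSpace.single i (1 : ℝ) : E) x)
    have h3 := congrArg (fun L : E →L[ℝ] ℝ => L v) (h.unique h2)
    simpa using h3
  have hsym : IsSymmSndFDerivAt ℝ ψ x :=
    hψ.contDiffAt.isSymmSndFDerivAt (by simpa using (WithTop.coe_le_coe.2 (le_top : (2 : ℕ∞) ≤ ⊤)))
  rw [curlV, curlOp_apply, hd, hd, hsym.eq, sub_self]

/-- The vector curl of a test function is an admissible, divergence free field. -/
theorem memH0div_curlS {Ω : Set E} (hΩ : IsPolygonalLipschitzDomain Ω) {φ : E → ℝ}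
    (hφ : IsTest (closure Ω) φ) : MemH0div Ω (curlS φ) fun _ => 0 := by
  refine ⟨memLp_curlS hφ.1 hφ.2.1 _, MemLp.zero', fun ψ hψ hψc => ?_⟩
  -- Since `φ` is smooth on the plane and vanishes off the closure of `Ω`, the integration by parts
  -- takes place in the whole plane and leaves no boundary term; the curl of a gradient is zero.
  have h := integral_inner_curlS (contDiff_gradient hψ) hφ.1 hφ.2.1
  simp only [curlV_gradient hψ, zero_mul, integral_zero] at h
  rw [← hΩ.restrict_closure, setIntegral_eq_integral_of_forall_compl_eq_zero]
  · refine (integral_congr_ae (.of_forall fun x => ?_)).trans h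
    simp only [zero_mul, add_zero]
    exact real_inner_comm _ _
  · intro x hx
    rw [curlS_eq_zero fun h => hx (hφ.2.2 h)]
    simp

theorem MemH1Vec.memLp {U : Set E} {f : E → E} (hf : MemH1Vec U f) :
    MemLp f 2 (volume.restrict U) := by
  have h : ∀ i : Fin 2, MemLp (fun x => f x i) 2 (volume.restrict U) := fun i => by
    obtain ⟨G, hG⟩ := hf i; exact hG.1
  have h' : ∀ i : Fin 2, MemLp (fun x => f x i • (EuclideanSpace.single i 1 : E)) 2
      (volume.restrict U) := fun i =>
    (ContinuousLinearMap.toSpanSingleton ℝ (EuclideanSpace.single i 1 : E)).comp_memLp' (h i)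
  refine (memLp_congr_ae (.of_forall fun x => ?_)).2 (memLp_fun_add (h' 0) (h' 1))
  exact decomp_E (f x)

/-! ### The residual -/

/-- This is `(2 - p)/(2p) + (p - 1)/p = 1/2`: the temperature error in `L^{2p/(2-p)}` times the
velocity in `L^{p'}` is square integrable. -/
theorem holderTriple_exponents {p : ℝ} (hp1 : 1 < p) (hp2 : p < 2) :
    ENNReal.HolderTriple (sobExp p) (conjExp p) 2 := by
  have h1 : 0 < p - 1 := by linarith
  have h2 : 0 < 2 - p := by linarith
  refine ⟨?_⟩
  rw [sobExp, conjExp, ← ENNReal.ofReal_inv_of_pos (by positivity),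
    ← ENNReal.ofReal_inv_of_pos (by positivity), ← ENNReal.ofReal_add (by positivity)
    (by positivity), show (2 : ℝ≥0∞) = ENNReal.ofReal 2 by simp,
    ← ENNReal.ofReal_inv_of_pos (by norm_num)]
  congr 1
  field_simp
  ring

theorem holderConjugate_exponents {p : ℝ} (hp1 : 1 < p) :
    ENNReal.HolderConjugate (ENNReal.ofReal p) (conjExp p) := by
  have h1 : 0 < p - 1 := by linarith
  refine ⟨?_⟩
  rw [conjExp, ← ENNReal.ofReal_inv_of_pos (by positivity),
    ← ENNReal.ofReal_inv_of_pos (by positivity), ← ENNReal.ofReal_add (by positivity)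
    (by positivity), inv_one, ← ENNReal.ofReal_one]
  congr 1
  field_simp
  ring

/-- The difference of the fluxes `ν(T) u` and `ν(T_h) u_h`. -/
theorem eLpNorm_flux_sub_le {μ : Measure E} {p : ℝ} (hp1 : 1 < p) (hp2 : p < 2) {ν : ℝ → ℝ}
    {νmax CL : ℝ} (hν : ∀ s, |ν s| ≤ νmax) (hCL : 0 ≤ CL)
    (hL : ∀ s₁ s₂, |ν s₁ - ν s₂| ≤ CL * |s₁ - s₂|) (hνc : Continuous ν)
    {u uh : E → E} {T Th : E → ℝ} (hu : AEStronglyMeasurable u μ) (huh : AEStronglyMeasurable uh μ)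
    (hT : AEStronglyMeasurable T μ) (hTh : AEStronglyMeasurable Th μ) :
    eLpNorm (fun x => ν (T x) • u x - ν (Th x) • uh x) 2 μ ≤
      ENNReal.ofReal νmax * eLpNorm (u - uh) 2 μ +
        ENNReal.ofReal CL * eLpNorm u (conjExp p) μ * eLpNorm (T - Th) (sobExp p) μ := by
  have := holderTriple_exponents hp1 hp2
  have hνT := hνc.comp_aestronglyMeasurable hT
  have hνTh := hνc.comp_aestronglyMeasurable hTh
  -- The splitting pairs the viscosity difference with the exact velocity, whose `L^{p'}` norm is
  -- controlled by the smallness hypothesis.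
  have e : (fun x => ν (T x) • u x - ν (Th x) • uh x) =
      (fun x => ν (Th x) • (u - uh) x) + (fun x => ν (T x) - ν (Th x)) • u := by
    ext1 x
    simp only [Pi.add_apply, Pi.smul_apply', Pi.sub_apply, smul_sub, sub_smul]
    abel
  rw [e]
  refine (eLpNorm_add_le (hνTh.smul (hu.sub huh)) ((hνT.sub hνTh).smul hu)
    (by norm_num)).trans (add_le_add ?_ ?_)
  · refine eLpNorm_le_nnreal_smul_eLpNorm_of_ae_le_mul (c := νmax.toNNReal)
      (.of_forall fun x => ?_) 2
    rw [Pi.smul_apply', nnnorm_smul]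
    refine mul_le_mul' ?_ le_rfl
    rw [← NNReal.coe_le_coe, Real.coe_toNNReal _ ((abs_nonneg _).trans (hν 0))]
    exact hν _
  · refine (eLpNorm_smul_le_mul_eLpNorm (p := sobExp p) (q := conjExp p) hu
      (hνT.sub hνTh)).trans ?_
    have h1 : eLpNorm (fun x => ν (T x) - ν (Th x)) (sobExp p) μ ≤
        ENNReal.ofReal CL * eLpNorm (T - Th) (sobExp p) μ := by
      refine eLpNorm_le_nnreal_smul_eLpNorm_of_ae_le_mul (c := CL.toNNReal)
        (.of_forall fun x => ?_) _
      rw [← NNReal.coe_le_coe, NNReal.coe_mul, Real.coe_toNNReal _ hCL]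
      exact hL _ _
    calc _ ≤ ENNReal.ofReal CL * eLpNorm (T - Th) (sobExp p) μ * eLpNorm u (conjExp p) μ :=
          mul_le_mul' h1 le_rfl
      _ = _ := by ring

/-- The field `curlS φ` is admissible and divergence free, so the momentum equation replaces `f` by
`ν(T) u` without a pressure term. The support of `φ` localizes the errors to `N`. -/
theorem eLpNorm_residual_le {Ω : Set E} (hΩ : IsPolygonalLipschitzDomain Ω) {p : ℝ}
    (hp1 : 1 < p) (hp2 : p < 2) {ν : ℝ → ℝ}
    {νmax CL : ℝ} (hν : ∀ s, |ν s| ≤ νmax) (hCL : 0 ≤ CL)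
    (hL : ∀ s₁ s₂, |ν s₁ - ν s₂| ≤ CL * |s₁ - s₂|) (hνc : Continuous ν)
    {κ : ℝ → ℝ} {f : E → E} (hf : MemLp f 2 (volume.restrict Ω)) {z : E} {u uh : E → E}
    {P T Th : E → ℝ} (hsol : IsWeakSolution Ω p ν κ f z u P T)
    (huh : MemLp uh 2 (volume.restrict Ω)) (hTh : AEStronglyMeasurable Th (volume.restrict Ω))
    {M : ℝ≥0∞} (hM : ENNReal.ofReal CL * eLpNorm u (conjExp p) (volume.restrict Ω) ≤ M)
    {N : Set E} (hN : N ⊆ closure Ω) {φ : E → ℝ} (hφ : IsTest N φ) :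
    ‖∫ x in Ω, inner ℝ (f x - ν (Th x) • uh x) (curlS φ x)‖ₑ ≤
      (ENNReal.ofReal νmax * eLpNorm (u - uh) 2 (volume.restrict N) +
        M * eLpNorm (T - Th) (sobExp p) (volume.restrict N)) * eLpNorm (curlS φ) 2 volume := by
  obtain ⟨du, GT, hu, -, hT, heq, -, -⟩ := hsol
  have hφΩ : IsTest (closure Ω) φ := ⟨hφ.1, hφ.2.1, hφ.2.2.trans hN⟩
  have h0 := heq _ _ (memH0div_curlS hΩ hφΩ)
  simp only [mul_zero, sub_zero] at h0
  have hcs := memLp_curlS hφ.1 hφ.2.1 (volume.restrict Ω)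
  have hbdd : ∀ {S : E → ℝ} {v : E → E}, AEStronglyMeasurable S (volume.restrict Ω) →
      MemLp v 2 (volume.restrict Ω) → MemLp (fun x => ν (S x) • v x) 2 (volume.restrict Ω) := by
    intro S v hS hv
    refine hv.of_le_mul (c := νmax) ((hνc.comp_aestronglyMeasurable hS).smul hv.1)
      (.of_forall fun x => ?_)
    rw [norm_smul]
    exact mul_le_mul_of_nonneg_right (hν _) (norm_nonneg _)
  have hνu := hbdd hT.1.1.1 hu.1
  have hνuh := hbdd hTh huh
  have hle : (volume : Measure E).restrict N ≤ volume.restrict Ω := by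
    rw [← hΩ.restrict_closure]; exact Measure.restrict_mono_set _ hN
  have e : ∫ x in Ω, inner ℝ (f x - ν (Th x) • uh x) (curlS φ x) =
      ∫ x in N, inner ℝ (ν (T x) • u x - ν (Th x) • uh x) (curlS φ x) := by
    have hz : ∀ x ∉ N, curlS φ x = 0 := fun x hx => curlS_eq_zero fun h => hx (hφ.2.2 h)
    have e1 : ∫ x in N, inner ℝ (ν (T x) • u x - ν (Th x) • uh x) (curlS φ x) =
        ∫ x in Ω, inner ℝ (ν (T x) • u x - ν (Th x) • uh x) (curlS φ x) := by
      rw [← hΩ.restrict_closure, setIntegral_eq_integral_of_forall_compl_eq_zero,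
        setIntegral_eq_integral_of_forall_compl_eq_zero]
      · intro x hx; rw [hz x fun h => hx (hN h), inner_zero_right]
      · intro x hx; rw [hz x hx, inner_zero_right]
    rw [e1]
    simp only [inner_sub_left]
    rw [integral_sub (integrable_inner_of_memLp hf hcs) (integrable_inner_of_memLp hνuh hcs),
      integral_sub (integrable_inner_of_memLp hνu hcs) (integrable_inner_of_memLp hνuh hcs), ← h0]
    simp only [inner_smul_left, conj_trivial]
  rw [e]
  refine (enorm_integral_inner_le (p := 2) (q := 2) ((hνu.sub hνuh).1.mono_measure hle)
    (continuous_curlS hφ.1).aestronglyMeasurable).trans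
    (mul_le_mul' ?_ (eLpNorm_mono_measure _ Measure.restrict_le_self))
  refine (eLpNorm_flux_sub_le hp1 hp2 hν hCL hL hνc (hu.1.1.mono_measure hle)
    (huh.1.mono_measure hle) (hT.1.1.1.mono_measure hle) (hTh.mono_measure hle)).trans ?_
  gcongr
  exact (mul_le_mul' le_rfl (eLpNorm_mono_measure _ hle)).trans hM

/-! ### Bounds for the constants of the smallness hypotheses -/

theorem exists_isTest {Ω : Set E} (hΩ : IsOpen Ω) {z : E} (hz : z ∈ Ω) :
    ∃ S, IsTest Ω S ∧ S z = 1 := by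
  obtain ⟨r, hr, hball⟩ := Metric.isOpen_iff.1 hΩ z hz
  let b : ContDiffBump z := ⟨r / 4, r / 2, by positivity, by linarith⟩
  refine ⟨b, ⟨b.contDiff, b.hasCompactSupport, ?_⟩, b.one_of_mem_closedBall ?_⟩
  · rw [b.tsupport_eq]
    exact (Metric.closedBall_subset_ball (show r / 2 < r by linarith)).trans hball
  · exact Metric.mem_closedBall_self (by positivity)

theorem IsTest.memW0 {Ω : Set E} {S : E → ℝ} (hS : IsTest Ω S) (q : ℝ≥0∞) :
    MemW0 Ω q S (gradient S) := by
  have hgc : HasCompactSupport (gradient S) :=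
    (hS.2.1.fderiv ℝ).comp_left (map_zero (InnerProductSpace.toDual ℝ E).symm)
  have hg := (contDiff_gradient hS.1).continuous
  have hin : ∀ x v, inner ℝ (gradient S x) v = fderiv ℝ S x v := fun x v => by
    rw [gradient, InnerProductSpace.toDual_symm_apply]
  refine ⟨⟨hS.1.continuous.memLp_of_hasCompactSupport hS.2.1, hg.memLp_of_hasCompactSupport hgc,
    hS.1.continuous.locallyIntegrable.locallyIntegrableOn _,
    hg.locallyIntegrable.locallyIntegrableOn _, fun φ hφ v => ?_⟩, fun _ => S, fun _ => hS, ?_, ?_⟩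
  · rw [setIntegral_eq_integral_of_forall_compl_eq_zero,
      setIntegral_eq_integral_of_forall_compl_eq_zero]
    · simp_rw [hin]
      have hd : ∀ {ψ : E → ℝ}, IsTest Ω ψ → Continuous fun x => fderiv ℝ ψ x v := fun hψ =>
        (hψ.1.continuous_fderiv (by simp)).clm_apply continuous_const
      refine integral_mul_fderiv_eq_neg_fderiv_mul_of_integrable ?_ ?_ ?_ ?_ ?_
      · exact ((hd hS).mul hφ.1.continuous).integrable_of_hasCompactSupport hφ.2.1.mul_left
      · exact (hS.1.continuous.mul (hd hφ)).integrable_of_hasCompactSupport hS.2.1.mul_right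
      · exact (hS.1.continuous.mul hφ.1.continuous).integrable_of_hasCompactSupport
          hS.2.1.mul_right
      · exact fun x _ => hS.1.differentiable (by simp) x
      · exact fun x _ => hφ.1.differentiable (by simp) x
    · intro x hx
      rw [image_eq_zero_of_notMem_tsupport fun h => hx (hφ.2.2 h), mul_zero]
    · intro x hx
      rw [image_eq_zero_of_notMem_tsupport fun h => hx (hS.2.2 h), zero_mul]
  · simp
  · simp

/-- A function with zero gradient is constant, and with compact support in the plane the constant is
zero. -/
theorem eLpNorm_gradient_ne_zero {Ω : Set E} {S : E → ℝ} (hS : IsTest Ω S)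
    {z : E} (hz : S z ≠ 0) {q : ℝ≥0∞} (hq : q ≠ 0) :
    eLpNorm (gradient S) q (volume.restrict Ω) ≠ 0 := by
  intro h
  have hcont := (contDiff_gradient hS.1).continuous
  rw [eLpNorm_eq_zero_iff hcont.aestronglyMeasurable hq] at h
  have hout : ∀ x ∉ tsupport S, gradient S x = 0 := fun x hx => by
    have : fderiv ℝ S x = 0 := by
      by_contra h
      exact hx (support_fderiv_subset ℝ h)
    rw [gradient, this, map_zero]
  have h1 : gradient S =ᵐ[volume] 0 := by
    have := ae_imp_of_ae_restrict h
    filter_upwards [this] with x hx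
    by_cases hxΩ : x ∈ Ω
    · exact hx hxΩ
    · exact hout x fun hh => hxΩ (hS.2.2 hh)
  have h2 := (Continuous.ae_eq_iff_eq volume hcont continuous_zero).1 h1
  have h3 : ∀ x, fderiv ℝ S x = 0 := fun x => by
    have := congrFun h2 x
    rw [gradient] at this
    simpa using! this
  obtain ⟨y, hy⟩ : ∃ y, y ∉ tsupport S := by
    by_contra! hh
    have : IsCompact (Set.univ : Set E) := by
      rw [← Set.eq_univ_of_forall hh]; exact hS.2.1
    exact noncompact_univ E this
  have h4 := is_const_of_fderiv_eq_zero (hS.1.differentiable (by simp)) h3 z y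
  rw [image_eq_zero_of_notMem_tsupport hy] at h4
  exact hz h4

theorem sobolevConst_ne_zero {Ω : Set E} (hΩ : IsOpen Ω) {z : E} (hz : z ∈ Ω) {p : ℝ}
    (hp1 : 1 < p) (hp2 : p < 2) : sobolevConst Ω p ≠ 0 := by
  obtain ⟨S, hS, hSz⟩ := exists_isTest hΩ hz
  have hW := hS.memW0 (ENNReal.ofReal p)
  have h2 : 0 < 2 - p := by linarith
  have hpos : eLpNorm S (sobExp p) (volume.restrict Ω) ≠ 0 := by
    intro h
    rw [eLpNorm_eq_zero_iff hS.1.continuous.aestronglyMeasurable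
      (by simpa [sobExp] using (by positivity : 0 < 2 * p / (2 - p)))] at h
    have h' := Measure.eqOn_open_of_ae_eq h hΩ hS.1.continuous.continuousOn
      continuous_zero.continuousOn hz
    rw [hSz] at h'
    exact one_ne_zero h'
  have hle : eLpNorm S (sobExp p) (volume.restrict Ω) /
      eLpNorm (gradient S) (ENNReal.ofReal p) (volume.restrict Ω) ≤ sobolevConst Ω p :=
    le_sInf fun C hC => ENNReal.div_le_of_le_mul (hC S _ hW)
  exact (lt_of_lt_of_le (ENNReal.div_pos hpos hW.1.2.1.2.ne) hle).ne'

/-- By Hölder the supremum is at most `κ ‖∇R‖`, so one `R` with nonzero gradient forces every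
admissible constant to be at least `1/κ`. -/
theorem infSupConst_ne_zero {Ω : Set E} (hΩ : IsOpen Ω) {z : E} (hz : z ∈ Ω) {p κ : ℝ}
    (hp1 : 1 < p) (hκ : 0 < κ) : infSupConst Ω p κ ≠ 0 := by
  obtain ⟨S, hS, hSz⟩ := exists_isTest hΩ hz
  have hW := hS.memW0 (ENNReal.ofReal p)
  have := holderConjugate_exponents hp1
  set g := eLpNorm (gradient S) (ENNReal.ofReal p) (volume.restrict Ω) with hg
  have hg0 : g ≠ 0 := eLpNorm_gradient_ne_zero hS (z := z) (by rw [hSz]; exact one_ne_zero)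
    (by simpa using (by linarith : 0 < p))
  have hgt : g ≠ ⊤ := hW.1.2.1.2.ne
  have hle : (ENNReal.ofReal κ)⁻¹ ≤ infSupConst Ω p κ := by
    refine le_sInf fun C hC => ?_
    have h1 := hC S _ hW
    have h2 : g ≤ C * (ENNReal.ofReal κ * g) := by
      refine h1.trans (mul_le_mul' le_rfl (iSup_le fun R => iSup_le fun GR => iSup_le fun hR => ?_))
      refine ENNReal.div_le_of_le_mul ?_
      rw [integral_const_mul, ENNReal.ofReal_mul hκ.le, mul_assoc]
      refine mul_le_mul' le_rfl (ENNReal.ofReal_le_ofReal (le_abs_self _) |>.trans ?_)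
      rw [← Real.enorm_eq_ofReal_abs]
      exact enorm_integral_inner_le hW.1.2.1.1 hR.1.2.1.1
    have h3 : 1 ≤ C * ENNReal.ofReal κ := by
      rw [← mul_assoc] at h2
      nth_rewrite 1 [← one_mul g] at h2
      exact (ENNReal.mul_le_mul_iff_left hg0 hgt).1 h2
    rw [← one_div]
    exact ENNReal.div_le_of_le_mul h3
  exact (lt_of_lt_of_le (ENNReal.inv_pos.2 ENNReal.ofReal_ne_top) hle).ne'

/-- In `ℝ≥0∞` the inverse is infinite only at zero, so positivity of `C_e` and `C_κ` suffices;
should one of them be infinite, `𝔠` is zero. -/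
theorem smallConst_ne_top {Ω : Set E} (hΩ : IsOpen Ω) {z : E} (hz : z ∈ Ω) {p κ : ℝ}
    (hp1 : 1 < p) (hp2 : p < 2) (hκ : 0 < κ) : smallConst Ω p κ ≠ ⊤ := by
  rw [smallConst, ENNReal.inv_ne_top]
  exact mul_ne_zero (mul_ne_zero two_ne_zero (sobolevConst_ne_zero hΩ hz hp1 hp2))
    (infSupConst_ne_zero hΩ hz hp1 hκ)

theorem diracNorm_ne_zero {Ω : Set E} (hΩ : IsOpen Ω) {z : E} (hz : z ∈ Ω) (p : ℝ) :
    diracNorm Ω p z ≠ 0 := by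
  obtain ⟨S, hS, hSz⟩ := exists_isTest hΩ hz
  have hW := hS.memW0 (conjExp p)
  have h : ‖S z‖ₑ / eLpNorm (gradient S) (conjExp p) (volume.restrict Ω) ≤ diracNorm Ω p z :=
    le_iSup_of_le S (le_iSup_of_le (gradient S)
      (le_iSup_of_le ⟨hW, hS.1.continuous.continuousOn⟩ le_rfl))
  refine (lt_of_lt_of_le (ENNReal.div_pos ?_ hW.1.2.1.2.ne) h).ne'
  simp [hSz]

/-- The smallness hypothesis bounds the velocity. -/
theorem exists_velocity_bound {Ω : Set E} (hΩ : IsOpen Ω) {z : E} (hz : z ∈ Ω) {p κ : ℝ}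
    (hp1 : 1 < p) (hp2 : p < 2) (hκ : 0 < κ) {νmin CL : ℝ} (hνmin : 0 < νmin) :
    ∃ M : ℝ≥0, ∀ (u : E → E) (ρ ϱ : ℝ), 0 < ρ → ρ < 1 → 0 < ϱ → ϱ < 1 →
      ENNReal.ofReal CL * diracNorm Ω p z * eLpNorm u (conjExp p) (volume.restrict Ω) ≤
          ENNReal.ofReal (ϱ * (1 - ρ) * νmin) * smallConst Ω p κ ^ 2 →
      ENNReal.ofReal CL * eLpNorm u (conjExp p) (volume.restrict Ω) ≤ M := by
  have hR : ENNReal.ofReal νmin * smallConst Ω p κ ^ 2 ≠ ⊤ :=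
    ENNReal.mul_ne_top ENNReal.ofReal_ne_top
      (ENNReal.pow_ne_top (smallConst_ne_top hΩ hz hp1 hp2 hκ))
  have hD := diracNorm_ne_zero hΩ hz p
  -- The bound is `ν₋ 𝔠² / ‖δ_z‖`; the factor `ϱ (1 - ρ)` is at most `1`, so neither parameter
  -- enters.
  refine ⟨(ENNReal.ofReal νmin * smallConst Ω p κ ^ 2 / diracNorm Ω p z).toNNReal,
    fun u ρ ϱ h1 h2 h3 h4 h => ?_⟩
  rw [ENNReal.coe_toNNReal (ENNReal.div_ne_top hR hD), ENNReal.le_div_iff_mul_le (.inl hD) (.inr hR)]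
  calc _ = ENNReal.ofReal CL * diracNorm Ω p z * eLpNorm u (conjExp p) (volume.restrict Ω) := by
        ring
    _ ≤ _ := h
    _ ≤ _ := by
      gcongr
      have : ϱ * (1 - ρ) ≤ 1 := mul_le_one₀ h4.le (by linarith) (by linarith)
      exact mul_le_of_le_one_left hνmin.le this

/-! ### Polynomials in scaled coordinates -/

theorem exists_polyFun_comp_toRef (p : MvPolynomial (Fin 2) ℝ) (m : E) {s : ℝ} (hs : 0 < s) {τ : E}
    (hτ : ‖τ‖ = 1) : ∃ p' : MvPolynomial (Fin 2) ℝ, p'.totalDegree ≤ p.totalDegree ∧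
      ∀ x, polyFun p' (toRef m hs hτ x) = polyFun p x := by
  let g : Fin 2 → MvPolynomial (Fin 2) ℝ := fun i => MvPolynomial.C (m i) +
    (MvPolynomial.C (s * τ i) * MvPolynomial.X 0 + MvPolynomial.C (s * rot τ i) * MvPolynomial.X 1)
  have hX : ∀ (c : ℝ) (i : Fin 2), (MvPolynomial.C c * MvPolynomial.X i :
      MvPolynomial (Fin 2) ℝ).totalDegree ≤ 1 := fun c i =>
    (MvPolynomial.totalDegree_mul _ _).trans (by simp)
  have hg : ∀ i, (g i).totalDegree ≤ 1 := fun i =>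
    (MvPolynomial.totalDegree_add _ _).trans (max_le (by simp)
      ((MvPolynomial.totalDegree_add _ _).trans (max_le (hX _ _) (hX _ _))))
  refine ⟨MvPolynomial.bind₁ g p, totalDegree_bind₁_le hg, fun x => ?_⟩
  have hx : ∀ i, MvPolynomial.eval (fun j => (toRef m hs hτ x) j) (g i) = x i := by
    intro i
    have h1 : x = m + s • frame τ hτ (toRef m hs hτ x) := by
      rw [toRef_apply, map_smul, smul_smul, mul_inv_cancel₀ hs.ne', one_smul,
        LinearIsometryEquiv.apply_symm_apply, add_sub_cancel]
    conv_rhs => rw [h1, frame_apply]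
    simp [g]
    ring
  rw [polyFun, polyFun, MvPolynomial.eval, MvPolynomial.eval₂Hom_bind₁]
  have : (fun i => (MvPolynomial.eval₂Hom (RingHom.id ℝ) fun j => (toRef m hs hτ x) j) (g i)) =
      fun i => x i := funext hx
  rw [this]
  rfl

theorem exists_polynomial_on_line (p : MvPolynomial (Fin 2) ℝ) (m τ : E) {s : ℝ} (hs : 0 < s) :
    ∃ w : Polynomial ℝ, w.natDegree ≤ p.totalDegree ∧
      ∀ t : ℝ, w.eval (s⁻¹ * t) = polyFun p (m + t • τ) := by
  let g : Fin 2 → Polynomial ℝ := fun i =>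
    Polynomial.C (m i) + Polynomial.C (s * τ i) * Polynomial.X
  refine ⟨MvPolynomial.aeval g p, ?_, fun t => ?_⟩
  · have := MvPolynomial.aeval_natDegree_le p le_rfl g (n := 1) fun i => by
      refine (Polynomial.natDegree_add_le _ _).trans (max_le (by simp) ?_)
      exact (Polynomial.natDegree_C_mul_le _ _).trans Polynomial.natDegree_X_le
    simpa using this
  · have hx : ∀ i, (g i).eval (s⁻¹ * t) = (m + t • τ) i := by
      intro i
      simp [g]
      field_simp
    rw [polyFun, MvPolynomial.aeval_def, Polynomial.eval, Polynomial.algebraMap_eq]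
    change (Polynomial.evalRingHom (s⁻¹ * t)) (MvPolynomial.eval₂ Polynomial.C g p) = _
    rw [MvPolynomial.hom_eval₂]
    have h1 : (Polynomial.evalRingHom (s⁻¹ * t)).comp Polynomial.C = RingHom.id ℝ := by
      ext; simp
    have h2 : (fun i => (Polynomial.evalRingHom (s⁻¹ * t)) (g i)) = fun i => (m + t • τ) i :=
      funext hx
    rw [h1]
    change MvPolynomial.eval₂ (RingHom.id ℝ)
      (fun i => (Polynomial.evalRingHom (s⁻¹ * t)) (g i)) p = _
    rw [h2]
    rfl

/-- The vector field with the polynomial components `p 0` and `p 1`. -/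
def polyField (p : Fin 2 → MvPolynomial (Fin 2) ℝ) (x : E) : E :=
  !₂[polyFun (p 0) x, polyFun (p 1) x]

theorem contDiff_polyField (p : Fin 2 → MvPolynomial (Fin 2) ℝ) : ContDiff ℝ ∞ (polyField p) := by
  rw [contDiff_euclidean]
  intro i
  fin_cases i
  · exact contDiff_polyFun (p 0)
  · exact contDiff_polyFun (p 1)

theorem curlV_polyField (p : Fin 2 → MvPolynomial (Fin 2) ℝ) (x : E) : curlV (polyField p) x =
    polyFun (MvPolynomial.pderiv 0 (p 1) - MvPolynomial.pderiv 1 (p 0)) x := by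
  have hd : ∀ (i : Fin 2) (v : E), fderiv ℝ (polyField p) x v i = fderiv ℝ (polyFun (p i)) x v := by
    intro i v
    have h := (EuclideanSpace.proj i : E →L[ℝ] ℝ).hasFDerivAt.comp x
      ((contDiff_polyField p).differentiable (by simp) x).hasFDerivAt
    have e : (EuclideanSpace.proj i : E →L[ℝ] ℝ) ∘ polyField p = polyFun (p i) := by
      ext y; fin_cases i <;> rfl
    rw [e] at h
    rw [h.fderiv]; simp
  rw [curlV, curlOp_apply, hd, hd, fderiv_polyFun, fderiv_polyFun]
  simp [polyFun]

/-- Testing with the bubble yields the square of the weighted norm `b` on the left and one factor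
`b` on the right; this cancels it, also when `b = 0`. -/
theorem le_of_mul_sq_le {a b x : ℝ≥0∞} (hb : b ≠ ⊤) (h : a * b ^ 2 ≤ x * b) : a * b ≤ x := by
  rcases eq_or_ne b 0 with rfl | hb0
  · simp
  rw [sq, ← mul_assoc] at h
  exact (ENNReal.mul_le_mul_iff_left hb0 hb).1 h

/-! ### The element residual -/

/-- Here `c` is the curl of the oscillation `w`, and only the curl of the polynomial part is
unknown. The test function is the bubble of that curl on the inscribed disc; the residual
contributes `A` and the oscillation contributes `c`. -/
theorem exists_element_bound (N : ℕ) (R : ℝ) (hR : 0 ≤ R) : ∃ C : ℝ≥0, ∀ (Ω : Set E),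
    IsPolygonalLipschitzDomain Ω → ∀ (r w : E → E) (A : ℝ≥0∞) (K : Finset E) (c : E → ℝ)
    (p : Fin 2 → MvPolynomial (Fin 2) ℝ) (x₀ : E) (s : ℝ), 0 < s →
    Metric.ball x₀ s ⊆ hull K → hull K ⊆ closure Ω → s ≤ hK K → hK K ≤ R * s →
    (∀ i, (p i).totalDegree ≤ N) → r =ᵐ[volume.restrict (hull K)] w + polyField p →
    MemLp w 2 (volume.restrict (hull K)) → HasWeakCurl (interior (hull K)) w c →
    MemLp c 2 (volume.restrict (hull K)) →
    (∀ φ, IsTest (hull K) φ →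
      ‖∫ x in Ω, inner ℝ (r x) (curlS φ x)‖ₑ ≤ A * eLpNorm (curlS φ) 2 volume) →
    ENNReal.ofReal (hK K) * eLpNorm (c + curlV (polyField p)) 2 (volume.restrict (hull K)) ≤
      C * (A + ENNReal.ofReal (hK K) * eLpNorm c 2 (volume.restrict (hull K))) := by
  obtain ⟨C, hC⟩ := exists_bubble_bound N R
  refine ⟨1 + 2 * R.toNNReal * C ^ 2, ?_⟩
  intro Ω hΩ r w A K c p x₀ s hs hball hKΩ hsK hKs hp hr hw hc hc2 hres
  have hτ : ‖(EuclideanSpace.single 0 1 : E)‖ = 1 := by simp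
  obtain ⟨q, hqdeg, hq⟩ := exists_polyFun_comp_toRef
    (MvPolynomial.pderiv 0 (p 1) - MvPolynomial.pderiv 1 (p 0)) x₀ hs hτ
  set Φ := toRef x₀ hs hτ with hΦ
  have hcurl : ∀ x, curlV (polyField p) x = polyFun q (Φ x) := fun x => by
    rw [curlV_polyField, hq]
  have hqN : q.totalDegree ≤ N := hqdeg.trans ((MvPolynomial.totalDegree_sub _ _).trans
    (max_le ((totalDegree_pderiv_le _ _).trans (hp 1)) ((totalDegree_pderiv_le _ _).trans (hp 0))))
  obtain ⟨b1, b2, b3⟩ := hC q hqN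
  set B := eLpNorm (fun x => bump x * polyFun q x) 2 volume with hB
  have hBt : B ≠ ⊤ := (memLp_bump_mul (contDiff_polyFun q)).2.ne
  set φ : E → ℝ := fun x => bubble (polyFun q) (Φ x) with hφdef
  have hφ : IsTest (Metric.ball x₀ s) φ := isTest_comp_toRef x₀ hs hτ (isTest_bubble (contDiff_polyFun q))
  have hφK : IsTest (hull K) φ := ⟨hφ.1, hφ.2.1, hφ.2.2.trans hball⟩
  have hφi : IsTest (interior (hull K)) φ :=
    ⟨hφ.1, hφ.2.1, hφ.2.2.trans (interior_maximal hball Metric.isOpen_ball)⟩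
  have hφ2 : MemLp φ 2 (volume.restrict (hull K)) :=
    hφ.1.continuous.memLp_of_hasCompactSupport hφ.2.1
  have hz : ∀ x ∉ hull K, x ∉ tsupport φ := fun x hx h => hx (hφK.2.2 h)
  have hP := contDiff_polyField p
  have hrc := hc.add_smooth hc2 hw hP hr
  have hcP := memLp_hull K (continuous_curlV hP) 2
  -- the weighted norm of the curl
  have e1 : ∫ x in hull K, curlV (polyField p) x * φ x =
      (∫ x in Ω, inner ℝ (r x) (curlS φ x)) - ∫ x in hull K, c x * φ x := by
    have h1 := hrc.2.2 φ hφi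
    rw [restrict_interior_hull] at h1
    have h2 : ∫ x in Ω, inner ℝ (r x) (curlS φ x) = ∫ x in hull K, inner ℝ (r x) (curlS φ x) := by
      rw [← hΩ.restrict_closure, setIntegral_eq_integral_of_forall_compl_eq_zero,
        setIntegral_eq_integral_of_forall_compl_eq_zero]
      · intro x hx; rw [curlS_eq_zero (hz x hx), inner_zero_right]
      · intro x hx; rw [curlS_eq_zero (hz x fun h => hx (hKΩ h)), inner_zero_right]
    have h3 : ∫ x in hull K, (c + curlV (polyField p)) x * φ x =
        (∫ x in hull K, c x * φ x) + ∫ x in hull K, curlV (polyField p) x * φ x := by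
      simp only [Pi.add_apply, add_mul]
      exact integral_add (integrable_mul_of_memLp hc2 hφ2) (integrable_mul_of_memLp hcP hφ2)
    rw [h2, h1, h3]
    ring
  -- The square of the cut-off in `bubble` makes the pairing an exact square.
  have e2 : ‖∫ x in hull K, curlV (polyField p) x * φ x‖ₑ = (ENNReal.ofReal s * B) ^ 2 := by
    have hG : MemLp (fun x => bump (Φ x) * polyFun q (Φ x)) 2 volume := by
      refine ⟨?_, ?_⟩
      · exact ((bump.continuous.mul (contDiff_polyFun q).continuous).comp
          Φ.continuous).aestronglyMeasurable
      · have := eLpNorm_comp_toRef x₀ hs hτ fun x => bump x * polyFun q x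
        rw [← hB] at this
        rw [this]
        exact ENNReal.mul_lt_top ENNReal.ofReal_lt_top hBt.lt_top
    rw [← eLpNorm_comp_toRef x₀ hs hτ fun x => bump x * polyFun q x, ← enorm_integral_sq_eq hG,
      setIntegral_eq_integral_of_forall_compl_eq_zero]
    · congr 1
      refine integral_congr_ae (.of_forall fun x => ?_)
      simp only [hcurl, hφdef, bubble]
      ring
    · intro x hx
      rw [image_eq_zero_of_notMem_tsupport (hz x hx), mul_zero]
  have e3 : eLpNorm (curlS φ) 2 volume ≤ 2 * (C * B) :=
    (eLpNorm_curlS_comp_toRef_le x₀ hs hτ (contDiff_bubble (contDiff_polyFun q))).trans (by gcongr)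
  have e4 : eLpNorm φ 2 (volume.restrict (hull K)) ≤ ENNReal.ofReal s * (C * B) := by
    refine (eLpNorm_mono_measure _ Measure.restrict_le_self).trans ?_
    rw [hφdef, eLpNorm_comp_toRef x₀ hs hτ (bubble (polyFun q))]
    gcongr
  set S := ENNReal.ofReal s with hS
  set nc := eLpNorm c 2 (volume.restrict (hull K)) with hnc
  -- The curl of the bubble is bounded by `B` without a power of `s` and the bubble itself by `s *
  -- B`; one factor `B` then cancels.
  have e5 : S ^ 2 * B ≤ 2 * C * (A + S * nc) := by
    refine le_of_mul_sq_le hBt ?_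
    calc S ^ 2 * B ^ 2 = ‖∫ x in hull K, curlV (polyField p) x * φ x‖ₑ := by rw [e2]; ring
      _ ≤ ‖∫ x in Ω, inner ℝ (r x) (curlS φ x)‖ₑ + ‖∫ x in hull K, c x * φ x‖ₑ := by
        rw [e1]; exact enorm_sub_le
      _ ≤ A * (2 * (C * B)) + nc * (S * (C * B)) := by
        refine add_le_add ((hres φ hφK).trans (mul_le_mul' le_rfl e3)) ?_
        exact (enorm_integral_mul_le hc2.1 hφ2.1).trans (mul_le_mul' le_rfl e4)
      _ ≤ A * (2 * (C * B)) + 2 * (nc * (S * (C * B))) := by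
        refine add_le_add le_rfl ?_
        rw [two_mul]
        exact le_self_add
      _ = _ := by ring
  -- Since `hK K ≤ R * s`, the similarity takes the whole triangle into the disc of radius `R`,
  -- where the weighted norm controls the polynomial.
  have e6 : eLpNorm (curlV (polyField p)) 2 (volume.restrict (hull K)) ≤ S * (C * B) := by
    have h1 : eLpNorm (curlV (polyField p)) 2 (volume.restrict (hull K)) ≤
        eLpNorm (fun x => (Metric.closedBall (0 : E) R).indicator (polyFun q) (Φ x)) 2 volume := by
      refine le_trans (le_of_eq (eLpNorm_congr_ae ?_))
        (eLpNorm_mono_measure _ Measure.restrict_le_self)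
      refine ae_restrict_of_forall_mem (measurableSet_hull K) fun x hx => ?_
      rw [hcurl]
      beta_reduce
      rw [Set.indicator_of_mem]
      rw [mem_closedBall_zero_iff, norm_toRef, inv_mul_le_iff₀ hs, mul_comm]
      refine le_trans ?_ hKs
      rw [← dist_eq_norm]
      exact Metric.dist_le_diam_of_mem (isCompact_hull K).isBounded hx
        (hball (Metric.mem_ball_self hs))
    refine h1.trans ?_
    rw [eLpNorm_comp_toRef x₀ hs hτ, eLpNorm_indicator_eq_eLpNorm_restrict
      Metric.isClosed_closedBall.measurableSet]
    gcongr
  set H := ENNReal.ofReal (hK K) with hH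
  have hHS : H ≤ R.toNNReal * S := by
    rw [hH, hS]
    change _ ≤ ENNReal.ofReal R * ENNReal.ofReal s
    rw [← ENNReal.ofReal_mul hR]
    exact ENNReal.ofReal_le_ofReal hKs
  have hSH : S ≤ H := ENNReal.ofReal_le_ofReal hsK
  calc H * eLpNorm (c + curlV (polyField p)) 2 (volume.restrict (hull K))
      ≤ H * (nc + S * (C * B)) := by
        gcongr
        exact (eLpNorm_add_le hc2.1 hcP.1 (by norm_num)).trans (add_le_add le_rfl e6)
    _ = H * nc + H * (S * (C * B)) := by ring
    _ ≤ H * nc + (R.toNNReal * S) * (S * (C * B)) := by gcongr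
    _ = H * nc + R.toNNReal * C * (S ^ 2 * B) := by ring
    _ ≤ H * nc + R.toNNReal * C * (2 * C * (A + S * nc)) := by gcongr
    _ ≤ (A + H * nc) + R.toNNReal * C * (2 * C * (A + H * nc)) := by
        gcongr
        exact le_add_self
    _ = _ := by push_cast; ring

/-! ### The jump residual -/

/-- The test function is the bubble of the polynomial part `p` of the jump on the disc about the
midpoint. Green's formula in the two half discs turns the residual into the jump on the side plus
the curls in the triangles; `p` is isolated and everything else is estimated. -/
theorem exists_side_bound (N : ℕ) (R : ℝ) : ∃ C : ℝ≥0, ∀ (Ω : Set E),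
    IsPolygonalLipschitzDomain Ω → ∀ (r : E → E) (A : ℝ≥0∞) (K₁ K₂ γ : Finset E) (a b : E) (s : ℝ)
    (g₁ g₂ : E → E) (c₁ c₂ j : E → ℝ) (p : MvPolynomial (Fin 2) ℝ),
    MemLp r 2 (volume.restrict Ω) → 0 < s → a ≠ b → hull γ = segment ℝ a b → 2 * s ≤ ‖b - a‖ →
    ‖b - a‖ ≤ R * s →
    (∀ x ∈ Metric.ball (midpoint ℝ a b) s,
      x ∈ hull K₁ ↔ x ∈ halfPlane (midpoint ℝ a b) (tangent a b)) →
    (∀ x ∈ Metric.ball (midpoint ℝ a b) s,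
      x ∈ hull K₂ ↔ x ∈ halfPlane (midpoint ℝ a b) (tangent b a)) →
    hull K₁ ⊆ closure Ω → hull K₂ ⊆ closure Ω → hull K₁ ∩ hull K₂ = segment ℝ a b →
    IsTrace K₁ γ r g₁ → IsTrace K₂ γ r g₂ →
    HasWeakCurl (interior (hull K₁)) r c₁ → HasWeakCurl (interior (hull K₂)) r c₂ →
    MemLp c₁ 2 (volume.restrict (hull K₁)) → MemLp c₂ 2 (volume.restrict (hull K₂)) →
    MemLp j 2 (sideMeasure γ) → p.totalDegree ≤ N →
    (∀ x, inner ℝ (tangent a b) (g₁ x) - inner ℝ (tangent a b) (g₂ x) = j x + polyFun p x) →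
    (∀ φ, IsTest (hull K₁ ∪ hull K₂) φ →
      ‖∫ x in Ω, inner ℝ (r x) (curlS φ x)‖ₑ ≤ A * eLpNorm (curlS φ) 2 volume) →
    ENNReal.ofReal s ^ (1 / 2 : ℝ) * eLpNorm (polyFun p) 2 (sideMeasure γ) ≤
      C * (A + ENNReal.ofReal s * (eLpNorm c₁ 2 (volume.restrict (hull K₁)) +
        eLpNorm c₂ 2 (volume.restrict (hull K₂))) +
        ENNReal.ofReal s ^ (1 / 2 : ℝ) * eLpNorm j 2 (sideMeasure γ)) := by
  obtain ⟨C, hC⟩ := exists_side_bubble_bound N R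
  refine ⟨C * (2 * C + 1), ?_⟩
  intro Ω hΩ r A K₁ K₂ γ a b s g₁ g₂ c₁ c₂ j p hr hs hab hγ hsab habs hK₁ hK₂ hK₁Ω hK₂Ω hinter ht₁
    ht₂ hc₁ hc₂ hc₁2 hc₂2 hj hp hjump hres
  set m := midpoint ℝ a b with hm
  set τ := tangent a b with hτdef
  have hτ : ‖τ‖ = 1 := norm_tangent hab
  obtain ⟨w, hwdeg, hw⟩ := exists_polynomial_on_line p m τ hs
  obtain ⟨b1, b2, b3⟩ := hC w (hwdeg.trans hp)
  set B := eLpNorm (fun t => bump (axisPt t) * w.eval t) 2 volume with hB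
  have hwy : ContDiff ℝ ∞ (fun y : E => w.eval (y 0)) :=
    (w.contDiff_aeval (R := ℝ) (𝕜 := ℝ) ∞).comp (by fun_prop : ContDiff ℝ ∞ fun y : E => y 0)
  have hBm : MemLp (fun t => bump (axisPt t) * w.eval t) 2 volume := by
    have h := memLp_axis (contDiff_bump.mul hwy).continuous bump.hasCompactSupport.mul_right
    simpa [axisPt] using! h
  have hBt : B ≠ ⊤ := hBm.2.ne
  set Φ := toRef m hs hτ with hΦ
  set φ : E → ℝ := fun x => bubble (fun y => w.eval (y 0)) (Φ x) with hφdef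
  have hφ : IsTest (Metric.ball m s) φ := isTest_comp_toRef m hs hτ (isTest_bubble hwy)
  have hφline : ∀ t : ℝ, φ (m + t • τ) = bump (axisPt (s⁻¹ * t)) ^ 2 * w.eval (s⁻¹ * t) := by
    intro t
    simp only [hφdef, bubble, hΦ, toRef_line]
    simp [axisPt]
  have hz : ∀ x ∉ Metric.ball m s, x ∉ tsupport φ := fun x hx h => hx (hφ.2.2 h)
  have hballU : Metric.ball m s ⊆ hull K₁ ∪ hull K₂ := by
    intro x hx
    rw [Set.mem_union, hK₁ x hx, hK₂ x hx, tangent_swap, halfPlane, halfPlane, rot_neg]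
    simp only [Set.mem_ofPred_eq, inner_neg_left]
    rcases le_total 0 (inner ℝ (rot τ) (x - m)) with h | h
    · exact Or.inl h
    · exact Or.inr (by linarith)
  have hφU : IsTest (hull K₁ ∪ hull K₂) φ := ⟨hφ.1, hφ.2.1, hφ.2.2.trans hballU⟩
  have hφ2 : ∀ K : Finset E, MemLp φ 2 (volume.restrict (hull K)) := fun K =>
    hφ.1.continuous.memLp_of_hasCompactSupport hφ.2.1
  have hφside := memLp_side hab hγ hφ.1.continuous 2
  set S := ENNReal.ofReal s with hS
  -- Green's formula
  have e1 : ∫ x in Ω, inner ℝ (r x) (curlS φ x) =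
      (∫ x in hull K₁, c₁ x * φ x) + (∫ x in hull K₂, c₂ x * φ x) -
        ((∫ x, j x * φ x ∂sideMeasure γ) + ∫ x, polyFun p x * φ x ∂sideMeasure γ) := by
    have h1 := ht₁.setIntegral_inner_curlS hab hγ hsab hK₁ hφ hc₁ hc₁2
    have h2 := ht₂.setIntegral_inner_curlS hab.symm (hγ.trans (segment_symm ℝ a b))
      (by rwa [norm_sub_rev]) (by rw [midpoint_comm]; exact hK₂) (by rw [midpoint_comm]; exact hφ)
      hc₂ hc₂2
    have hφτ : MemLp (fun x => φ x • τ) 2 (sideMeasure γ) :=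
      memLp_side hab hγ (hφ.1.continuous.smul continuous_const) 2
    have h3 : ∫ x in Ω, inner ℝ (r x) (curlS φ x) =
        (∫ x in hull K₁, inner ℝ (r x) (curlS φ x)) + ∫ x in hull K₂, inner ℝ (r x) (curlS φ x) := by
      have hle : (volume : Measure E).restrict (hull K₁ ∪ hull K₂) ≤ volume.restrict Ω := by
        rw [← hΩ.restrict_closure]
        exact Measure.restrict_mono_set _ (Set.union_subset hK₁Ω hK₂Ω)
      have hi : IntegrableOn (fun x => (inner ℝ (r x) (curlS φ x) : ℝ)) (hull K₁ ∪ hull K₂) volume :=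
        (integrable_inner_of_memLp hr (memLp_curlS hφ.1 hφ.2.1 _)).mono_measure hle
      rw [← setIntegral_union₀ (by rw [AEDisjoint, hinter]; exact volume_segment a b)
        (measurableSet_hull K₂).nullMeasurableSet (hi.mono_set Set.subset_union_left)
        (hi.mono_set Set.subset_union_right), ← hΩ.restrict_closure,
        setIntegral_eq_integral_of_forall_compl_eq_zero,
        setIntegral_eq_integral_of_forall_compl_eq_zero]
      · intro x hx
        rw [curlS_eq_zero fun h => hx (hφU.2.2 h), inner_zero_right]
      · intro x hx
        rw [curlS_eq_zero fun h => hx (Set.union_subset hK₁Ω hK₂Ω (hφU.2.2 h)), inner_zero_right]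
    have h4 : (∫ x, inner ℝ (g₁ x) (φ x • τ) ∂sideMeasure γ) -
        (∫ x, inner ℝ (g₂ x) (φ x • τ) ∂sideMeasure γ) =
        (∫ x, j x * φ x ∂sideMeasure γ) + ∫ x, polyFun p x * φ x ∂sideMeasure γ := by
      rw [← integral_sub (integrable_inner_of_memLp ht₁.2.1 hφτ)
        (integrable_inner_of_memLp ht₂.2.1 hφτ), ← integral_add (integrable_mul_of_memLp hj hφside)
        (integrable_mul_of_memLp (memLp_side hab hγ (contDiff_polyFun p).continuous 2) hφside)]
      refine integral_congr_ae (.of_forall fun x => ?_)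
      simp only
      rw [← add_mul, ← hjump, inner_smul_right, inner_smul_right, real_inner_comm,
        real_inner_comm (g₂ x)]
      ring
    have h5 : ∫ x, inner ℝ (g₂ x) (φ x • tangent b a) ∂sideMeasure γ =
        -∫ x, inner ℝ (g₂ x) (φ x • τ) ∂sideMeasure γ := by
      rw [← integral_neg]
      refine integral_congr_ae (.of_forall fun x => ?_)
      simp only [tangent_swap a b, smul_neg, inner_neg_right]
      rfl
    rw [h5] at h2
    rw [h3, h1, h2, ← h4]
    ring
  have hscale : ∀ g : ℝ → ℝ, eLpNorm (fun t => g (s⁻¹ * t)) 2 volume =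
      S ^ (1 / 2 : ℝ) * eLpNorm g 2 volume := by
    intro g
    have := eLpNorm_two_comp_smul volume g hs
    simpa using this
  have hSS : S ^ (1 / 2 : ℝ) * S ^ (1 / 2 : ℝ) = S := by
    rw [← ENNReal.rpow_add_of_nonneg _ _ (by norm_num) (by norm_num)]
    norm_num
  have e2 : ‖∫ x, polyFun p x * φ x ∂sideMeasure γ‖ₑ = S * B ^ 2 := by
    have hG : MemLp (fun t => bump (axisPt (s⁻¹ * t)) * w.eval (s⁻¹ * t)) 2 volume := by
      refine ⟨?_, ?_⟩
      · have hc : Continuous fun t => bump (axisPt t) * w.eval t :=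
          (bump.continuous.comp isometry_axisPt.continuous).mul w.continuous
        exact (hc.comp (continuous_const.mul continuous_id)).aestronglyMeasurable
      · rw [hscale fun t => bump (axisPt t) * w.eval t]
        exact ENNReal.mul_lt_top (ENNReal.rpow_lt_top_of_nonneg (by norm_num)
          ENNReal.ofReal_ne_top) hBt.lt_top
    have h1 := enorm_integral_sq_eq hG
    rw [hscale fun t => bump (axisPt t) * w.eval t, mul_pow, sq (S ^ (1 / 2 : ℝ)), hSS] at h1
    rw [← h1, integral_sideMeasure hab hγ hsab]
    · congr 1
      refine integral_congr_ae (.of_forall fun t => ?_)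
      change polyFun p (m + t • τ) * φ (m + t • τ) = _
      rw [hφline, ← hw]
      ring
    · intro x hx
      rw [image_eq_zero_of_notMem_tsupport (hz x hx), mul_zero]
  have hline : ∀ F : E → ℝ, eLpNorm F 2 (sideMeasure γ) = eLpNorm (fun t => F (m + t • τ)) 2
      (volume.restrict (Set.Icc (-(‖b - a‖ / 2)) (‖b - a‖ / 2))) := by
    intro F
    rw [sideMeasure_eq_map hab hγ, (measurableEmbedding_line m hτ).eLpNorm_map_measure]
    rfl
  -- One of the two cut-off factors is dropped, using that it is at most `1`.
  have e3 : eLpNorm φ 2 (sideMeasure γ) ≤ S ^ (1 / 2 : ℝ) * B := by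
    rw [hline, hB, ← hscale]
    refine (eLpNorm_mono_measure _ Measure.restrict_le_self).trans (eLpNorm_mono fun t => ?_)
    rw [hφline, sq, mul_assoc, norm_mul]
    refine mul_le_of_le_one_left (norm_nonneg _) ?_
    rw [Real.norm_of_nonneg bump.nonneg]
    exact bump.le_one
  have e4 : eLpNorm (polyFun p) 2 (sideMeasure γ) ≤ S ^ (1 / 2 : ℝ) * (C * B) := by
    have h1 : eLpNorm (polyFun p) 2 (sideMeasure γ) ≤
        eLpNorm (fun t => (Set.Icc (-R) R).indicator (fun t => w.eval t) (s⁻¹ * t)) 2 volume := by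
      rw [hline]
      refine le_trans (le_of_eq (eLpNorm_congr_ae ?_))
        (eLpNorm_mono_measure _ Measure.restrict_le_self)
      refine ae_restrict_of_forall_mem measurableSet_Icc fun t ht => ?_
      beta_reduce
      rw [Set.indicator_of_mem, hw]
      have h0 : 0 ≤ ‖b - a‖ := norm_nonneg _
      have hRs : |t| ≤ s * R := (abs_le.2 ht).trans (by linarith)
      have : |s⁻¹ * t| ≤ R := by
        rw [abs_mul, abs_inv, abs_of_pos hs, inv_mul_le_iff₀ hs]; exact hRs
      exact abs_le.1 this
    refine h1.trans ?_
    rw [hscale, eLpNorm_indicator_eq_eLpNorm_restrict measurableSet_Icc]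
    gcongr
  have e5 : eLpNorm (curlS φ) 2 volume ≤ 2 * (C * B) :=
    (eLpNorm_curlS_comp_toRef_le m hs hτ (contDiff_bubble hwy)).trans (by gcongr)
  have e6 : ∀ K : Finset E, eLpNorm φ 2 (volume.restrict (hull K)) ≤ S * (C * B) := fun K => by
    refine (eLpNorm_mono_measure _ Measure.restrict_le_self).trans ?_
    rw [hφdef, eLpNorm_comp_toRef m hs hτ (bubble fun y => w.eval (y 0))]
    gcongr
  set n₁ := eLpNorm c₁ 2 (volume.restrict (hull K₁))
  set n₂ := eLpNorm c₂ 2 (volume.restrict (hull K₂))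
  set nj := eLpNorm j 2 (sideMeasure γ)
  set S' := S ^ (1 / 2 : ℝ)
  have e7 : S * B ≤ (2 * C + 1) * (A + S * (n₁ + n₂) + S' * nj) := by
    refine le_of_mul_sq_le hBt ?_
    have h1 : ∫ x, polyFun p x * φ x ∂sideMeasure γ =
        (∫ x in hull K₁, c₁ x * φ x) + (∫ x in hull K₂, c₂ x * φ x) -
          (∫ x in Ω, inner ℝ (r x) (curlS φ x)) - ∫ x, j x * φ x ∂sideMeasure γ := by
      rw [e1]; ring
    calc S * B ^ 2 = ‖∫ x, polyFun p x * φ x ∂sideMeasure γ‖ₑ := e2.symm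
      _ ≤ ‖∫ x in hull K₁, c₁ x * φ x‖ₑ + ‖∫ x in hull K₂, c₂ x * φ x‖ₑ +
          ‖∫ x in Ω, inner ℝ (r x) (curlS φ x)‖ₑ + ‖∫ x, j x * φ x ∂sideMeasure γ‖ₑ := by
        rw [h1]
        refine enorm_sub_le.trans (add_le_add (enorm_sub_le.trans (add_le_add ?_ le_rfl)) le_rfl)
        exact enorm_add_le _ _
      _ ≤ n₁ * (S * (C * B)) + n₂ * (S * (C * B)) + A * (2 * (C * B)) + nj * (S' * B) := by
        gcongr
        · exact (enorm_integral_mul_le hc₁2.1 (hφ2 _).1).trans (mul_le_mul' le_rfl (e6 _))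
        · exact (enorm_integral_mul_le hc₂2.1 (hφ2 _).1).trans (mul_le_mul' le_rfl (e6 _))
        · exact (hres φ hφU).trans (mul_le_mul' le_rfl e5)
        · exact (enorm_integral_mul_le hj.1 hφside.1).trans (mul_le_mul' le_rfl e3)
      _ = (C * (S * (n₁ + n₂)) + 2 * C * A + S' * nj) * B := by ring
      _ ≤ ((2 * C + 1) * (S * (n₁ + n₂)) + (2 * C + 1) * A + (2 * C + 1) * (S' * nj)) * B := by
        refine mul_le_mul' (add_le_add (add_le_add ?_ ?_) ?_) le_rfl
        · refine mul_le_mul' (le_trans ?_ le_self_add) le_rfl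
          rw [two_mul]
          exact le_self_add
        · exact mul_le_mul' le_self_add le_rfl
        · exact (one_mul _).symm.le.trans (mul_le_mul' le_add_self le_rfl)
      _ = _ := by ring
  calc S' * eLpNorm (polyFun p) 2 (sideMeasure γ) ≤ S' * (S' * (C * B)) := by gcongr
    _ = C * (S * B) := by rw [← hSS]; ring
    _ ≤ C * ((2 * C + 1) * (A + S * (n₁ + n₂) + S' * nj)) := by gcongr
    _ = _ := by push_cast; ring

/-! ### The residual on a mesh -/

/-- On a triangle the residual is the oscillation of the force plus a polynomial field. -/
theorem exists_residual_eq_osc_add_polyField {k : ℕ} {K : Finset E} {θ : E → ℝ} {f uh : E → E}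
    (hθ : IsPolynomialOn k K θ)
    (huh : ∃ (a : ℝ) (b : E), ∀ᵐ x ∂(volume.restrict (hull K)), uh x = a • x + b) :
    ∃ p : Fin 2 → MvPolynomial (Fin 2) ℝ, (∀ i, (p i).totalDegree ≤ k + 1) ∧
      (fun x => f x - θ x • uh x) =ᵐ[volume.restrict (hull K)] osc f K + polyField p := by
  obtain ⟨Q, hQ, hθQ⟩ := hθ
  obtain ⟨a, b, hab⟩ := huh
  set m := ⨍ y in hull K, f y with hm
  -- The polynomial field is the mean of `f` minus the viscosity polynomial times `a x + b`; the
  -- affine factor turns degree `k` into `k + 1`.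
  refine ⟨fun i => MvPolynomial.C (m i) -
    Q * (MvPolynomial.C a * MvPolynomial.X i + MvPolynomial.C (b i)), fun i => ?_, ?_⟩
  · refine (MvPolynomial.totalDegree_sub _ _).trans (max_le (by simp) ?_)
    refine (MvPolynomial.totalDegree_mul _ _).trans (add_le_add hQ ?_)
    refine (MvPolynomial.totalDegree_add _ _).trans (max_le ?_ (by simp))
    exact (MvPolynomial.totalDegree_mul _ _).trans (by simp)
  · filter_upwards [hab, ae_restrict_mem (measurableSet_hull K)] with x hx hxK
    ext i
    have h := hθQ x hxK
    fin_cases i <;> simp [osc, ← hm, hx, h, polyField, polyFun] <;> ring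

theorem inner_polyField (τ : E) (p : Fin 2 → MvPolynomial (Fin 2) ℝ) (x : E) :
    inner ℝ τ (polyField p x) =
      polyFun (MvPolynomial.C (τ 0) * p 0 + MvPolynomial.C (τ 1) * p 1) x := by
  rw [inner_E]
  simp [polyField, polyFun]

theorem hull_eq_segment {γ : Finset E} (hγ : γ.card = 2) {a b : E} (ha : a ∈ γ) (hb : b ∈ γ)
    (hab : a ≠ b) : hull γ = segment ℝ a b := by
  classical
  have h : ({a, b} : Finset E) = γ := by
    refine Finset.eq_of_subset_of_card_le ?_ ?_
    · intro x hx
      simp only [Finset.mem_insert, Finset.mem_singleton] at hx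
      rcases hx with rfl | rfl <;> assumption
    · rw [hγ, Finset.card_pair hab]
  rw [← h, hull_pair]

theorem Mesh.hull_subset_closure {Ω : Set E} (𝒯 : Mesh Ω) {K : Finset E} (hK : K ∈ 𝒯.elems) :
    hull K ⊆ closure Ω := by
  rw [← 𝒯.cover]
  exact Set.subset_biUnion_of_mem (u := fun K : Finset E => convexHull ℝ (K : Set E)) hK

theorem Mesh.mem_patch_self {Ω : Set E} (𝒯 : Mesh Ω) {K : Finset E} (hK : K ∈ 𝒯.elems) :
    K ∈ 𝒯.patch K := by
  classical
  simp [Mesh.patch, hK]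

theorem Mesh.patch_subset {Ω : Set E} (𝒯 : Mesh Ω) (K : Finset E) : 𝒯.patch K ⊆ 𝒯.elems := by
  classical
  exact Finset.filter_subset _ _

theorem Mesh.mem_patch_of_side {Ω : Set E} (𝒯 : Mesh Ω) {K K' γ : Finset E} (hγ : γ ∈ 𝒯.sides K)
    (hK' : K' ∈ 𝒯.elems) (hγK' : γ ⊆ K') : K' ∈ 𝒯.patch K := by
  classical
  rw [Mesh.patch, Finset.mem_filter]
  refine ⟨hK', Or.inr ⟨γ, Finset.mem_inter.2 ⟨hγ, ?_⟩⟩⟩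
  rw [Mesh.sides, Finset.mem_filter] at hγ ⊢
  exact ⟨Finset.mem_powersetCard.2 ⟨hγK', hγ.2.1⟩, hγ.2⟩

theorem Mesh.card_sides_le {Ω : Set E} (𝒯 : Mesh Ω) {K : Finset E} (hK : K ∈ 𝒯.elems) :
    (𝒯.sides K).card ≤ 3 := by
  classical
  refine (Finset.card_filter_le _ _).trans ?_
  rw [Finset.card_powersetCard, 𝒯.card_eq K hK]
  decide

theorem Mesh.hull_subset_patchSet {Ω : Set E} (𝒯 : Mesh Ω) {K K' : Finset E}
    (h : K' ∈ 𝒯.patch K) : hull K' ⊆ 𝒯.patchSet K :=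
  Set.subset_biUnion_of_mem (u := fun K : Finset E => hull K) h

theorem Mesh.patchSet_subset_closure {Ω : Set E} (𝒯 : Mesh Ω) (K : Finset E) :
    𝒯.patchSet K ⊆ closure Ω :=
  Set.iUnion₂_subset fun _ h => 𝒯.hull_subset_closure (𝒯.patch_subset K h)

/-- The bound of the polynomial part of the jump across an internal side of a mesh. -/
theorem Mesh.exists_side_bound (N : ℕ) (R : ℝ) : ∃ C : ℝ≥0, ∀ (Ω : Set E),
    IsPolygonalLipschitzDomain Ω → ∀ (𝒯 : Mesh Ω) (r : E → E) (A : ℝ≥0∞) (K₁ K₂ γ : Finset E)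
    (a b x₁ x₂ : E) (s : ℝ) (g₁ g₂ : E → E) (c₁ c₂ j : E → ℝ) (p : MvPolynomial (Fin 2) ℝ),
    MemLp r 2 (volume.restrict Ω) → K₁ ∈ 𝒯.elems → K₂ ∈ 𝒯.elems → K₁ ≠ K₂ →
    γ.card = 2 → γ ⊆ K₁ → γ ⊆ K₂ → a ∈ γ → b ∈ γ → a ≠ b →
    0 < s → Metric.ball x₁ s ⊆ hull K₁ → Metric.ball x₂ s ⊆ hull K₂ → ‖b - a‖ ≤ R * s →
    IsTrace K₁ γ r g₁ → IsTrace K₂ γ r g₂ →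
    HasWeakCurl (interior (hull K₁)) r c₁ → HasWeakCurl (interior (hull K₂)) r c₂ →
    MemLp c₁ 2 (volume.restrict (hull K₁)) → MemLp c₂ 2 (volume.restrict (hull K₂)) →
    MemLp j 2 (sideMeasure γ) → p.totalDegree ≤ N →
    (∀ x, inner ℝ (tangent a b) (g₁ x) - inner ℝ (tangent a b) (g₂ x) = j x + polyFun p x) →
    (∀ φ, IsTest (hull K₁ ∪ hull K₂) φ →
      ‖∫ x in Ω, inner ℝ (r x) (curlS φ x)‖ₑ ≤ A * eLpNorm (curlS φ) 2 volume) →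
    ENNReal.ofReal s ^ (1 / 2 : ℝ) * eLpNorm (polyFun p) 2 (sideMeasure γ) ≤
      C * (A + ENNReal.ofReal s * (eLpNorm c₁ 2 (volume.restrict (hull K₁)) +
        eLpNorm c₂ 2 (volume.restrict (hull K₂))) +
        ENNReal.ofReal s ^ (1 / 2 : ℝ) * eLpNorm j 2 (sideMeasure γ)) := by
  obtain ⟨C, hC⟩ := DarcyHeat.exists_side_bound N R
  refine ⟨C, ?_⟩
  intro Ω hΩ 𝒯 r A K₁ K₂ γ a b x₁ x₂ s g₁ g₂ c₁ c₂ j p hr hK₁ hK₂ hne hγ2 hγ₁ hγ₂ ha hb hab hs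
    hb₁ hb₂ habs ht₁ ht₂ hc₁ hc₂ hc₁2 hc₂2 hj hp hjump hres
  have hγ := hull_eq_segment hγ2 ha hb hab
  have hsab := two_mul_le_norm_side (𝒯.card_eq _ hK₁) (𝒯.indep _ hK₁) hs hb₁ (hγ₁ ha) (hγ₁ hb) hab
  have hinter := 𝒯.hull_inter_hull hK₁ hK₂ hne hab (hγ₁ ha) (hγ₁ hb) (hγ₂ ha) (hγ₂ hb)
  have hnot := fun {τ : E} (h1 : ‖τ‖ = 1) (h2 : τ = tangent a b ∨ τ = tangent b a) =>
    𝒯.not_same_side hK₁ hK₂ hne hab (hγ₁ ha) (hγ₁ hb) (hγ₂ ha) (hγ₂ hb) h1 h2 hs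
  rcases hull_eq_halfPlane_near_midpoint (𝒯.card_eq _ hK₁) (𝒯.indep _ hK₁) hs hb₁ (hγ₁ ha) (hγ₁ hb)
    hab with h₁ | h₁ <;>
  rcases hull_eq_halfPlane_near_midpoint (𝒯.card_eq _ hK₂) (𝒯.indep _ hK₂) hs hb₂ (hγ₂ ha) (hγ₂ hb)
    hab with h₂ | h₂
  · exact (hnot (norm_tangent hab) (Or.inl rfl) h₁ h₂).elim
  · exact hC Ω hΩ r A K₁ K₂ γ a b s g₁ g₂ c₁ c₂ j p hr hs hab hγ hsab habs h₁ h₂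
      (𝒯.hull_subset_closure hK₁) (𝒯.hull_subset_closure hK₂) hinter ht₁ ht₂ hc₁ hc₂ hc₁2 hc₂2 hj hp
      hjump hres
  -- The triangles lie the other way round: exchanging them with the tangent kept fixed reverses the
  -- sign of the jump, which no norm sees.
  · have hneg : polyFun (-p) = -polyFun p := by ext x; simp [polyFun]
    have h := hC Ω hΩ r A K₂ K₁ γ a b s g₂ g₁ c₂ c₁ (-j) (-p) hr hs hab hγ hsab habs h₂ h₁
      (𝒯.hull_subset_closure hK₂) (𝒯.hull_subset_closure hK₁) (by rw [Set.inter_comm, hinter])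
      ht₂ ht₁ hc₂ hc₁ hc₂2 hc₁2 hj.neg (by rwa [MvPolynomial.totalDegree_neg])
      (fun x => by
        have := hjump x
        rw [hneg, Pi.neg_apply, Pi.neg_apply]
        linarith) (by rwa [Set.union_comm])
    rwa [hneg, eLpNorm_neg, eLpNorm_neg, add_comm (eLpNorm c₂ _ _)] at h
  · exact (hnot (norm_tangent hab.symm) (Or.inr rfl) h₁ h₂).elim

theorem rpow_half_sq (x : ℝ≥0∞) : (x ^ (1 / 2 : ℝ)) ^ 2 = x := by
  rw [← ENNReal.rpow_natCast, ← ENNReal.rpow_mul]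
  norm_num

theorem rpow_half_le_of_le_sq {x y : ℝ≥0∞} (h : x ≤ y ^ 2) : x ^ (1 / 2 : ℝ) ≤ y := by
  refine (ENNReal.rpow_le_rpow h (by norm_num)).trans (le_of_eq ?_)
  rw [← ENNReal.rpow_natCast, ← ENNReal.rpow_mul]
  norm_num

/-- The Euclidean norm of nonnegative terms is at most their sum, so curl and jumps can be bounded
separately. -/
theorem Mesh.curlIndicator_le {Ω : Set E} (𝒯 : Mesh Ω) (ν : ℝ → ℝ) (f uh : E → E) (Th : E → ℝ)
    (K : Finset E) : 𝒯.curlIndicator ν f uh Th K ≤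
      ENNReal.ofReal (hK K) *
        curlNorm (interior (hull K)) (fun x => f x - ν (Th x) • uh x) +
      ∑ γ ∈ 𝒯.sides K, ENNReal.ofReal (hK K) ^ (1 / 2 : ℝ) *
        𝒯.jumpNorm γ (fun _ x => f x - ν (Th x) • uh x) := by
  refine rpow_half_le_of_le_sq ?_
  have h : ENNReal.ofReal (hK K) *
      ∑ γ ∈ 𝒯.sides K, 𝒯.jumpNorm γ (fun _ x => f x - ν (Th x) • uh x) ^ 2 ≤
      (∑ γ ∈ 𝒯.sides K, ENNReal.ofReal (hK K) ^ (1 / 2 : ℝ) *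
        𝒯.jumpNorm γ (fun _ x => f x - ν (Th x) • uh x)) ^ 2 := by
    refine le_trans (le_of_eq ?_) (Finset.sum_sq_le_sq_sum_of_nonneg fun _ _ => zero_le)
    simp only [mul_pow, rpow_half_sq, Finset.mul_sum]
  refine (add_le_add (mul_pow _ _ 2).symm.le h).trans ?_
  rw [add_sq]
  refine add_le_add ?_ le_rfl
  exact le_self_add

/-- The bound of the jump of the residual across an internal side of a shape regular mesh. -/
theorem Mesh.exists_jumpNorm_bound (N : ℕ) {σ : ℝ} (hσ : 0 ≤ σ) : ∃ C : ℝ≥0, ∀ (Ω : Set E),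
    IsPolygonalLipschitzDomain Ω → ∀ (𝒯 : Mesh Ω) (r : E → E) (w : Finset E → E → E) (A D : ℝ≥0∞)
    (K γ : Finset E) (d : Finset E → E → ℝ) (p : Finset E → Fin 2 → MvPolynomial (Fin 2) ℝ),
    MemLp r 2 (volume.restrict Ω) →
    (∀ K ∈ 𝒯.elems, ∃ (x : E) (s : ℝ), 0 < s ∧ Metric.ball x s ⊆ hull K ∧ hK K ≤ σ * (2 * s)) →
    K ∈ 𝒯.elems → γ ∈ 𝒯.sides K →
    (∀ K' ∈ 𝒯.patch K, ∀ i, (p K' i).totalDegree ≤ N) →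
    (∀ K' ∈ 𝒯.patch K, r =ᵐ[volume.restrict (hull K')] w K' + polyField (p K')) →
    (∀ K' ∈ 𝒯.patch K, HasWeakCurl (interior (hull K')) r (d K')) →
    (∀ K' ∈ 𝒯.patch K, MemLp (d K') 2 (volume.restrict (hull K'))) →
    (∀ K' ∈ 𝒯.patch K,
      ENNReal.ofReal (hK K') * eLpNorm (d K') 2 (volume.restrict (hull K')) ≤ D) →
    (∀ φ, IsTest (𝒯.patchSet K) φ →
      ‖∫ x in Ω, inner ℝ (r x) (curlS φ x)‖ₑ ≤ A * eLpNorm (curlS φ) 2 volume) →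
    ENNReal.ofReal (hK K) ^ (1 / 2 : ℝ) * 𝒯.jumpNorm γ (fun _ => r) ≤
      C * (A + 2 * D + ENNReal.ofReal (hK K) ^ (1 / 2 : ℝ) * 𝒯.jumpNorm γ w) := by
  obtain ⟨C, hC⟩ := Mesh.exists_side_bound N (2 * σ)
  set t : ℝ≥0∞ := ENNReal.ofReal (2 * σ ^ 2) ^ (1 / 2 : ℝ) with ht
  have htt : t ≠ ⊤ := ENNReal.rpow_ne_top_of_nonneg (by norm_num) ENNReal.ofReal_ne_top
  refine ⟨1 + t.toNNReal * C, ?_⟩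
  intro Ω hΩ 𝒯 r w A D K γ d p hr hreg hKT hγ hp hrw hd hd2 hD hres
  have hγ' : γ ⊆ K ∧ γ.card = 2 := by
    classical
    rw [Mesh.sides, Finset.mem_filter, Finset.mem_powersetCard] at hγ
    exact hγ.1
  obtain ⟨xK, sK, hsK, hbK, hKs⟩ := hreg K hKT
  have hH0 : 0 < hK K := by
    obtain ⟨a, b, hab, rfl⟩ := Finset.card_eq_two.1 hγ'.2
    have ha : a ∈ K := hγ'.1 (by simp)
    have hb : b ∈ K := hγ'.1 (by simp)
    have h1 := two_mul_le_norm_side (𝒯.card_eq _ hKT) (𝒯.indep _ hKT) hsK hbK ha hb hab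
    have h2 := norm_side_le_hK ha hb
    linarith
  have hH1 : ENNReal.ofReal (hK K) ^ (1 / 2 : ℝ) ≠ ⊤ :=
    ENNReal.rpow_ne_top_of_nonneg (by norm_num) ENNReal.ofReal_ne_top
  have hH2 : ENNReal.ofReal (hK K) ^ (1 / 2 : ℝ) ≠ 0 := by
    have : ENNReal.ofReal (hK K) ≠ 0 := (ENNReal.ofReal_pos.2 hH0).ne'
    simp [ENNReal.rpow_eq_zero_iff, this]
  -- Finite nonzero factors move inside the infimum that defines the jump norm of `w`, so it
  -- suffices to treat each tangential jump `j`; if there is none, the right side is infinite.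
  have hC0 : ((1 + t.toNNReal * C : ℝ≥0) : ℝ≥0∞) ≠ 0 := by simp
  have hjn : 𝒯.jumpNorm γ w = ⨅ (j : E → ℝ) (_ : 𝒯.IsTangentialJump γ w j),
      eLpNorm j 2 (sideMeasure γ) := rfl
  rw [hjn]
  simp_rw [ENNReal.mul_iInf_of_ne hH2 hH1, ENNReal.add_iInf,
    ENNReal.mul_iInf_of_ne hC0 ENNReal.coe_ne_top]
  refine le_iInf₂ fun j hj => ?_
  obtain ⟨K₁, hK₁, K₂, hK₂, hne, hγ₁, hγ₂, a, ha, b, hb, hab, g₁, g₂, ht₁, ht₂, hjg⟩ := hj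
  have hm₁ := 𝒯.mem_patch_of_side hγ hK₁ hγ₁
  have hm₂ := 𝒯.mem_patch_of_side hγ hK₂ hγ₂
  have hγs := hull_eq_segment hγ'.2 ha hb hab
  obtain ⟨x₁, s₁, hs₁, hb₁, hKs₁⟩ := hreg K₁ hK₁
  obtain ⟨x₂, s₂, hs₂, hb₂, hKs₂⟩ := hreg K₂ hK₂
  -- One radius must serve both triangles.
  set s := min s₁ s₂ with hsdef
  have hs : 0 < s := lt_min hs₁ hs₂
  have hb₁' : Metric.ball x₁ s ⊆ hull K₁ := (Metric.ball_subset_ball (min_le_left _ _)).trans hb₁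
  have hb₂' : Metric.ball x₂ s ⊆ hull K₂ := (Metric.ball_subset_ball (min_le_right _ _)).trans hb₂
  have hn₁ := norm_side_le_hK (hγ₁ ha) (hγ₁ hb)
  have hn₂ := norm_side_le_hK (hγ₂ ha) (hγ₂ hb)
  have hn := norm_side_le_hK (hγ'.1 ha) (hγ'.1 hb)
  have h2s := two_mul_le_norm_side (𝒯.card_eq _ hK₁) (𝒯.indep _ hK₁) hs hb₁' (hγ₁ ha) (hγ₁ hb) hab
  have habs : ‖b - a‖ ≤ 2 * σ * s := by
    rcases min_choice s₁ s₂ with h | h <;> rw [hsdef, h] <;> linarith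
  -- Sizes are compared through the common side: `hK K ≤ 2 σ sK ≤ σ ‖b - a‖ ≤ 2 σ² s`. This is the
  -- origin of the constant `t`.
  have hHs : hK K ≤ 2 * σ ^ 2 * s := by
    have h1 := two_mul_le_norm_side (𝒯.card_eq _ hKT) (𝒯.indep _ hKT) hsK hbK (hγ'.1 ha)
      (hγ'.1 hb) hab
    calc hK K ≤ σ * (2 * sK) := hKs
      _ ≤ σ * (2 * σ * s) := mul_le_mul_of_nonneg_left (h1.trans habs) hσ
      _ = _ := by ring
  set τ := tangent a b with hτ
  have hP := fun K' => contDiff_polyField (p K')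
  let q : Finset E → MvPolynomial (Fin 2) ℝ := fun K' =>
    MvPolynomial.C (τ 0) * p K' 0 + MvPolynomial.C (τ 1) * p K' 1
  have hq : ∀ K' ∈ 𝒯.patch K, (q K').totalDegree ≤ N := fun K' hK' =>
    (MvPolynomial.totalDegree_add _ _).trans (max_le
      ((MvPolynomial.totalDegree_mul _ _).trans (by simpa using hp K' hK' 0))
      ((MvPolynomial.totalDegree_mul _ _).trans (by simpa using hp K' hK' 1)))
  have hqs : ∀ x, polyFun (q K₁ - q K₂) x =
      inner ℝ τ (polyField (p K₁) x) - inner ℝ τ (polyField (p K₂) x) := fun x => by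
    rw [inner_polyField, inner_polyField]
    simp [polyFun, q]
  have hr₁ := ht₁.add_smooth hab hγs (hP K₁) (hrw K₁ hm₁)
  have hr₂ := ht₂.add_smooth hab hγs (hP K₂) (hrw K₂ hm₂)
  have hj' : ∀ x, j x = inner ℝ τ (g₁ x) - inner ℝ τ (g₂ x) := fun x => by
    rw [hjg, inner_neg_left, ← sub_eq_add_neg]; rfl
  have hjm : MemLp j 2 (sideMeasure γ) := by
    have h1 := (ht₁.2.1.const_inner (𝕜 := ℝ) τ).sub (ht₂.2.1.const_inner (𝕜 := ℝ) τ)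
    exact h1.congr_norm (by
      have : j = fun x => inner ℝ τ (g₁ x) - inner ℝ τ (g₂ x) := funext hj'
      rw [this]; exact h1.1) (.of_forall fun x => by rw [hj']; rfl)
  have hjump : ∀ x, inner ℝ τ ((g₁ + polyField (p K₁)) x) -
      inner ℝ τ ((g₂ + polyField (p K₂)) x) = j x + polyFun (q K₁ - q K₂) x := fun x => by
    rw [hqs, hj', Pi.add_apply, Pi.add_apply, inner_add_right, inner_add_right]
    ring
  have hside := hC Ω hΩ 𝒯 r A K₁ K₂ γ a b x₁ x₂ s _ _ (d K₁) (d K₂) j (q K₁ - q K₂) hr hK₁ hK₂ hne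
    hγ'.2 hγ₁ hγ₂ ha hb hab hs hb₁' hb₂' habs hr₁ hr₂ (hd _ hm₁) (hd _ hm₂) (hd2 _ hm₁) (hd2 _ hm₂)
    hjm ((MvPolynomial.totalDegree_sub _ _).trans (max_le (hq _ hm₁) (hq _ hm₂))) hjump
    (fun φ hφ => hres φ ⟨hφ.1, hφ.2.1, hφ.2.2.trans
      (Set.union_subset (𝒯.hull_subset_patchSet hm₁) (𝒯.hull_subset_patchSet hm₂))⟩)
  -- Adding the polynomial fields to the traces of `w` gives traces of `r`, so `j` plus the
  -- polynomial jump is a competitor for the jump norm of `r`.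
  have hjr : 𝒯.jumpNorm γ (fun _ => r) ≤
      eLpNorm j 2 (sideMeasure γ) + eLpNorm (polyFun (q K₁ - q K₂)) 2 (sideMeasure γ) := by
    refine le_trans (iInf₂_le (j + polyFun (q K₁ - q K₂))
      ⟨K₁, hK₁, K₂, hK₂, hne, hγ₁, hγ₂, a, ha, b, hb, hab, _, _, hr₁, hr₂, fun x => ?_⟩)
      (eLpNorm_add_le hjm.1 (contDiff_polyFun _).continuous.aestronglyMeasurable (by norm_num))
    rw [Pi.add_apply, ← hjump, inner_neg_left, ← sub_eq_add_neg]
    rfl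
  set H := ENNReal.ofReal (hK K) ^ (1 / 2 : ℝ) with hH
  set S := ENNReal.ofReal s with hS
  set nj := eLpNorm j 2 (sideMeasure γ)
  have hHS : H ≤ t * S ^ (1 / 2 : ℝ) := by
    rw [hH, ht, ← ENNReal.mul_rpow_of_nonneg _ _ (by norm_num), hS,
      ← ENNReal.ofReal_mul (by positivity)]
    exact ENNReal.rpow_le_rpow (ENNReal.ofReal_le_ofReal hHs) (by norm_num)
  have hSH : S ^ (1 / 2 : ℝ) ≤ H :=
    ENNReal.rpow_le_rpow (ENNReal.ofReal_le_ofReal (by linarith)) (by norm_num)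
  have hS₁ : S ≤ ENNReal.ofReal (hK K₁) := ENNReal.ofReal_le_ofReal (by linarith)
  have hS₂ : S ≤ ENNReal.ofReal (hK K₂) := ENNReal.ofReal_le_ofReal (by linarith)
  have hSD : S * (eLpNorm (d K₁) 2 (volume.restrict (hull K₁)) +
      eLpNorm (d K₂) 2 (volume.restrict (hull K₂))) ≤ 2 * D := by
    rw [mul_add, two_mul]
    exact add_le_add ((mul_le_mul' hS₁ le_rfl).trans (hD _ hm₁))
      ((mul_le_mul' hS₂ le_rfl).trans (hD _ hm₂))
  calc H * 𝒯.jumpNorm γ (fun _ => r)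
      ≤ H * nj + H * eLpNorm (polyFun (q K₁ - q K₂)) 2 (sideMeasure γ) := by
        rw [← mul_add]; exact mul_le_mul' le_rfl hjr
    _ ≤ H * nj + t * (S ^ (1 / 2 : ℝ) * eLpNorm (polyFun (q K₁ - q K₂)) 2 (sideMeasure γ)) := by
        rw [← mul_assoc t]
        exact add_le_add le_rfl (mul_le_mul' hHS le_rfl)
    _ ≤ H * nj + t * (C * (A + 2 * D + H * nj)) := by
        refine add_le_add le_rfl (mul_le_mul' le_rfl (hside.trans (mul_le_mul' le_rfl ?_)))
        exact add_le_add (add_le_add le_rfl hSD) (mul_le_mul' hSH le_rfl)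
    _ ≤ (A + 2 * D + H * nj) + t * (C * (A + 2 * D + H * nj)) := add_le_add le_add_self le_rfl
    _ = _ := by
        rw [ENNReal.coe_add, ENNReal.coe_mul, ENNReal.coe_toNNReal htt, ENNReal.coe_one]
        ring

end DarcyHeat

end

/-! ### Assembly of the local estimate -/

open DarcyHeat in
theorem theorem5p8
    (Ω : Set E) (hΩ : IsPolygonalLipschitzDomain Ω)
    (p : ℝ) (hp1 : 1 < p) (hp2 : p < 2)
    (z : E) (hz : z ∈ Ω)
    (κ : ℝ) (hκ : 0 < κ)
    (νmin νmax CL : ℝ) (hνmin : 0 < νmin) (hCL : 0 ≤ CL)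
    (σ : ℝ) (k : ℕ) :
    ∃ C : ℝ≥0,
      ∀ (𝕋 : Set (Mesh Ω)), ShapeRegular σ 𝕋 →
      ∀ hstar : ℝ, 0 < hstar →
      ∀ ν : ℝ → ℝ, (∀ s, νmin ≤ ν s ∧ ν s ≤ νmax) →
        (∀ s₁ s₂, |ν s₁ - ν s₂| ≤ CL * |s₁ - s₂|) →
      ∀ f : E → E, MemH1Vec Ω f →
        eLpNorm f 2 (volume.restrict Ω) ≤
          ENNReal.ofReal νmin * min (smallConst Ω p κ) (discreteSmallConst 𝕋 hstar p κ) →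
      ∀ (u : E → E) (P T : E → ℝ), IsWeakSolution Ω p ν (fun _ => κ) f z u P T →
      ∀ 𝒯 ∈ 𝕋, 𝒯.size ≤ hstar →
      ∀ (uh : E → E) (Ph Th : E → ℝ), 𝒯.IsDiscreteSolution p ν (fun _ => κ) f z uh Ph Th →
      ∀ ρ : ℝ, 0 < ρ → ρ < 1 →
        (smallConst Ω p κ)⁻¹ * eLpNorm (u - uh) 2 (volume.restrict Ω) ≤ ENNReal.ofReal ρ →
      ∀ ϱ : ℝ, 0 < ϱ → ϱ < 1 →
        ENNReal.ofReal CL * diracNorm Ω p z * eLpNorm u (conjExp p) (volume.restrict Ω) ≤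
          ENNReal.ofReal (ϱ * (1 - ρ) * νmin) * smallConst Ω p κ ^ 2 →
      (∀ K ∈ 𝒯.elems, IsPolynomialOn k K (fun x => ν (Th x))) →
      ∀ K ∈ 𝒯.elems,
        𝒯.curlIndicator ν f uh Th K ≤
          C * (eLpNorm (u - uh) 2 (volume.restrict (𝒯.patchSet K)) +
            ∑ K' ∈ 𝒯.patch K, ENNReal.ofReal (hK K') * curlNorm (interior (hull K')) (osc f K') +
            eLpNorm (T - Th) (sobExp p) (volume.restrict (𝒯.patchSet K)) +
            ∑ γ ∈ 𝒯.sides K, ENNReal.ofReal (hK K) ^ (1 / 2 : ℝ) * 𝒯.jumpNorm γ (osc f)) := by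
  -- The maximum keeps the aspect ratio bound and is nonnegative whatever the sign of `σ`.
  set σ' := max σ 1 with hσ'
  have hσ0 : (0 : ℝ) ≤ σ' := zero_le_one.trans (le_max_right _ _)
  obtain ⟨M, hM⟩ := exists_velocity_bound hΩ.isOpen hz hp1 hp2 hκ hνmin (CL := CL)
  obtain ⟨CE, hCE⟩ := exists_element_bound (k + 1) (2 * σ') (by positivity)
  obtain ⟨CS, hCS⟩ := Mesh.exists_jumpNorm_bound (k + 1) hσ0
  set m := νmax.toNNReal + M with hm
  -- `m` bounds the residual functional, `CE * (m + 1)` the curl on each triangle of the patch, and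
  -- the last term the jumps on at most three sides. The `1` keeps the constant nonzero, so an
  -- infinite right side stays infinite.
  refine ⟨1 + CE * (m + 1) + 3 * (CS * (m + 2 * (CE * (m + 1)) + 1)), ?_⟩
  intro 𝕋 hreg hstar _ ν hν hL f hf _ u P T hsol 𝒯 h𝒯 _ uh Ph Th hdsol ρ hρ0 hρ1 _ ϱ hϱ0 hϱ1 hsmall
    hpoly K hKT
  set eu := eLpNorm (u - uh) 2 (volume.restrict (𝒯.patchSet K))
  set eT := eLpNorm (T - Th) (sobExp p) (volume.restrict (𝒯.patchSet K))
  set X := eu + ∑ K' ∈ 𝒯.patch K, ENNReal.ofReal (hK K') * curlNorm (interior (hull K')) (osc f K') +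
    eT + ∑ γ ∈ 𝒯.sides K, ENNReal.ofReal (hK K) ^ (1 / 2 : ℝ) * 𝒯.jumpNorm γ (osc f) with hX
  by_cases hXt : X = ⊤
  · rw [hXt, ENNReal.mul_top (by simp)]
    exact le_top
  obtain ⟨du, GT, huh, -, hTh, -⟩ := hdsol
  set r : E → E := fun x => f x - ν (Th x) • uh x with hr
  have hνabs : ∀ s, |ν s| ≤ νmax := fun s => by
    rw [abs_of_nonneg (hνmin.le.trans (hν s).1)]; exact (hν s).2
  have hνc : Continuous ν := by
    refine (LipschitzWith.of_dist_le_mul (K := CL.toNNReal) fun x y => ?_).continuous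
    rw [Real.dist_eq, Real.dist_eq, Real.coe_toNNReal CL hCL]
    exact hL x y
  have hThm : AEStronglyMeasurable Th (volume.restrict Ω) := hTh.2.2.1.1.1
  have hf2 := hf.memLp
  have huh2 : MemLp uh 2 (volume.restrict Ω) := huh.1.1
  have hr2 : MemLp r 2 (volume.restrict Ω) := by
    refine hf2.sub (MemLp.of_le_mul (c := νmax) huh2
      ((hνc.comp_aestronglyMeasurable hThm).smul huh2.1) (.of_forall fun x => ?_))
    rw [norm_smul]
    exact mul_le_mul_of_nonneg_right (hνabs _) (norm_nonneg _)
  have hmono : ∀ {K'}, K' ∈ 𝒯.elems →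
      (volume : Measure E).restrict (hull K') ≤ volume.restrict Ω := fun hK' => by
    rw [← hΩ.restrict_closure]
    exact Measure.restrict_mono_set _ (𝒯.hull_subset_closure hK')
  have hball : ∀ K ∈ 𝒯.elems, ∃ (x : E) (s : ℝ), 0 < s ∧ Metric.ball x s ⊆ hull K ∧
      hK K ≤ σ' * (2 * s) := fun K hK => by
    obtain ⟨x, s, hs, h1, h2⟩ := hreg 𝒯 h𝒯 K hK
    exact ⟨x, s, hs, h1, h2.trans (mul_le_mul_of_nonneg_right (le_max_left _ _) (by positivity))⟩
  have hsize : ∀ K ∈ 𝒯.elems, ∀ (x : E) (s : ℝ), 0 < s → Metric.ball x s ⊆ hull K → s ≤ hK K :=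
    fun K hK x s hs h => by
      obtain ⟨a, ha, b, hb, hab⟩ := Finset.one_lt_card.1 (by rw [𝒯.card_eq K hK]; norm_num)
      have h1 := two_mul_le_norm_side (𝒯.card_eq K hK) (𝒯.indep K hK) hs h ha hb hab
      have h2 := norm_side_le_hK ha hb
      linarith
  -- The right side is now finite and every diameter in the patch is positive, so the oscillation
  -- has a weak curl in `L²` on each triangle of the patch.
  have hc : ∀ K' : Finset E, ∃ c : E → ℝ, K' ∈ 𝒯.patch K →
      HasWeakCurl (interior (hull K')) (osc f K') c ∧ MemLp c 2 (volume.restrict (hull K')) := by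
    intro K'
    by_cases hK' : K' ∈ 𝒯.patch K
    · obtain ⟨x, s, hs, h1, -⟩ := hball K' (𝒯.patch_subset K hK')
      have hpos : 0 < hK K' := hs.trans_le (hsize K' (𝒯.patch_subset K hK') x s hs h1)
      have hle : ENNReal.ofReal (hK K') * curlNorm (interior (hull K')) (osc f K') ≤ X :=
        (Finset.single_le_sum (f := fun K' => ENNReal.ofReal (hK K') *
          curlNorm (interior (hull K')) (osc f K')) (fun _ _ => zero_le) hK').trans
          (le_add_self.trans (le_self_add.trans le_self_add))
      have hne : curlNorm (interior (hull K')) (osc f K') ≠ ⊤ := fun h => by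
        rw [h, ENNReal.mul_top (ENNReal.ofReal_pos.2 hpos).ne'] at hle
        exact hXt (top_le_iff.1 hle)
      obtain ⟨c, h2, h3⟩ := exists_hasWeakCurl_of_curlNorm_ne_top hne
      rw [restrict_interior_hull] at h3
      exact ⟨c, fun _ => ⟨h2, h3⟩⟩
    · exact ⟨0, fun h => (hK' h).elim⟩
  choose c hc using hc
  have hq : ∀ K' : Finset E, ∃ q : Fin 2 → MvPolynomial (Fin 2) ℝ, K' ∈ 𝒯.elems →
      (∀ i, (q i).totalDegree ≤ k + 1) ∧
        r =ᵐ[volume.restrict (hull K')] osc f K' + polyField q := by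
    intro K'
    by_cases hK' : K' ∈ 𝒯.elems
    · obtain ⟨q, h⟩ := exists_residual_eq_osc_add_polyField (f := f) (hpoly K' hK') (huh.2 K' hK')
      exact ⟨q, fun _ => h⟩
    · exact ⟨0, fun h => (hK' h).elim⟩
  choose q hq using hq
  have hosc : ∀ K' ∈ 𝒯.elems, MemLp (osc f K') 2 (volume.restrict (hull K')) := fun K' hK' =>
    (hf2.mono_measure (hmono hK')).sub (memLp_hull K' continuous_const 2)
  set A := ENNReal.ofReal νmax * eu + M * eT with hA
  have hres : ∀ φ, IsTest (𝒯.patchSet K) φ →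
      ‖∫ x in Ω, inner ℝ (r x) (curlS φ x)‖ₑ ≤ A * eLpNorm (curlS φ) 2 volume := fun φ hφ =>
    eLpNorm_residual_le hΩ hp1 hp2 hνabs hCL hL hνc hf2 hsol huh2 hThm
      (hM u ρ ϱ hρ0 hρ1 hϱ0 hϱ1 hsmall) (𝒯.patchSet_subset_closure K) hφ
  have hAX : A ≤ m * X := by
    have h1 : eu ≤ X := le_self_add.trans (le_self_add.trans le_self_add)
    have h2 : eT ≤ X := le_add_self.trans le_self_add
    rw [hA, hm, ENNReal.coe_add, add_mul]
    exact add_le_add (mul_le_mul' le_rfl h1) (mul_le_mul' le_rfl h2)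
  let d : Finset E → E → ℝ := fun K' => c K' + curlV (polyField (q K'))
  have hP := fun K' => contDiff_polyField (q K')
  have hd : ∀ K' ∈ 𝒯.patch K, HasWeakCurl (interior (hull K')) r (d K') := fun K' hK' =>
    (hc K' hK').1.add_smooth (hc K' hK').2 (hosc K' (𝒯.patch_subset K hK')) (hP K')
      (hq K' (𝒯.patch_subset K hK')).2
  have hd2 : ∀ K' ∈ 𝒯.patch K, MemLp (d K') 2 (volume.restrict (hull K')) := fun K' hK' =>
    (hc K' hK').2.add (memLp_hull K' (continuous_curlV (hP K')) 2)
  -- The curl of the residual is bounded on the neighbours as well as on `K`, since Green's formula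
  -- for a jump brings in both triangles.
  have hD : ∀ K' ∈ 𝒯.patch K, ENNReal.ofReal (hK K') *
      eLpNorm (d K') 2 (volume.restrict (hull K')) ≤ CE * ((m + 1) * X) := by
    intro K' hK'
    have hK'T := 𝒯.patch_subset K hK'
    obtain ⟨x, s, hs, h1, h2⟩ := hball K' hK'T
    refine (hCE Ω hΩ r (osc f K') A K' (c K') (q K') x s hs h1 (𝒯.hull_subset_closure hK'T)
      (hsize K' hK'T x s hs h1) (by linarith) (hq K' hK'T).1 (hq K' hK'T).2 (hosc K' hK'T)
      (hc K' hK').1 (hc K' hK').2 fun φ hφ => hres φ ⟨hφ.1, hφ.2.1,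
        hφ.2.2.trans (𝒯.hull_subset_patchSet hK')⟩).trans (mul_le_mul' le_rfl ?_)
    rw [add_mul, one_mul]
    refine add_le_add hAX ?_
    rw [← restrict_interior_hull, ← (hc K' hK').1.curlNorm_eq isOpen_interior
      (by rw [restrict_interior_hull]; exact (hc K' hK').2)]
    exact (Finset.single_le_sum (f := fun K' => ENNReal.ofReal (hK K') *
      curlNorm (interior (hull K')) (osc f K')) (fun _ _ => zero_le) hK').trans
      (le_add_self.trans (le_self_add.trans le_self_add))
  have hself := 𝒯.mem_patch_self hKT
  have hJ : ∀ γ ∈ 𝒯.sides K, ENNReal.ofReal (hK K) ^ (1 / 2 : ℝ) * 𝒯.jumpNorm γ (fun _ => r) ≤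
      CS * (m + 2 * (CE * (m + 1)) + 1) * X := by
    intro γ hγ
    have hjX : ENNReal.ofReal (hK K) ^ (1 / 2 : ℝ) * 𝒯.jumpNorm γ (osc f) ≤ X :=
      (Finset.single_le_sum (f := fun γ => ENNReal.ofReal (hK K) ^ (1 / 2 : ℝ) *
        𝒯.jumpNorm γ (osc f)) (fun _ _ => zero_le) hγ).trans le_add_self
    refine (hCS Ω hΩ 𝒯 r (osc f) A (CE * ((m + 1) * X)) K γ d q hr2 hball hKT hγ
      (fun K' hK' => (hq K' (𝒯.patch_subset K hK')).1)
      (fun K' hK' => (hq K' (𝒯.patch_subset K hK')).2) hd hd2 hD hres).trans ?_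
    calc (CS : ℝ≥0∞) * (A + 2 * (CE * ((m + 1) * X)) +
          ENNReal.ofReal (hK K) ^ (1 / 2 : ℝ) * 𝒯.jumpNorm γ (osc f))
        ≤ CS * (m * X + 2 * (CE * ((m + 1) * X)) + X) :=
          mul_le_mul' le_rfl (add_le_add (add_le_add hAX le_rfl) hjX)
      _ = _ := by ring
  calc 𝒯.curlIndicator ν f uh Th K
      ≤ ENNReal.ofReal (hK K) * curlNorm (interior (hull K)) r +
        ∑ γ ∈ 𝒯.sides K, ENNReal.ofReal (hK K) ^ (1 / 2 : ℝ) * 𝒯.jumpNorm γ (fun _ => r) :=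
        𝒯.curlIndicator_le ν f uh Th K
    _ ≤ CE * ((m + 1) * X) + 3 * (CS * (m + 2 * (CE * (m + 1)) + 1) * X) := by
        refine add_le_add ?_ ?_
        · rw [(hd K hself).curlNorm_eq isOpen_interior
            (by rw [restrict_interior_hull]; exact hd2 K hself), restrict_interior_hull]
          exact hD K hself
        · refine (Finset.sum_le_card_nsmul _ _ _ hJ).trans ?_
          rw [nsmul_eq_mul]
          exact mul_le_mul' (by exact_mod_cast 𝒯.card_sides_le hKT) le_rfl
    _ ≤ X + (CE * ((m + 1) * X) + 3 * (CS * (m + 2 * (CE * (m + 1)) + 1) * X)) := le_add_self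
    _ = _ := by push_cast; ring
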